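/- All functions of $x\in\mathbb R$ below are $2\pi$-periodic (i.e. live on $\mathbb T=\mathbb R/2\pi\mathbb Z$), and $0<\epsilon<1$. Write $c^+=\max(0,c)$, $c^-=\max(0,-c)$. Let $\phi\in C_c^\infty(\mathbb R)$ with $\int\phi=1$, $\phi_\delta(x)=\delta^{-1}\phi(x/\delta)$, and, for a velocity $u^\epsilon(x,t)$, $$A^\epsilon(t)Y(x)=\tfrac1\epsilon\big[(Yu^{\epsilon+})(x-\epsilon,t)-(Y|u^\epsilon|)(x,t)+(Yu^{\epsilon-})(x+\epsilon,t)\big].$$ A family $(U_k^\epsilon)_k$ is called a *weak asymptotic method* for the Cauchy problem $\partial_tU_k+\partial_xF_k(U)=0$, $U_k(\cdot,0)=U_{k,0}$, if $U_k^\epsilon(x,\cdot)$ is differentiable on $[0,\infty)$ (one-sidedly at $0$), $\partial_tU_k^\epsilon(\cdot,t)$ and $F_k(U^\epsilon)(\cdot,t)$ are locally integrable and, for every $\psi\in C_c^\infty(\mathbb R)$ and every $k$, as $\epsilon\to0^+$, $$\int\big[\partial_tU_k^\epsilon(x,t)\,\psi(x)-F_k(U^\epsilon)(x,t)\,\psi'(x)\big]dx\to0$$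 uniformly for $t$ in each bounded interval $[0,T]$, and $\int U^\epsilon_k(x,0)\psi(x)\,dx\to\int U_{k,0}(x)\psi(x)\,dx$. A *regularization* of $g\in L^1(\mathbb T)$ is a family of continuous functions $g^\epsilon$ on $\mathbb T$, bounded in $L^1(\mathbb T)$ uniformly in small $\epsilon$, with $g^\epsilon\to g$ in the sense of distributions as $\epsilon\to 0^+$. Let $u_0\in L^\infty(\mathbb T)$. For $\beta>0$, a *$\beta$-velocity family* for $u_0$ is a family $u^\epsilon(x,t)$, $t\ge0$, continuous in $(x,t)$ and differentiable in $x$, which is a weak asymptotic method for $\partial_tu+\partial_x(u^2)=0$, $u(\cdot,0)=u_0$, satisfies $|u^\epsilon|\le M$ with $M$ independent of $\epsilon,x,t$ and, for every $T$, $|\partial_xu^\epsilon(x,t)|\le C_T\,\epsilon^{-\beta}$ for all $x$, all $t\in[0,T]$ and all $\epsilon$. **Theorem 2.** (a) For every $u_0\in L^\infty(\mathbb T)$ there are $\nu(\epsilon)>0$ with $\nu(\epsilon)\to0$ as $\epsilon\to 0^+$ and classical solutions $u^\epsilon$ on $\mathbb R\times[0,\infty)$ of $\partial_tu^\epsilon+\partial_x((u^\epsilon)^2)=\nu(\epsilon)\,\partial_{xx}u^\epsilon$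 that form a $\beta$-velocity family for $u_0$ for every $\beta>0$. (b) Let $\beta>0$, let $(u^\epsilon)$ be any $\beta$-velocity family for $u_0$, let $v_0,w_0,Z_0\in L^1(\mathbb T)$ with regularizations $v_0^\epsilon,w_0^\epsilon,Z_0^\epsilon$, let $n\in\mathbb N$, and let $\alpha,\gamma$ satisfy $\beta<\alpha$, $\gamma>(n+2)\alpha$, $2\gamma+(n+2)\alpha<1$. Then for each $\epsilon$ the linear differential equations in the Banach space of bounded continuous $2\pi$-periodic functions $$\dot X^\epsilon=2A^\epsilon X^\epsilon,\qquad \dot w^\epsilon=2A^\epsilon w^\epsilon-2\,\partial_x\big((v^\epsilon)^n\big),\qquad \dot Z^\epsilon=2A^\epsilon Z^\epsilon-6\,\partial_x\big[(v^\epsilon w^\epsilon)*\phi_{\epsilon^\gamma}\big],$$ where $v^\epsilon=X^\epsilon*\phi_{\epsilon^\alpha}$ (convolution in $x$), with initial values $v_0^\epsilon,w_0^\epsilon,Z_0^\epsilon$, have unique global solutions on $[0,\infty)$, and $(u^\epsilon,v^\epsilon,w^\epsilon,Z^\epsilon)$ is a weak asymptotic method for $$\partial_tu+\partial_x(u^2)=0,\quad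 \partial_tv+2\partial_x(uv)=0,\quad \partial_tw+2\partial_x(uw)+2\partial_x(v^n)=0,\quad \partial_tZ+2\partial_x(uZ)+6\partial_x(vw)=0$$ with initial data $(u_0,v_0,w_0,Z_0)$. (The Panov–Shelkovich $\delta''$-system is the case $n=2$.) (c) Let $p\in\mathbb N$ and consider the $\delta^{(p)}$-system $$\partial_tU_k+\partial_x\sum_{i+j=k}\binom kiU_iU_j=0,\qquad 0\le k\le p+1,$$ with data $U_{0,0}=u_0$ and $U_{k,0}\in L^1(\mathbb T)$ ($1\le k\le p+1$), the latter with regularizations $U_{k,0}^\epsilon$. Let $\beta>0$, let $(u^\epsilon)$ be any $\beta$-velocity family for $u_0$, and let $\beta<\alpha_1$, $5\alpha_k\le\alpha_{k+1}$ for $1\le k\le p$, and $\alpha_{p+1}<1$. Put $U_0^\epsilon=u^\epsilon$ and, for $1\le k\le p+1$, $U_k^\epsilon=X_k^\epsilon*\phi_{\epsilon^{\alpha_k}}$, where $$\dot X_k^\epsilon=2A^\epsilon X_k^\epsilon-\partial_x\sum_{i+j=k,\ i,j\ge1}\binom kiU_i^\epsilon U_j^\epsilon,\qquad X_k^\epsilon(\cdot,0)=U_{k,0}^\epsilon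 .$$ These linear differential equations have unique global solutions on $[0,\infty)$ in the same Banach space, and $(U_0^\epsilon,\dots,U_{p+1}^\epsilon)$ is a weak asymptotic method for the $\delta^{(p)}$-system with data $(U_{k,0})_{0\le k\le p+1}$. -/

import Mathlib

open Set Filter Topology MeasureTheory
open scoped ContDiff ENNReal BoundedContinuousFunction

noncomputable section

namespace WeakAsymptotic

/-- A smooth compactly supported function on the line. -/
def IsTest (ψ : ℝ → ℝ) : Prop :=
  ContDiff ℝ ∞ ψ ∧ HasCompactSupport ψ

/-- A smooth compactly supported function of integral one (no sign condition). -/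
def IsMollifier (φ : ℝ → ℝ) : Prop :=
  IsTest φ ∧ ∫ x, φ x = 1

/-- `(f * φ_δ)(x)`, where `φ_δ(y) = φ(y/δ)/δ`. -/
def mollify (φ : ℝ → ℝ) (δ : ℝ) (f : ℝ → ℝ) (x : ℝ) : ℝ :=
  ∫ y, f (x - y) * (δ⁻¹ * φ (y / δ))

/-- An integrable function on the torus `ℝ / 2πℤ`, seen as a periodic function on the line. -/
def IsTorusL1 (g : ℝ → ℝ) : Prop :=
  Function.Periodic g (2 * Real.pi) ∧ LocallyIntegrable g volume

/-- A bounded measurable function on the torus (up to null sets). -/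
def IsTorusLinfty (g : ℝ → ℝ) : Prop :=
  Function.Periodic g (2 * Real.pi) ∧ MemLp g ∞ volume

/-- `g ε → g` in the sense of distributions as `ε → 0⁺`. -/
def TendstoDistrib (gε : ℝ → ℝ → ℝ) (g : ℝ → ℝ) : Prop :=
  ∀ ψ : ℝ → ℝ, IsTest ψ →
    Tendsto (fun ε => ∫ x, gε ε x * ψ x) (𝓝[>] 0) (𝓝 (∫ x, g x * ψ x))

/-- Regularized initial data: continuous, periodic, bounded in `L¹` of a period uniformly in
(small) `ε`, and converging to `g`. -/
structure IsRegularization (g : ℝ → ℝ) (gε : ℝ → ℝ → ℝ) : Prop where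
  continuous : ∀ ε ∈ Ioo (0 : ℝ) 1, Continuous (gε ε)
  periodic : ∀ ε ∈ Ioo (0 : ℝ) 1, Function.Periodic (gε ε) (2 * Real.pi)
  bounded : ∃ C : ℝ, ∀ᶠ ε in 𝓝[>] (0 : ℝ), ∫ x in (-Real.pi)..Real.pi, |gε ε x| ≤ C
  tendsto : TendstoDistrib gε g

/-- `∫ (∂ₜU ψ - F ψ') dx` at parameter `ε` and time `t`. Functions of `(ε, t, x)` are written
`U ε t x`; the time derivative is one-sided at `t = 0`. -/
def weakResidual (U F : ℝ → ℝ → ℝ → ℝ) (ψ : ℝ → ℝ) (ε t : ℝ) : ℝ :=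
  ∫ x, (derivWithin (fun s => U ε s x) (Ici 0) t * ψ x - F ε t x * deriv ψ x)

/-- The family `U ε` tends to satisfy the Cauchy problem `∂ₜU + ∂ₓF = 0`, `U(·, 0) = g`, in the
sense of distributions in `x`, uniformly for `t` in bounded intervals of `[0, ∞)`. The first three
fields say that the quantities entering the residual are meaningful. -/
structure IsWeakAsymptotic (U F : ℝ → ℝ → ℝ → ℝ) (g : ℝ → ℝ) : Prop where
  differentiable : ∀ ε ∈ Ioo (0 : ℝ) 1, ∀ t, 0 ≤ t → ∀ x,
    DifferentiableWithinAt ℝ (fun s => U ε s x) (Ici 0) t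
  locInt_deriv : ∀ ε ∈ Ioo (0 : ℝ) 1, ∀ t, 0 ≤ t →
    LocallyIntegrable (fun x => derivWithin (fun s => U ε s x) (Ici 0) t) volume
  locInt_flux : ∀ ε ∈ Ioo (0 : ℝ) 1, ∀ t, 0 ≤ t → LocallyIntegrable (F ε t) volume
  residual : ∀ ψ : ℝ → ℝ, IsTest ψ → ∀ T : ℝ,
    TendstoUniformlyOn (weakResidual U F ψ) (fun _ => 0) (𝓝[>] 0) (Icc 0 T)
  initial : TendstoDistrib (fun ε => U ε 0) g

/-- Approximate solutions of `∂ₜu + ∂ₓ(u²) = 0`, `u(·, 0) = u₀`, that are bounded uniformly in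
`(ε, t, x)` and whose `x`-derivative is `O(ε^{-β})`, uniformly in `x` and in bounded times. -/
structure IsVelocityFamily (β : ℝ) (u₀ : ℝ → ℝ) (u : ℝ → ℝ → ℝ → ℝ) : Prop where
  continuous : ∀ ε ∈ Ioo (0 : ℝ) 1,
    ContinuousOn (fun q : ℝ × ℝ => u ε q.1 q.2) (Ici 0 ×ˢ univ)
  periodic : ∀ ε ∈ Ioo (0 : ℝ) 1, ∀ t, 0 ≤ t → Function.Periodic (u ε t) (2 * Real.pi)
  differentiable : ∀ ε ∈ Ioo (0 : ℝ) 1, ∀ t, 0 ≤ t → Differentiable ℝ (u ε t)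
  bounded : ∃ M : ℝ, ∀ ε ∈ Ioo (0 : ℝ) 1, ∀ t, 0 ≤ t → ∀ x, |u ε t x| ≤ M
  deriv_bound : ∀ T : ℝ, ∃ C : ℝ, ∀ ε ∈ Ioo (0 : ℝ) 1, ∀ t ∈ Icc 0 T, ∀ x,
    |deriv (u ε t) x| ≤ C / ε ^ β
  weak : IsWeakAsymptotic u (fun ε t x => u ε t x ^ 2) u₀

/-- A classical solution on `[0, ∞) × ℝ` of `∂ₜu + ∂ₓ(u²) = ν ∂ₓₓu`. -/
def IsViscousSolution (ν : ℝ) (u : ℝ → ℝ → ℝ) : Prop :=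
  ∀ t, 0 ≤ t → ContDiff ℝ 2 (u t) ∧ ∀ x,
    HasDerivWithinAt (fun s => u s x)
      (ν * iteratedDeriv 2 (u t) x - deriv (fun y => u t y ^ 2) x) (Ici 0) t

/-- `(1/ε) [(Y c⁺)(x - ε) - (Y |c|)(x) + (Y c⁻)(x + ε)]`, with `c⁺ = max 0 c` and
`c⁻ = max 0 (-c)`. -/
def upwind (ε : ℝ) (c Y : ℝ → ℝ) (x : ℝ) : ℝ :=
  (1 / ε) * (Y (x - ε) * max 0 (c (x - ε)) - Y x * |c x| + Y (x + ε) * max 0 (-c (x + ε)))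

/-- `Y` is a global solution, in the Banach space of bounded continuous functions on the line
with the sup norm and with `2π`-periodic values, of the linear differential equation
`dY/dt = 2 upwind(Y) - S`, `Y(0) = y₀`. -/
structure IsTransportSolution (ε : ℝ) (u S : ℝ → ℝ → ℝ) (y₀ : ℝ → ℝ) (Y : ℝ → (ℝ →ᵇ ℝ)) :
    Prop where
  initial : ∀ x, Y 0 x = y₀ x
  periodic : ∀ t, 0 ≤ t → Function.Periodic (Y t) (2 * Real.pi)
  ode : ∀ t, 0 ≤ t → ∃ G : ℝ →ᵇ ℝ,
    (∀ x, G x = 2 * upwind ε (u t) (Y t) x - S t x) ∧ HasDerivWithinAt Y G (Ici 0) t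

/-- `Y` mollified in space at scale `ε^α`. -/
def smoothed (φ : ℝ → ℝ) (α : ℝ) (Y : ℝ → ℝ → (ℝ →ᵇ ℝ)) (ε t x : ℝ) : ℝ :=
  mollify φ (ε ^ α) (Y ε t) x

/-- The construction of `(X, w, Z)` from the velocity `u`, with `v = smoothed φ α X`. -/
structure IsFourConstruction (φ : ℝ → ℝ) (n : ℕ) (α γ : ℝ) (u : ℝ → ℝ → ℝ → ℝ)
    (v₀ w₀ Z₀ : ℝ → ℝ → ℝ) (X w Z : ℝ → ℝ → (ℝ →ᵇ ℝ)) : Prop where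
  X_eq : ∀ ε ∈ Ioo (0 : ℝ) 1, IsTransportSolution ε (u ε) (fun _ _ => 0) (v₀ ε) (X ε)
  w_eq : ∀ ε ∈ Ioo (0 : ℝ) 1, IsTransportSolution ε (u ε)
    (fun t x => 2 * deriv (fun y => smoothed φ α X ε t y ^ n) x) (w₀ ε) (w ε)
  Z_eq : ∀ ε ∈ Ioo (0 : ℝ) 1, IsTransportSolution ε (u ε)
    (fun t x => 6 * deriv (mollify φ (ε ^ γ) (fun y => smoothed φ α X ε t y * w ε t y)) x)
    (Z₀ ε) (Z ε)

/-- `(u, v, w, Z)` is a weak asymptotic method for the Cauchy problem of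
`∂ₜu + ∂ₓ(u²) = 0`, `∂ₜv + 2∂ₓ(uv) = 0`, `∂ₜw + 2∂ₓ(uw) + 2∂ₓ(vⁿ) = 0`,
`∂ₜZ + 2∂ₓ(uZ) + 6∂ₓ(vw) = 0`. -/
structure IsWeakAsymptoticFour (n : ℕ) (u v w Z : ℝ → ℝ → ℝ → ℝ) (u₀ v₀ w₀ Z₀ : ℝ → ℝ) :
    Prop where
  u_eq : IsWeakAsymptotic u (fun ε t x => u ε t x ^ 2) u₀
  v_eq : IsWeakAsymptotic v (fun ε t x => 2 * (u ε t x * v ε t x)) v₀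
  w_eq : IsWeakAsymptotic w (fun ε t x => 2 * (u ε t x * w ε t x) + 2 * v ε t x ^ n) w₀
  Z_eq : IsWeakAsymptotic Z
    (fun ε t x => 2 * (u ε t x * Z ε t x) + 6 * (v ε t x * w ε t x)) Z₀

/-- The flux `∑_{i+j=k} C(k,i) U_i U_j` of the `k`-th equation of the hierarchy. -/
def hierarchyFlux (U : ℕ → ℝ → ℝ → ℝ → ℝ) (k : ℕ) (ε t x : ℝ) : ℝ :=
  ∑ q ∈ Finset.HasAntidiagonal.antidiagonal k, (k.choose q.1 : ℝ) * (U q.1 ε t x * U q.2 ε t x)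

/-- The part of the flux of the `k`-th equation that involves only `U_1, …, U_{k-1}`. -/
def hierarchySource (U : ℕ → ℝ → ℝ → ℝ → ℝ) (k : ℕ) (ε t x : ℝ) : ℝ :=
  ∑ q ∈ (Finset.HasAntidiagonal.antidiagonal k).filter (fun q => 1 ≤ q.1 ∧ 1 ≤ q.2),
    (k.choose q.1 : ℝ) * (U q.1 ε t x * U q.2 ε t x)

/-- `U_0 = u`, and `U_k` is `X_k` mollified at scale `ε^{α_k}` for `k ≥ 1`. -/
def hierarchyFamily (φ : ℝ → ℝ) (α : ℕ → ℝ) (u : ℝ → ℝ → ℝ → ℝ)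
    (X : ℕ → ℝ → ℝ → (ℝ →ᵇ ℝ)) (k : ℕ) : ℝ → ℝ → ℝ → ℝ :=
  if k = 0 then u else smoothed φ (α k) (X k)

/-- The construction of `X_1, …, X_{p+1}` from the velocity `u`. -/
def IsHierarchyConstruction (φ : ℝ → ℝ) (p : ℕ) (α : ℕ → ℝ) (u : ℝ → ℝ → ℝ → ℝ)
    (y₀ : ℕ → ℝ → ℝ → ℝ) (X : ℕ → ℝ → ℝ → (ℝ →ᵇ ℝ)) : Prop :=
  ∀ k ∈ Icc 1 (p + 1), ∀ ε ∈ Ioo (0 : ℝ) 1, IsTransportSolution ε (u ε)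
    (fun t x => deriv (hierarchySource (hierarchyFamily φ α u X) k ε t) x) (y₀ k ε) (X k ε)

/-- `U_0, …, U_{p+1}` is a weak asymptotic method for the Cauchy problem of
`∂ₜU_k + ∂ₓ ∑_{i+j=k} C(k,i) U_i U_j = 0`, `0 ≤ k ≤ p + 1`. -/
def IsWeakAsymptoticHierarchy (p : ℕ) (U : ℕ → ℝ → ℝ → ℝ → ℝ) (g : ℕ → ℝ → ℝ) : Prop :=
  ∀ k ≤ p + 1, IsWeakAsymptotic (U k) (hierarchyFlux U k) (g k)

end WeakAsymptotic

end

noncomputable section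

namespace WeakAsymptotic

/-!
The upwind operator `A^ε(t)` is bounded on bounded continuous functions and depends continuously
on `t`, so each linear equation is globally and uniquely solvable. Three features of `A^ε` carry
the estimates. An explicit Euler step of the upwind scheme does not increase the `L¹` norm of a
period, hence the `L¹` norm of a solution grows only by that of its source. Against a test
function, `A^ε Y` is `-∂ₓ(uY)` up to `O(ε) ‖Y‖_{L¹}`. And mollifying at scale `ε^α` commutes with
multiplication by `u` up to `O(ε^α) ‖∂ₓu‖_∞ ‖Y‖_{L¹}`, with `‖∂ₓu‖_∞ = O(ε^{-β})` and `β < α`.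
Since `‖Y * φ_δ‖_∞ ≤ C δ⁻¹ ‖Y‖_{L¹}`, all `L¹` norms are controlled by powers of `ε`, and the
conditions on the scales are exactly what makes the residuals vanish.

Velocities as required come from the Cole–Hopf formula: with datum `u₀ * φ_ν` and viscosity
`ν = 1 / (1 - log ε)`, the maximum principle bounds `u`, and `|∂ₓu| = O(1 / ν)` grows more slowly
than any negative power of `ε`.
-/

open scoped Convolution

/-- The `L¹` norm of a `2π`-periodic function, computed over the period `[-π, π]`. -/
def periodL1 (f : ℝ → ℝ) : ℝ := ∫ x in (-Real.pi)..Real.pi, |f x|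

section PeriodL1

variable {f g : ℝ → ℝ} {B R : ℝ}

lemma neg_pi_le_pi : -Real.pi ≤ Real.pi := by linarith [Real.pi_pos]

lemma periodL1_nonneg (f : ℝ → ℝ) : 0 ≤ periodL1 f :=
  intervalIntegral.integral_nonneg neg_pi_le_pi fun _ _ => abs_nonneg _

lemma periodL1_mono (hf : Continuous f) (hg : Continuous g) (h : ∀ x, |f x| ≤ |g x|) :
    periodL1 f ≤ periodL1 g :=
  intervalIntegral.integral_mono_on neg_pi_le_pi (hf.abs.intervalIntegrable _ _)
    (hg.abs.intervalIntegrable _ _) fun x _ => h x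

lemma periodL1_sum_le {ι : Type*} (s : Finset ι) {f : ι → ℝ → ℝ}
    (hf : ∀ i ∈ s, Continuous (f i)) :
    periodL1 (fun x => ∑ i ∈ s, f i x) ≤ ∑ i ∈ s, periodL1 (f i) := by
  unfold periodL1
  rw [← intervalIntegral.integral_finsetSum fun i hi => (hf i hi).abs.intervalIntegrable _ _]
  exact intervalIntegral.integral_mono_on neg_pi_le_pi
    ((continuous_finsetSum s hf).abs.intervalIntegrable _ _)
    ((continuous_finsetSum s fun i hi => (hf i hi).abs).intervalIntegrable _ _)
    fun x _ => Finset.abs_sum_le_sum_abs _ _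

lemma periodL1_add_le (hf : Continuous f) (hg : Continuous g) :
    periodL1 (fun x => f x + g x) ≤ periodL1 f + periodL1 g := by
  simpa using periodL1_sum_le (Finset.univ : Finset Bool) (f := fun b => bif b then f else g)
    (Bool.rec (fun _ => hg) fun _ => hf)

lemma periodL1_const_mul (c : ℝ) (f : ℝ → ℝ) :
    periodL1 (fun x => c * f x) = |c| * periodL1 f := by
  simp [periodL1, abs_mul]

lemma periodL1_mul_le (hf : Continuous f) (hg : Continuous g) (hB : ∀ x, |f x| ≤ B) :
    periodL1 (fun x => f x * g x) ≤ B * periodL1 g := by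
  have hB0 : 0 ≤ B := (abs_nonneg _).trans (hB 0)
  rw [← abs_of_nonneg hB0, ← periodL1_const_mul]
  refine periodL1_mono (hf.mul hg) (continuous_const.mul hg) fun x => ?_
  rw [abs_mul, abs_mul, abs_of_nonneg hB0]
  exact mul_le_mul_of_nonneg_right (hB x) (abs_nonneg _)

lemma periodL1_le_of_abs_le (hf : Continuous f) (hB : ∀ x, |f x| ≤ B) :
    periodL1 f ≤ 2 * Real.pi * B :=
  calc periodL1 f ≤ ∫ _ in (-Real.pi)..Real.pi, B :=
        intervalIntegral.integral_mono_on neg_pi_le_pi (hf.abs.intervalIntegrable _ _)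
          (continuous_const.intervalIntegrable _ _) fun x _ => hB x
    _ = 2 * Real.pi * B := by
        rw [intervalIntegral.integral_const, smul_eq_mul]
        ring

lemma intervalIntegral_add_two_pi (hf : Function.Periodic f (2 * Real.pi)) (a : ℝ) :
    ∫ x in a..a + 2 * Real.pi, f x = ∫ x in (-Real.pi)..Real.pi, f x := by
  rw [hf.intervalIntegral_add_eq a (-Real.pi)]
  congr 1
  ring

lemma periodL1_comp_add (hf : Function.Periodic f (2 * Real.pi)) (a : ℝ) :
    periodL1 (fun x => f (x + a)) = periodL1 f := by
  unfold periodL1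
  rw [intervalIntegral.integral_comp_add_right (fun x => |f x|)]
  refine Eq.trans ?_ (intervalIntegral_add_two_pi (hf.comp abs) (-Real.pi + a))
  congr 1
  ring

lemma periodL1_comp_sub_left (hf : Function.Periodic f (2 * Real.pi)) (a : ℝ) :
    periodL1 (fun x => f (a - x)) = periodL1 f := by
  unfold periodL1
  rw [intervalIntegral.integral_comp_sub_left (fun x => |f x|)]
  refine Eq.trans ?_ (intervalIntegral_add_two_pi (hf.comp abs) (a - Real.pi))
  congr 1
  ring

lemma intervalIntegral_abs_nat_mul_pi (hf : LocallyIntegrable f)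
    (hp : Function.Periodic f (2 * Real.pi)) (m : ℕ) :
    ∫ x in (-(m * Real.pi))..m * Real.pi, |f x| = m * periodL1 f := by
  have hint : ∀ a b, IntervalIntegrable (fun x => |f x|) volume a b := fun a b =>
    (intervalIntegrable_iff.2 ((hf.integrableOn_isCompact isCompact_uIcc).mono_set
      uIoc_subset_uIcc)).norm
  have hend : -(m * Real.pi) + (m : ℤ) • (2 * Real.pi) = m * Real.pi := by
    rw [zsmul_eq_mul, Int.cast_natCast]
    ring
  have h := (hp.comp abs).intervalIntegral_add_zsmul_eq m (-(m * Real.pi)) hint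
  rwa [hend, intervalIntegral_add_two_pi (hp.comp abs), zsmul_eq_mul, Int.cast_natCast] at h

lemma abs_integral_mul_le_periodL1 (hf : LocallyIntegrable f)
    (hp : Function.Periodic f (2 * Real.pi)) (hg : ∀ x, R < |x| → g x = 0)
    (hB : ∀ x, |g x| ≤ B) :
    |∫ x, f x * g x| ≤ ⌈R / Real.pi⌉₊ * B * periodL1 f := by
  set a : ℝ := ⌈R / Real.pi⌉₊ * Real.pi with ha
  have hRa : R ≤ a := (div_le_iff₀ Real.pi_pos).1 (Nat.le_ceil _)
  have ha0 : -a ≤ a := neg_le_self (by positivity)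
  have hint : IntegrableOn (fun x => B * |f x|) (Icc (-a) a) :=
    (hf.integrableOn_isCompact isCompact_Icc).norm.const_mul B
  have hpt : ∀ x, ‖f x * g x‖ ≤ (Icc (-a) a).indicator (fun x => B * |f x|) x := fun x => by
    by_cases hx : x ∈ Icc (-a) a
    · rw [indicator_of_mem hx, Real.norm_eq_abs, abs_mul, mul_comm]
      exact mul_le_mul_of_nonneg_right (hB x) (abs_nonneg _)
    · rw [indicator_of_notMem hx,
        hg x (hRa.trans_lt (not_le.1 fun h => hx (abs_le.1 h))), mul_zero, norm_zero]
  calc |∫ x, f x * g x| ≤ ∫ x, (Icc (-a) a).indicator (fun x => B * |f x|) x :=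
        norm_integral_le_of_norm_le (hint.integrable_indicator measurableSet_Icc)
          (Eventually.of_forall hpt)
    _ = B * ∫ x in (-a)..a, |f x| := by
        rw [integral_indicator measurableSet_Icc, integral_Icc_eq_integral_Ioc,
          ← intervalIntegral.integral_of_le ha0, intervalIntegral.integral_const_mul]
    _ = ⌈R / Real.pi⌉₊ * B * periodL1 f := by
        rw [ha, intervalIntegral_abs_nat_mul_pi hf hp]
        ring

lemma exists_abs_le_of_periodic (hf : Continuous f) (hp : Function.Periodic f (2 * Real.pi)) :
    ∃ M : ℝ, 0 ≤ M ∧ ∀ x, |f x| ≤ M := by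
  obtain ⟨M, hM0, hM⟩ := (hp.compact_of_continuous Real.two_pi_pos.ne' hf).isBounded
    |>.exists_pos_norm_le
  exact ⟨M, hM0.le, fun x => hM _ (mem_range_self x)⟩

end PeriodL1

/-- The rescaled kernel `k_δ(y) = k(y/δ)/δ`. -/
def rescale (k : ℝ → ℝ) (δ y : ℝ) : ℝ := δ⁻¹ * k (y / δ)

namespace IsTest

variable {k : ℝ → ℝ} {δ : ℝ}

lemma continuous (hk : IsTest k) : Continuous k := hk.1.continuous

lemma differentiable (hk : IsTest k) : Differentiable ℝ k := hk.1.differentiable (by simp)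

lemma integrable (hk : IsTest k) : Integrable k :=
  hk.continuous.integrable_of_hasCompactSupport hk.2

lemma deriv (hk : IsTest k) : IsTest (deriv k) := ⟨hk.1.deriv', hk.2.deriv⟩

lemma comp_neg (hk : IsTest k) : IsTest (fun x => k (-x)) :=
  ⟨hk.1.comp contDiff_neg, hk.2.comp_homeomorph (Homeomorph.neg ℝ)⟩

lemma rescale (hk : IsTest k) (hδ : δ ≠ 0) : IsTest (rescale k δ) := by
  refine ⟨contDiff_const.mul (hk.1.comp (contDiff_id.div_const δ)), HasCompactSupport.mul_left ?_⟩
  simpa [Function.comp_def, div_eq_mul_inv] using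
    hk.2.comp_homeomorph (Homeomorph.mulRight₀ δ⁻¹ (inv_ne_zero hδ))

lemma exists_bound (hk : IsTest k) : ∃ B : ℝ, ∀ x, |k x| ≤ B :=
  hk.2.exists_bound_of_continuous hk.continuous

lemma exists_support_bound (hk : IsTest k) : ∃ R : ℝ, 0 < R ∧ ∀ x, R < |x| → k x = 0 := by
  obtain ⟨R, hR0, hR⟩ := hk.2.isCompact.isBounded.exists_pos_norm_le
  refine ⟨R, hR0, fun x hx => ?_⟩
  by_contra h
  exact absurd (hR x (subset_tsupport _ h)) (not_le.2 hx)

lemma integrable_abs_mul_abs (hk : IsTest k) : Integrable (fun z => |z| * |k z|) :=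
  (continuous_abs.mul hk.continuous.abs).integrable_of_hasCompactSupport hk.2.norm.mul_left

lemma integrable_comp_sub_mul (hk : IsTest k) {f : ℝ → ℝ} {M : ℝ} (hf : Continuous f)
    (hM : ∀ x, |f x| ≤ M) (x δ : ℝ) : Integrable (fun z => f (x - δ * z) * k z) :=
  hk.integrable.bdd_mul (c := M) (by fun_prop) (Eventually.of_forall fun _ => hM _)

end IsTest

lemma deriv_eq_zero_of_support {k : ℝ → ℝ} {R : ℝ} (h : ∀ x, R < |x| → k x = 0) (x : ℝ)
    (hx : R < |x|) : deriv k x = 0 := by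
  have : k =ᶠ[𝓝 x] fun _ => 0 := by
    filter_upwards [(isOpen_lt continuous_const continuous_abs).mem_nhds hx] with y hy
    exact h y hy
  rw [this.deriv_eq, deriv_const]

section Rescale

variable {k : ℝ → ℝ} {δ : ℝ}

lemma deriv_rescale (hk : IsTest k) (δ : ℝ) :
    deriv (rescale k δ) = fun y => δ⁻¹ * rescale (deriv k) δ y := by
  funext y
  have h : HasDerivAt (rescale k δ) (δ⁻¹ * (deriv k (y / δ) * (1 / δ))) y :=
    (HasDerivAt.comp y (hk.differentiable (y / δ)).hasDerivAt
      ((hasDerivAt_id y).div_const δ)).const_mul δ⁻¹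
  rw [h.deriv, rescale]
  ring

lemma integral_comp_mul_rescale (hδ : 0 < δ) (k h : ℝ → ℝ) :
    ∫ y, h y * rescale k δ y = ∫ z, h (δ * z) * k z := by
  have hsub := Measure.integral_comp_div (fun z => h (δ * z) * k z) δ
  simp only [mul_div_cancel₀ _ hδ.ne', abs_of_pos hδ, smul_eq_mul] at hsub
  rw [← inv_mul_cancel_left₀ hδ.ne' (∫ z, h (δ * z) * k z), ← hsub, ← integral_const_mul]
  congr 1
  funext y
  rw [rescale]
  ring

lemma integral_abs_rescale (hδ : 0 < δ) (k : ℝ → ℝ) :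
    ∫ y, |rescale k δ y| = ∫ z, |k z| := by
  simpa [rescale, abs_mul, abs_of_pos hδ] using
    integral_comp_mul_rescale hδ (fun z => |k z|) fun _ => 1

end Rescale

section Mollify

variable {k φ f g : ℝ → ℝ} {δ L B M : ℝ}

lemma mollify_eq_convolution (k : ℝ → ℝ) (δ : ℝ) (f : ℝ → ℝ) :
    mollify k δ f = rescale k δ ⋆[ContinuousLinearMap.mul ℝ ℝ] f := by
  ext x
  simp only [mollify, convolution_def, ContinuousLinearMap.mul_apply', rescale, mul_comm]

lemma mollify_eq_integral (k : ℝ → ℝ) (hδ : 0 < δ) (f : ℝ → ℝ) (x : ℝ) :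
    mollify k δ f x = ∫ z, f (x - δ * z) * k z :=
  integral_comp_mul_rescale hδ k fun y => f (x - y)

lemma continuous_mollify (hk : IsTest k) (hδ : 0 < δ) (hf : LocallyIntegrable f) :
    Continuous (mollify k δ f) := by
  rw [mollify_eq_convolution]
  exact (hk.rescale hδ.ne').2.continuous_convolution_left _ (hk.rescale hδ.ne').continuous hf

lemma contDiff_mollify (hk : IsTest k) (hδ : 0 < δ) (hf : LocallyIntegrable f) :
    ContDiff ℝ ∞ (mollify k δ f) := by
  rw [mollify_eq_convolution]
  exact (hk.rescale hδ.ne').2.contDiff_convolution_left _ (hk.rescale hδ.ne').1 hf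

lemma hasDerivAt_mollify (hk : IsTest k) (hδ : 0 < δ) (hf : LocallyIntegrable f) (x : ℝ) :
    HasDerivAt (mollify k δ f) (δ⁻¹ * mollify (deriv k) δ f x) x := by
  have hs := hk.rescale hδ.ne'
  have h := hs.2.hasDerivAt_convolution_left (ContinuousLinearMap.mul ℝ ℝ)
    (hs.1.of_le (by simp)) hf x
  rw [← mollify_eq_convolution] at h
  refine h.congr_deriv ?_
  simp only [mollify_eq_convolution, convolution_def, ContinuousLinearMap.mul_apply',
    deriv_rescale hk, mul_assoc, integral_const_mul]

lemma hasDerivAt_mollify_of_test (hk : IsTest k) (hδ : 0 < δ) (hf : IsTest f) (x : ℝ) :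
    HasDerivAt (mollify k δ f) (mollify k δ (deriv f) x) x := by
  have h := hf.2.hasDerivAt_convolution_right (ContinuousLinearMap.mul ℝ ℝ)
    ((hk.rescale hδ.ne').continuous.locallyIntegrable (μ := volume)) (hf.1.of_le (by simp)) x
  rwa [← mollify_eq_convolution, ← mollify_eq_convolution] at h

lemma mollify_periodic (k : ℝ → ℝ) (δ : ℝ) {c : ℝ} (hf : Function.Periodic f c) :
    Function.Periodic (mollify k δ f) c := fun x => by
  simp only [mollify, add_sub_right_comm, hf _]

lemma mollify_eq_zero_of_support {R R' : ℝ} (hδ : 0 < δ) (hδ1 : δ ≤ 1)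
    (hk : ∀ x, R' < |x| → k x = 0) (hf : ∀ x, R < |x| → f x = 0) (x : ℝ)
    (hx : R + R' < |x|) : mollify k δ f x = 0 := by
  rw [mollify_eq_integral k hδ]
  refine integral_eq_zero_of_ae (Eventually.of_forall fun z => ?_)
  by_cases hz : R' < |z|
  · simp [hk z hz]
  · have hδz : |δ * z| ≤ |z| := by
      rw [abs_mul, abs_of_pos hδ]
      exact mul_le_of_le_one_left (abs_nonneg z) hδ1
    have htri : |x| ≤ |x - δ * z| + |δ * z| := by simpa using abs_add_le (x - δ * z) (δ * z)
    simp [hf (x - δ * z) (by linarith)]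

lemma IsTest.mollify (hk : IsTest k) (hf : IsTest f) (hδ : 0 < δ) : IsTest (mollify k δ f) := by
  refine ⟨contDiff_mollify hk hδ hf.continuous.locallyIntegrable, ?_⟩
  rw [mollify_eq_convolution]
  exact (hk.rescale hδ.ne').2.convolution _ hf.2

lemma abs_mollify_le (hk : IsTest k) (hδ : 0 < δ) (hB : ∀ᵐ x, |f x| ≤ B) (x : ℝ) :
    |mollify k δ f x| ≤ B * ∫ z, |k z| := by
  have hB' : ∀ᵐ y, |f (x - y)| ≤ B :=
    (Measure.measurePreserving_sub_left volume x).quasiMeasurePreserving.ae hB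
  rw [← integral_abs_rescale hδ k, ← integral_const_mul]
  rw [← Real.norm_eq_abs]
  refine norm_integral_le_of_norm_le ((hk.rescale hδ.ne').integrable.norm.const_mul B) ?_
  filter_upwards [hB'] with y hy
  rw [Real.norm_eq_abs, abs_mul]
  exact mul_le_mul_of_nonneg_right hy (abs_nonneg _)

lemma abs_mul_mollify_sub_le (hk : IsTest k) (hδ : 0 < δ) {u : ℝ → ℝ} (hL0 : 0 ≤ L)
    (hu : Continuous u) (hL : ∀ x y, |u x - u y| ≤ L * |x - y|) (hM : ∀ x, |u x| ≤ M)
    (hf : Continuous f) (hB : ∀ x, |f x| ≤ B) (x : ℝ) :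
    |u x * mollify k δ f x - mollify k δ (fun y => u y * f y) x| ≤
      L * B * (∫ z, |z| * |k z|) * δ := by
  have huf : ∀ y, |u y * f y| ≤ M * B := fun y => by
    rw [abs_mul]
    exact mul_le_mul (hM y) (hB y) (abs_nonneg _) ((abs_nonneg _).trans (hM 0))
  have hpt : ∀ z, ‖u x * (f (x - δ * z) * k z) - u (x - δ * z) * f (x - δ * z) * k z‖ ≤
      L * B * δ * (|z| * |k z|) := fun z =>
    calc _ = |u x - u (x - δ * z)| * |f (x - δ * z)| * |k z| := by
          rw [Real.norm_eq_abs, ← abs_mul, ← abs_mul]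
          ring_nf
      _ ≤ L * |x - (x - δ * z)| * B * |k z| := by
          gcongr
          exacts [hL _ _, hB _]
      _ = L * B * δ * (|z| * |k z|) := by
          rw [sub_sub_cancel, abs_mul, abs_of_pos hδ]
          ring
  rw [mollify_eq_integral k hδ, mollify_eq_integral k hδ, ← integral_const_mul,
    ← integral_sub ((hk.integrable_comp_sub_mul hf hB x δ).const_mul _)
      (hk.integrable_comp_sub_mul (f := fun y => u y * f y) (hu.mul hf) huf x δ), mul_right_comm,
    ← integral_const_mul]
  exact norm_integral_le_of_norm_le (hk.integrable_abs_mul_abs.const_mul _)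
    (Eventually.of_forall hpt)

lemma mollify_const (hφ : IsMollifier φ) (hδ : 0 < δ) (c x : ℝ) :
    mollify φ δ (fun _ => c) x = c := by
  rw [mollify_eq_integral φ hδ, integral_const_mul, hφ.2, mul_one]

lemma abs_mollify_sub_le (hφ : IsMollifier φ) (hδ : 0 < δ) (hL0 : 0 ≤ L) (hf : Continuous f)
    (hL : ∀ x y, |f x - f y| ≤ L * |x - y|) (hM : ∀ x, |f x| ≤ M) (x : ℝ) :
    |mollify φ δ f x - f x| ≤ L * (∫ z, |z| * |φ z|) * δ := by
  have h := abs_mul_mollify_sub_le (f := fun _ => 1) (B := 1) hφ.1 hδ hL0 hf hL hM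
    continuous_const (by simp) x
  rw [mollify_const hφ hδ] at h
  rw [abs_sub_comm]
  simpa using h

lemma IsMollifier.comp_neg (hφ : IsMollifier φ) : IsMollifier (fun x => φ (-x)) :=
  ⟨hφ.1.comp_neg, by rw [integral_neg_eq_self]; exact hφ.2⟩

-- Both sides are `(f ⋆ k_δ ⋆ g(-·))(0)`, so this is the associativity of convolution.
lemma integral_mollify_mul (hk : IsTest k) (hδ : 0 < δ) (hf : LocallyIntegrable f)
    (hg : Continuous g) (hgs : HasCompactSupport g) :
    ∫ x, mollify k δ f x * g x = ∫ x, f x * mollify (fun y => k (-y)) δ g x := by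
  have hK := hk.rescale hδ.ne'
  have hg' : Continuous fun x => g (-x) := hg.comp continuous_neg
  have hgs' : HasCompactSupport fun x => g (-x) := hgs.comp_homeomorph (Homeomorph.neg ℝ)
  have hKg := hgs'.norm.continuous_convolution_right (ContinuousLinearMap.mul ℝ ℝ)
    hK.continuous.norm.locallyIntegrable hg'.norm (μ := volume)
  have hassoc := convolution_assoc (x₀ := 0) (μ := volume) (ν := volume)
    (ContinuousLinearMap.mul ℝ ℝ) (ContinuousLinearMap.mul ℝ ℝ) (ContinuousLinearMap.mul ℝ ℝ)
    (ContinuousLinearMap.mul ℝ ℝ) mul_assoc hf.aestronglyMeasurable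
    hK.continuous.aestronglyMeasurable hg'.aestronglyMeasurable
    (Eventually.of_forall (hK.2.convolutionExists_right _ hf hK.continuous))
    (Eventually.of_forall (hgs'.norm.convolutionExists_right _
      hK.continuous.norm.locallyIntegrable hg'.norm))
    ((hK.2.norm.convolution _ hgs'.norm).convolutionExists_right _
      (fun x => (hf x).norm) hKg 0)
  have hcomm : f ⋆[ContinuousLinearMap.mul ℝ ℝ] rescale k δ = mollify k δ f := by
    rw [mollify_eq_convolution, ← convolution_flip]
    congr 1
    ext
    simp
  have hreflect : ∀ t, (rescale k δ ⋆[ContinuousLinearMap.mul ℝ ℝ] fun x => g (-x)) (0 - t) =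
      mollify (fun y => k (-y)) δ g t := fun t => by
    rw [mollify_eq_convolution, convolution_def, convolution_def, ← integral_neg_eq_self]
    congr 1
    funext y
    simp [rescale, neg_div, sub_eq_add_neg, add_comm]
  calc ∫ x, mollify k δ f x * g x
      = (mollify k δ f ⋆[ContinuousLinearMap.mul ℝ ℝ] fun x => g (-x)) 0 := by
        simp [convolution_def]
    _ = (f ⋆[ContinuousLinearMap.mul ℝ ℝ] rescale k δ ⋆[ContinuousLinearMap.mul ℝ ℝ]
          fun x => g (-x)) 0 := by rw [← hcomm, hassoc]
    _ = ∫ x, f x * mollify (fun y => k (-y)) δ g x := by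
        rw [convolution_def]
        simp only [hreflect, ContinuousLinearMap.mul_apply']

lemma exists_mollify_sup_bound (hk : IsTest k) : ∃ C : ℝ, 0 ≤ C ∧ ∀ (δ : ℝ) (f : ℝ → ℝ),
    0 < δ → δ ≤ 1 → Continuous f → Function.Periodic f (2 * Real.pi) →
    ∀ x, |mollify k δ f x| ≤ C * δ⁻¹ * periodL1 f := by
  obtain ⟨R, hR0, hR⟩ := hk.exists_support_bound
  obtain ⟨B, hB⟩ := hk.exists_bound
  have hB0 : 0 ≤ B := (abs_nonneg _).trans (hB 0)
  refine ⟨⌈R / Real.pi⌉₊ * B, by positivity, fun δ f hδ hδ1 hf hp x => ?_⟩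
  have hsupp : ∀ y, R < |y| → rescale k δ y = 0 := fun y hy => by
    rw [rescale, hR, mul_zero]
    rw [abs_div, abs_of_pos hδ]
    exact hy.trans_le (le_div_self (abs_nonneg y) hδ hδ1)
  have hbound : ∀ y, |rescale k δ y| ≤ δ⁻¹ * B := fun y => by
    rw [rescale, abs_mul, abs_of_pos (inv_pos.2 hδ)]
    exact mul_le_mul_of_nonneg_left (hB _) (inv_pos.2 hδ).le
  have hshift : Function.Periodic (fun y => f (x - y)) (2 * Real.pi) := fun y => by
    simp only [← sub_sub, hp.sub_eq]
  have h := abs_integral_mul_le_periodL1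
    (by fun_prop : Continuous fun y => f (x - y)).locallyIntegrable hshift hsupp hbound
  rw [periodL1_comp_sub_left hp] at h
  exact h.trans_eq (by ring)

lemma integrable_abs_comp_sub_mul (hk : IsTest k) (hf : Continuous f) (hM : ∀ x, |f x| ≤ M)
    (a b : ℝ) : Integrable (Function.uncurry fun x y => |f (x - y)| * |k y|)
      ((volume.restrict (Ioc a b)).prod volume) := by
  have h : Integrable (fun p : ℝ × ℝ => (1 : ℝ) * |k p.2|)
      ((volume.restrict (Ioc a b)).prod volume) :=
    (integrable_const (1 : ℝ)).mul_prod hk.integrable.norm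
  simpa only [one_mul, Function.uncurry_def] using
    h.bdd_mul (f := fun p : ℝ × ℝ => |f (p.1 - p.2)|) (c := M)
      (by fun_prop) (Eventually.of_forall fun p => by simpa using hM (p.1 - p.2))

lemma periodL1_mollify_le (hk : IsTest k) (hδ : 0 < δ) (hf : Continuous f)
    (hp : Function.Periodic f (2 * Real.pi)) :
    periodL1 (mollify k δ f) ≤ (∫ z, |k z|) * periodL1 f := by
  have hK := hk.rescale hδ.ne'
  obtain ⟨M, -, hM⟩ := exists_abs_le_of_periodic hf hp
  have hint := integrable_abs_comp_sub_mul hK hf hM (-Real.pi) Real.pi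
  have hmol : IntegrableOn (fun x => |mollify k δ f x|) (Ioc (-Real.pi) Real.pi) :=
    (continuous_mollify hk hδ hf.locallyIntegrable).abs.integrableOn_Ioc
  have hpt : ∀ x, |mollify k δ f x| ≤ ∫ y, |f (x - y)| * |rescale k δ y| := fun x => by
    simp only [← abs_mul]
    exact norm_integral_le_integral_norm fun y => f (x - y) * rescale k δ y
  have hinner : ∀ y, ∫ x in Ioc (-Real.pi) Real.pi, |f (x - y)| = periodL1 f := fun y => by
    rw [← intervalIntegral.integral_of_le neg_pi_le_pi, ← periodL1_comp_add hp (-y)]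
    rfl
  calc periodL1 (mollify k δ f)
      = ∫ x in Ioc (-Real.pi) Real.pi, |mollify k δ f x| :=
        intervalIntegral.integral_of_le neg_pi_le_pi
    _ ≤ ∫ x in Ioc (-Real.pi) Real.pi, ∫ y, |f (x - y)| * |rescale k δ y| :=
        integral_mono hmol hint.integral_prod_left hpt
    _ = ∫ y, ∫ x in Ioc (-Real.pi) Real.pi, |f (x - y)| * |rescale k δ y| :=
        integral_integral_swap hint
    _ = (∫ z, |k z|) * periodL1 f := by
        simp only [integral_mul_const, hinner]
        rw [integral_const_mul, integral_abs_rescale hδ, mul_comm]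

end Mollify

section LinearODE

variable {E : Type*} [NormedAddCommGroup E] [NormedSpace ℝ E] {A : ℝ → E →L[ℝ] E} {b : ℝ → E}

/-- The terms of the Picard series of the linear equation `y' = A t y + b t`, `y 0 = y₀`. -/
def picardTerm (A : ℝ → E →L[ℝ] E) (b : ℝ → E) (y₀ : E) : ℕ → ℝ → E
  | 0, t => y₀ + ∫ s in (0 : ℝ)..t, b s
  | n + 1, t => ∫ s in (0 : ℝ)..t, A s (picardTerm A b y₀ n s)

lemma integral_cosh_mul {a : ℝ} (ha : a ≠ 0) (t : ℝ) :
    ∫ s in (0 : ℝ)..t, Real.cosh (a * s) = Real.sinh (a * t) / a := by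
  have h : ∀ s ∈ uIcc 0 t, HasDerivAt (fun s => Real.sinh (a * s) / a) (Real.cosh (a * s)) s :=
    fun s _ => (((hasDerivAt_id s).const_mul a).sinh.div_const a).congr_deriv (by field_simp; simp)
  rw [intervalIntegral.integral_eq_sub_of_hasDerivAt h
    (Continuous.intervalIntegrable (by fun_prop) _ _)]
  simp

-- The weight `cosh (2Kt)` makes the Volterra operator a contraction with factor `1/2`.
lemma norm_integral_clm_apply_le {K C T : ℝ} (hK : 0 < K) (hA : ∀ t ∈ Icc (-T) T, ‖A t‖ ≤ K)
    {g : ℝ → E} (hg : ∀ t ∈ Icc (-T) T, ‖g t‖ ≤ C * Real.cosh (2 * K * t)) {t : ℝ}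
    (ht : t ∈ Icc (-T) T) :
    ‖∫ s in (0 : ℝ)..t, A s (g s)‖ ≤ C * (1 / 2) * Real.cosh (2 * K * t) := by
  have hC : 0 ≤ C :=
    nonneg_of_mul_nonneg_left ((norm_nonneg _).trans (hg t ht)) (Real.cosh_pos _)
  have hsub : uIoc 0 t ⊆ Icc (-T) T :=
    uIoc_subset_uIcc.trans (uIcc_subset_Icc (by constructor <;> linarith [ht.1, ht.2]) ht)
  have hbound : ∀ᵐ s ∂volume.restrict (uIoc 0 t),
      ‖A s (g s)‖ ≤ K * C * Real.cosh (2 * K * s) := by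
    filter_upwards [ae_restrict_mem measurableSet_uIoc] with s hs
    calc ‖A s (g s)‖ ≤ ‖A s‖ * ‖g s‖ := (A s).le_opNorm _
      _ ≤ K * (C * Real.cosh (2 * K * s)) :=
        mul_le_mul (hA s (hsub hs)) (hg s (hsub hs)) (norm_nonneg _) hK.le
      _ = K * C * Real.cosh (2 * K * s) := (mul_assoc _ _ _).symm
  calc ‖∫ s in (0 : ℝ)..t, A s (g s)‖
      ≤ |∫ s in (0 : ℝ)..t, K * C * Real.cosh (2 * K * s)| :=
        intervalIntegral.norm_integral_le_abs_of_norm_le hbound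
          (Continuous.intervalIntegrable (by fun_prop) _ _)
    _ = C * (1 / 2) * |Real.sinh (2 * K * t)| := by
        rw [intervalIntegral.integral_const_mul, integral_cosh_mul (by positivity), abs_mul,
          abs_div, abs_of_nonneg (by positivity : 0 ≤ K * C),
          abs_of_pos (by positivity : 0 < 2 * K)]
        field_simp
    _ ≤ C * (1 / 2) * Real.cosh (2 * K * t) := by
        rw [Real.abs_sinh, ← Real.cosh_abs]
        gcongr
        exact (Real.sinh_lt_cosh _).le

theorem eq_of_hasDerivWithinAt_clm_apply_add (hA : ContinuousOn A (Ici 0)) {y z : ℝ → E}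
    (hy : ∀ t, 0 ≤ t → HasDerivWithinAt y (A t (y t) + b t) (Ici 0) t)
    (hz : ∀ t, 0 ≤ t → HasDerivWithinAt z (A t (z t) + b t) (Ici 0) t)
    (h0 : y 0 = z 0) {t : ℝ} (ht : 0 ≤ t) : y t = z t := by
  obtain ⟨K, hK⟩ := isCompact_Icc.exists_bound_of_continuousOn
    (hA.mono (Icc_subset_Ici_self : Icc 0 t ⊆ Ici 0))
  have hL : ∀ s ∈ Ico 0 t, LipschitzOnWith K.toNNReal (fun x => A s x + b s) univ :=
    fun s hs => by
      have hs' := hK s (Ico_subset_Icc_self hs)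
      refine LipschitzOnWith.of_dist_le_mul fun x _ x' _ => ?_
      rw [dist_add_right, dist_eq_norm, dist_eq_norm, ← map_sub,
        Real.coe_toNNReal _ ((norm_nonneg _).trans hs')]
      exact ((A s).le_opNorm _).trans (mul_le_mul_of_nonneg_right hs' (norm_nonneg _))
  have hcont : ∀ w : ℝ → E, (∀ t, 0 ≤ t → HasDerivWithinAt w (A t (w t) + b t) (Ici 0) t) →
      ContinuousOn w (Icc 0 t) := fun w hw s hs =>
    (hw s hs.1).continuousWithinAt.mono Icc_subset_Ici_self
  exact ODE_solution_unique_of_mem_Icc_right hL (hcont y hy)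
    (fun s hs => (hy s hs.1).mono (Ici_subset_Ici.2 hs.1)) (fun _ _ => mem_univ _) (hcont z hz)
    (fun s hs => (hz s hs.1).mono (Ici_subset_Ici.2 hs.1)) (fun _ _ => mem_univ _) h0
    ⟨ht, le_rfl⟩

variable [CompleteSpace E]

lemma hasDerivAt_integral_of_continuous {g : ℝ → E} (hg : Continuous g) (t : ℝ) :
    HasDerivAt (fun t => ∫ s in (0 : ℝ)..t, g s) (g t) t :=
  intervalIntegral.integral_hasDerivAt_right (hg.intervalIntegrable _ _)
    (hg.stronglyMeasurableAtFilter _ _) hg.continuousAt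

lemma continuous_picardTerm (hA : Continuous A) (hb : Continuous b) (y₀ : E) (n : ℕ) :
    Continuous (picardTerm A b y₀ n) := by
  induction n with
  | zero => exact continuous_iff_continuousAt.2 fun t =>
      ((hasDerivAt_integral_of_continuous hb t).const_add y₀).continuousAt
  | succ n ih => exact continuous_iff_continuousAt.2 fun t =>
      (hasDerivAt_integral_of_continuous (hA.clm_apply ih) t).continuousAt

lemma hasDerivAt_picardTerm_zero (hb : Continuous b) (y₀ : E) (t : ℝ) :
    HasDerivAt (picardTerm A b y₀ 0) (b t) t :=
  (hasDerivAt_integral_of_continuous hb t).const_add y₀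

lemma hasDerivAt_picardTerm_succ (hA : Continuous A) (hb : Continuous b) (y₀ : E) (n : ℕ)
    (t : ℝ) : HasDerivAt (picardTerm A b y₀ (n + 1)) (A t (picardTerm A b y₀ n t)) t :=
  hasDerivAt_integral_of_continuous (hA.clm_apply (continuous_picardTerm hA hb y₀ n)) t

lemma exists_norm_picardTerm_le (hA : Continuous A) (hb : Continuous b) (y₀ : E) (T : ℝ) :
    ∃ C : ℝ, ∀ n, ∀ t ∈ Icc (-T) T, ‖picardTerm A b y₀ n t‖ ≤ C * (1 / 2) ^ n := by
  obtain ⟨K, hK⟩ := isCompact_Icc.exists_bound_of_continuousOn (s := Icc (-T) T) hA.continuousOn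
  obtain ⟨C, hC⟩ := isCompact_Icc.exists_bound_of_continuousOn (s := Icc (-T) T)
    (continuous_picardTerm hA hb y₀ 0).continuousOn
  set L : ℝ := max K 1
  have hL : 0 < L := lt_max_of_lt_right one_pos
  have hweighted : ∀ n, ∀ t ∈ Icc (-T) T,
      ‖picardTerm A b y₀ n t‖ ≤ C * (1 / 2) ^ n * Real.cosh (2 * L * t) := fun n => by
    induction n with
    | zero =>
        intro t ht
        simpa using (hC t ht).trans (le_mul_of_one_le_right ((norm_nonneg _).trans (hC t ht))
          (Real.one_le_cosh _))
    | succ n ih =>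
        intro t ht
        rw [pow_succ, ← mul_assoc]
        exact norm_integral_clm_apply_le hL (fun t ht => (hK t ht).trans (le_max_left _ _)) ih ht
  refine ⟨C * Real.cosh (2 * L * T), fun n t ht => (hweighted n t ht).trans ?_⟩
  have hC0 : 0 ≤ C := (norm_nonneg _).trans (hC t ht)
  have hcosh : Real.cosh (2 * L * t) ≤ Real.cosh (2 * L * T) := by
    rw [Real.cosh_le_cosh, abs_mul (2 * L) t, abs_mul (2 * L) T]
    exact mul_le_mul_of_nonneg_left ((abs_le.2 ht).trans (le_abs_self T)) (abs_nonneg _)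
  rw [mul_right_comm]
  gcongr

lemma hasDerivAt_tsum_picardTerm (hA : Continuous A) (hb : Continuous b) (y₀ : E) (t : ℝ) :
    HasDerivAt (fun t => ∑' n, picardTerm A b y₀ n t)
      (A t (∑' n, picardTerm A b y₀ n t) + b t) t := by
  set T : ℝ := |t| + 1
  have ht : t ∈ Ioo (-T) T := abs_lt.1 (lt_add_one _)
  obtain ⟨C, hC⟩ := exists_norm_picardTerm_le hA hb y₀ T
  obtain ⟨K, hK⟩ := isCompact_Icc.exists_bound_of_continuousOn (s := Icc (-T) T) hA.continuousOn
  have hsum : Summable fun n => picardTerm A b y₀ n t :=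
    Summable.of_norm_bounded (summable_geometric_two.mul_left C) fun n =>
      hC n t (Ioo_subset_Icc_self ht)
  have htail := hasDerivAt_tsum_of_isPreconnected (y₀ := t) (y := t)
    ((summable_geometric_two.mul_left C).mul_left K) isOpen_Ioo isPreconnected_Ioo
    (fun n s _ => hasDerivAt_picardTerm_succ hA hb y₀ n s)
    (fun n s hs => ((A s).le_opNorm _).trans (mul_le_mul (hK s (Ioo_subset_Icc_self hs))
      (hC n s (Ioo_subset_Icc_self hs)) (norm_nonneg _)
      ((norm_nonneg _).trans (hK s (Ioo_subset_Icc_self hs)))))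
    ht ((summable_nat_add_iff 1).2 hsum) ht
  rw [← ContinuousLinearMap.map_tsum _ hsum] at htail
  refine (((hasDerivAt_picardTerm_zero (A := A) hb y₀ t).add htail).congr_of_eventuallyEq ?_)
    |>.congr_deriv (add_comm _ _)
  filter_upwards [Ioo_mem_nhds ht.1 ht.2] with s hs
  exact (Summable.of_norm_bounded (summable_geometric_two.mul_left C) fun n =>
    hC n s (Ioo_subset_Icc_self hs)).tsum_eq_zero_add

theorem exists_hasDerivAt_eq_clm_apply_add (hA : Continuous A) (hb : Continuous b) (y₀ : E) :
    ∃ y : ℝ → E, y 0 = y₀ ∧ ∀ t, HasDerivAt y (A t (y t) + b t) t := by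
  refine ⟨fun t => ∑' n, picardTerm A b y₀ n t, ?_, hasDerivAt_tsum_picardTerm hA hb y₀⟩
  change ∑' n, picardTerm A b y₀ n 0 = y₀
  rw [tsum_eq_single 0 fun n hn => ?_]
  · simp [picardTerm]
  · obtain ⟨m, rfl⟩ := Nat.exists_eq_succ_of_ne_zero hn
    simp [picardTerm]

end LinearODE

section Operators

/-- Translation `Y ↦ Y(· + a)` on bounded continuous functions. -/
def translateL (a : ℝ) : (ℝ →ᵇ ℝ) →L[ℝ] (ℝ →ᵇ ℝ) :=
  LinearMap.mkContinuous
    { toFun := fun Y => Y.compContinuous ⟨fun x => x + a, by fun_prop⟩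
      map_add' := fun _ _ => rfl
      map_smul' := fun _ _ => rfl } 1
    (fun Y => (BoundedContinuousFunction.norm_compContinuous_le Y _).trans_eq (one_mul _).symm)

@[simp] lemma translateL_apply (a : ℝ) (Y : ℝ →ᵇ ℝ) (x : ℝ) : translateL a Y x = Y (x + a) := rfl

/-- The operator `upwind` with velocity `c`, as a continuous linear map. -/
def upwindL (ε : ℝ) (c : ℝ →ᵇ ℝ) : (ℝ →ᵇ ℝ) →L[ℝ] (ℝ →ᵇ ℝ) :=
  (1 / ε) • ((translateL (-ε)).comp (ContinuousLinearMap.mul ℝ (ℝ →ᵇ ℝ) (0 ⊔ c))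
    - ContinuousLinearMap.mul ℝ (ℝ →ᵇ ℝ) |c|
    + (translateL ε).comp (ContinuousLinearMap.mul ℝ (ℝ →ᵇ ℝ) (0 ⊔ -c)))

lemma upwindL_apply (ε : ℝ) (c Y : ℝ →ᵇ ℝ) (x : ℝ) : upwindL ε c Y x = upwind ε c Y x := by
  change 1 / ε * (max 0 (c (x + -ε)) * Y (x + -ε) - |c x| * Y x + max 0 (-c (x + ε)) * Y (x + ε)) =
    upwind ε c Y x
  rw [upwind, ← sub_eq_add_neg]
  ring

lemma continuous_upwindL (ε : ℝ) : Continuous (upwindL ε) := by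
  unfold upwindL
  have h1 : Continuous fun c : ℝ →ᵇ ℝ => (0 : ℝ →ᵇ ℝ) ⊔ c := continuous_const.sup continuous_id
  have h2 : Continuous fun c : ℝ →ᵇ ℝ => (0 : ℝ →ᵇ ℝ) ⊔ -c := continuous_const.sup continuous_neg
  have h3 : Continuous fun c : ℝ →ᵇ ℝ => |c| := continuous_id.sup continuous_neg
  have hm := (ContinuousLinearMap.mul ℝ (ℝ →ᵇ ℝ)).continuous
  exact (((continuous_const.clm_comp (hm.comp h1)).sub (hm.comp h3)).add
    (continuous_const.clm_comp (hm.comp h2))).const_smul (1 / ε)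

lemma upwind_add_period (ε : ℝ) {c Y : ℝ → ℝ} (hc : Function.Periodic c (2 * Real.pi)) (x : ℝ) :
    upwind ε c Y (x + 2 * Real.pi) = upwind ε c (fun y => Y (y + 2 * Real.pi)) x := by
  simp only [upwind]
  rw [show x + 2 * Real.pi - ε = x - ε + 2 * Real.pi by ring,
    show x + 2 * Real.pi + ε = x + ε + 2 * Real.pi by ring, hc, hc, hc]

/-- The operator `mollify k δ` on bounded continuous functions. -/
def mollifyL {k : ℝ → ℝ} (hk : IsTest k) {δ : ℝ} (hδ : 0 < δ) : (ℝ →ᵇ ℝ) →L[ℝ] (ℝ →ᵇ ℝ) :=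
  LinearMap.mkContinuous
    { toFun := fun Y => BoundedContinuousFunction.ofNormedAddCommGroup (mollify k δ Y)
        (continuous_mollify hk hδ Y.continuous.locallyIntegrable) (‖Y‖ * ∫ z, |k z|)
        (abs_mollify_le hk hδ (Eventually.of_forall Y.norm_coe_le_norm))
      map_add' := fun Y Y' => by
        ext x
        simp only [BoundedContinuousFunction.coe_ofNormedAddCommGroup,
          BoundedContinuousFunction.coe_add, Pi.add_apply, mollify_eq_integral k hδ, add_mul]
        exact integral_add
          (hk.integrable_comp_sub_mul Y.continuous Y.norm_coe_le_norm x δ)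
          (hk.integrable_comp_sub_mul Y'.continuous Y'.norm_coe_le_norm x δ)
      map_smul' := fun a Y => by
        ext x
        simp only [BoundedContinuousFunction.coe_ofNormedAddCommGroup,
          BoundedContinuousFunction.coe_smul, mollify_eq_integral k hδ, smul_eq_mul,
          RingHom.id_apply, mul_assoc]
        exact integral_const_mul _ _ }
    (∫ z, |k z|)
    (fun Y => by
      refine (BoundedContinuousFunction.norm_le (mul_nonneg
        (integral_nonneg fun _ => abs_nonneg _) (norm_nonneg _))).2 fun x => ?_
      rw [mul_comm]
      exact abs_mollify_le hk hδ (Eventually.of_forall Y.norm_coe_le_norm) x)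

@[simp] lemma mollifyL_apply {k : ℝ → ℝ} (hk : IsTest k) {δ : ℝ} (hδ : 0 < δ) (Y : ℝ →ᵇ ℝ)
    (x : ℝ) : mollifyL hk hδ Y x = mollify k δ Y x := rfl

lemma continuous_of_periodic_of_continuous_uncurry {F : ℝ → (ℝ →ᵇ ℝ)}
    (hF : Continuous fun q : ℝ × ℝ => F q.1 q.2)
    (hp : ∀ t, Function.Periodic (F t) (2 * Real.pi)) : Continuous F := by
  refine continuous_iff_continuousAt.2 fun t => Metric.tendsto_nhds.2 fun e he => ?_
  have hcompact := (ContinuousMap.curry ⟨fun q : ℝ × ℝ => F q.1 q.2, hF⟩).continuous.tendsto t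
  rw [ContinuousMap.tendsto_iff_forall_isCompact_tendstoUniformlyOn] at hcompact
  have hclose := Metric.tendstoUniformlyOn_iff.1
    (hcompact (Icc 0 (0 + 2 * Real.pi)) isCompact_Icc) (e / 2) (by positivity)
  filter_upwards [hclose] with s hs
  refine lt_of_le_of_lt ((BoundedContinuousFunction.dist_le (by positivity)).2 fun x => ?_)
    (half_lt_self he)
  have hper : Function.Periodic (fun x => dist (F s x) (F t x)) (2 * Real.pi) := fun x => by
    simp only [hp s x, hp t x]
  obtain ⟨y, hy, hxy⟩ := hper.exists_mem_Ico₀ (by positivity) x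
  rw [hxy, dist_comm]
  exact (hs y ⟨hy.1, by simpa only [zero_add] using hy.2.le⟩).le

end Operators

/-- A jointly continuous `2π`-periodic velocity on `[0, ∞) × ℝ` bounded by `M`. -/
structure IsBoundedVelocity (u : ℝ → ℝ → ℝ) (M : ℝ) : Prop where
  continuousOn : ContinuousOn (fun q : ℝ × ℝ => u q.1 q.2) (Ici 0 ×ˢ univ)
  periodic : ∀ t, 0 ≤ t → Function.Periodic (u t) (2 * Real.pi)
  bounded : ∀ t, 0 ≤ t → ∀ x, |u t x| ≤ M

namespace IsBoundedVelocity

variable {u : ℝ → ℝ → ℝ} {M : ℝ}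

lemma continuous_uncurry (hu : IsBoundedVelocity u M) :
    Continuous fun q : ℝ × ℝ => u (max q.1 0) q.2 :=
  hu.continuousOn.comp_continuous (f := fun q : ℝ × ℝ => (max q.1 0, q.2)) (by fun_prop)
    fun q => ⟨le_max_right q.1 0, mem_univ _⟩

lemma continuous (hu : IsBoundedVelocity u M) {t : ℝ} (ht : 0 ≤ t) : Continuous (u t) := by
  have h := hu.continuous_uncurry.comp (Continuous.prodMk_right t)
  simpa [Function.comp_def, max_eq_left ht] using h

/-- The velocity as a curve of bounded continuous functions, constant for negative times. -/
def curve (hu : IsBoundedVelocity u M) (t : ℝ) : ℝ →ᵇ ℝ :=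
  BoundedContinuousFunction.ofNormedAddCommGroup (u (max t 0))
    (hu.continuous (le_max_right _ _)) M (hu.bounded _ (le_max_right _ _))

lemma curve_coe (hu : IsBoundedVelocity u M) {t : ℝ} (ht : 0 ≤ t) : ⇑(hu.curve t) = u t := by
  simp [curve, max_eq_left ht]

lemma continuous_curve (hu : IsBoundedVelocity u M) : Continuous hu.curve :=
  continuous_of_periodic_of_continuous_uncurry hu.continuous_uncurry
    fun _ => hu.periodic _ (le_max_right _ _)

/-- The right-hand side operators `2 upwind` of the transport equation. -/
def generator (hu : IsBoundedVelocity u M) (ε t : ℝ) : (ℝ →ᵇ ℝ) →L[ℝ] (ℝ →ᵇ ℝ) :=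
  (2 : ℝ) • upwindL ε (hu.curve t)

lemma generator_apply (hu : IsBoundedVelocity u M) (ε : ℝ) {t : ℝ} (ht : 0 ≤ t) (Y : ℝ →ᵇ ℝ)
    (x : ℝ) : hu.generator ε t Y x = 2 * upwind ε (u t) Y x := by
  simp [generator, upwindL_apply, hu.curve_coe ht]

lemma continuous_generator (hu : IsBoundedVelocity u M) (ε : ℝ) : Continuous (hu.generator ε) :=
  ((continuous_upwindL ε).comp hu.continuous_curve).const_smul (2 : ℝ)

end IsBoundedVelocity

/-- A curve, continuous for `t ≥ 0`, in the Banach space of bounded continuous `2π`-periodic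
functions; nothing is required for `t < 0`. -/
def IsTorusCurve (f : ℝ → ℝ → ℝ) : Prop :=
  ∃ b : ℝ → (ℝ →ᵇ ℝ), ContinuousOn b (Ici 0) ∧
    ∀ t, 0 ≤ t → Function.Periodic (f t) (2 * Real.pi) ∧ ⇑(b t) = f t

namespace IsTorusCurve

variable {f g : ℝ → ℝ → ℝ} {t : ℝ}

lemma periodic (hf : IsTorusCurve f) (ht : 0 ≤ t) : Function.Periodic (f t) (2 * Real.pi) := by
  obtain ⟨b, -, hb⟩ := hf
  exact (hb t ht).1

lemma continuous (hf : IsTorusCurve f) (ht : 0 ≤ t) : Continuous (f t) := by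
  obtain ⟨b, -, hb⟩ := hf
  exact (hb t ht).2 ▸ (b t).continuous

lemma congr (hf : IsTorusCurve f) (h : ∀ t, 0 ≤ t → f t = g t) : IsTorusCurve g := by
  obtain ⟨b, hb, hbf⟩ := hf
  exact ⟨b, hb, fun t ht => h t ht ▸ hbf t ht⟩

lemma const (c : ℝ) : IsTorusCurve fun _ _ => c :=
  ⟨fun _ => BoundedContinuousFunction.const ℝ c, continuousOn_const,
    fun _ _ => ⟨fun _ => rfl, rfl⟩⟩

protected lemma add (hf : IsTorusCurve f) (hg : IsTorusCurve g) :
    IsTorusCurve fun t x => f t x + g t x := by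
  obtain ⟨b, hb, hbf⟩ := hf
  obtain ⟨c, hc, hcg⟩ := hg
  refine ⟨fun t => b t + c t, hb.add hc, fun t ht => ⟨(hbf t ht).1.add (hcg t ht).1, ?_⟩⟩
  rw [BoundedContinuousFunction.coe_add, (hbf t ht).2, (hcg t ht).2]
  rfl

protected lemma mul (hf : IsTorusCurve f) (hg : IsTorusCurve g) :
    IsTorusCurve fun t x => f t x * g t x := by
  obtain ⟨b, hb, hbf⟩ := hf
  obtain ⟨c, hc, hcg⟩ := hg
  refine ⟨fun t => b t * c t, hb.mul hc, fun t ht => ⟨(hbf t ht).1.mul (hcg t ht).1, ?_⟩⟩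
  rw [BoundedContinuousFunction.coe_mul, (hbf t ht).2, (hcg t ht).2]
  rfl

lemma mollify {k : ℝ → ℝ} (hf : IsTorusCurve f) (hk : IsTest k) {δ : ℝ} (hδ : 0 < δ) :
    IsTorusCurve fun t => mollify k δ (f t) := by
  obtain ⟨b, hb, hbf⟩ := hf
  refine ⟨fun t => mollifyL hk hδ (b t), (mollifyL hk hδ).continuous.comp_continuousOn hb,
    fun t ht => ⟨mollify_periodic k δ (hbf t ht).1, funext fun x => ?_⟩⟩
  rw [mollifyL_apply, (hbf t ht).2]

end IsTorusCurve

/-- A curve of differentiable functions which, like that of its `x`-derivatives, is an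
`IsTorusCurve`. -/
structure IsTorusCurveC1 (f : ℝ → ℝ → ℝ) : Prop where
  curve : IsTorusCurve f
  differentiable : ∀ t, 0 ≤ t → Differentiable ℝ (f t)
  curve_deriv : IsTorusCurve fun t => deriv (f t)

namespace IsTorusCurveC1

variable {f g : ℝ → ℝ → ℝ}

lemma const (c : ℝ) : IsTorusCurveC1 fun _ _ => c :=
  ⟨.const c, fun _ _ => differentiable_const c, by simpa only [deriv_const'] using .const 0⟩

protected lemma add (hf : IsTorusCurveC1 f) (hg : IsTorusCurveC1 g) :
    IsTorusCurveC1 fun t x => f t x + g t x :=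
  ⟨hf.curve.add hg.curve, fun t ht => (hf.differentiable t ht).fun_add (hg.differentiable t ht),
    (hf.curve_deriv.add hg.curve_deriv).congr fun t ht => funext fun x =>
      (deriv_fun_add (hf.differentiable t ht x) (hg.differentiable t ht x)).symm⟩

protected lemma mul (hf : IsTorusCurveC1 f) (hg : IsTorusCurveC1 g) :
    IsTorusCurveC1 fun t x => f t x * g t x :=
  ⟨hf.curve.mul hg.curve, fun t ht => (hf.differentiable t ht).fun_mul (hg.differentiable t ht),
    ((hf.curve_deriv.mul hg.curve).add (hf.curve.mul hg.curve_deriv)).congr fun t ht =>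
      funext fun x =>
        (deriv_fun_mul (hf.differentiable t ht x) (hg.differentiable t ht x)).symm⟩

lemma const_mul (hf : IsTorusCurveC1 f) (c : ℝ) : IsTorusCurveC1 fun t x => c * f t x :=
  (const c).mul hf

protected lemma pow (hf : IsTorusCurveC1 f) (n : ℕ) : IsTorusCurveC1 fun t x => f t x ^ n := by
  induction n with
  | zero => simpa only [pow_zero] using const 1
  | succ n ih => simpa only [pow_succ] using ih.mul hf

protected lemma sum {ι : Type*} (s : Finset ι) {f : ι → ℝ → ℝ → ℝ}
    (hf : ∀ i ∈ s, IsTorusCurveC1 (f i)) : IsTorusCurveC1 fun t x => ∑ i ∈ s, f i t x := by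
  classical
  induction s using Finset.induction_on with
  | empty => simpa only [Finset.sum_empty] using const 0
  | insert i s hi ih =>
    simp_rw [Finset.sum_insert hi]
    exact (hf i (Finset.mem_insert_self i s)).add
      (ih fun j hj => hf j (Finset.mem_insert_of_mem hj))

end IsTorusCurveC1

lemma isTorusCurveC1_mollify {k : ℝ → ℝ} {f : ℝ → ℝ → ℝ} (hf : IsTorusCurve f)
    (hk : IsTest k) {δ : ℝ} (hδ : 0 < δ) : IsTorusCurveC1 fun t => mollify k δ (f t) := by
  have hderiv : ∀ t, 0 ≤ t → ∀ x, HasDerivAt (mollify k δ (f t))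
      (δ⁻¹ * mollify (deriv k) δ (f t) x) x := fun t ht =>
    hasDerivAt_mollify hk hδ (hf.continuous ht).locallyIntegrable
  exact ⟨hf.mollify hk hδ, fun t ht x => (hderiv t ht x).differentiableAt,
    ((IsTorusCurve.const δ⁻¹).mul (hf.mollify hk.deriv hδ)).congr fun t ht =>
      funext fun x => (hderiv t ht x).deriv.symm⟩

section Transport

variable {ε M : ℝ} {u S : ℝ → ℝ → ℝ} {y₀ : ℝ → ℝ} {Y : ℝ → (ℝ →ᵇ ℝ)}

theorem exists_isTransportSolution (ε : ℝ) (hu : IsBoundedVelocity u M) (hS : IsTorusCurve S)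
    (hy : Continuous y₀) (hyp : Function.Periodic y₀ (2 * Real.pi)) :
    ∃ Y : ℝ → (ℝ →ᵇ ℝ), IsTransportSolution ε u S y₀ Y := by
  obtain ⟨b, hb, hbS⟩ := hS
  obtain ⟨B, -, hB⟩ := exists_abs_le_of_periodic hy hyp
  let y : ℝ →ᵇ ℝ := BoundedContinuousFunction.ofNormedAddCommGroup y₀ hy B hB
  have hb' : Continuous fun t => -b (max t 0) :=
    (hb.comp_continuous (f := fun t => max t 0) (by fun_prop) fun t => le_max_right t 0).neg
  obtain ⟨Y, hY0, hY⟩ := exists_hasDerivAt_eq_clm_apply_add (hu.continuous_generator ε) hb' y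
  have hbt : ∀ t, 0 ≤ t → -b (max t 0) = -b t := fun t ht => by rw [max_eq_left ht]
  -- The translate of `Y` by a period solves the same initial value problem.
  have htranslate : ∀ t, 0 ≤ t → HasDerivWithinAt (fun t => translateL (2 * Real.pi) (Y t))
      (hu.generator ε t (translateL (2 * Real.pi) (Y t)) + -b (max t 0)) (Ici 0) t :=
    fun t ht => by
      refine (((translateL (2 * Real.pi)).hasFDerivAt.comp_hasDerivAt t (hY t)).congr_deriv
        ?_).hasDerivWithinAt
      ext x
      simp only [hbt t ht, map_add, BoundedContinuousFunction.coe_add, Pi.add_apply,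
        translateL_apply, hu.generator_apply ε ht, upwind_add_period ε (hu.periodic t ht),
        BoundedContinuousFunction.coe_neg, Pi.neg_apply, (hbS t ht).2, (hbS t ht).1 x]
      rfl
  have hinit : translateL (2 * Real.pi) (Y 0) = Y 0 := by
    rw [hY0]
    exact BoundedContinuousFunction.ext hyp
  have hper : ∀ t, 0 ≤ t → translateL (2 * Real.pi) (Y t) = Y t := fun t ht =>
    eq_of_hasDerivWithinAt_clm_apply_add (hu.continuous_generator ε).continuousOn htranslate
      (fun t _ => (hY t).hasDerivWithinAt) hinit ht
  refine ⟨Y, fun x => by rw [hY0]; rfl, fun t ht x => DFunLike.congr_fun (hper t ht) x,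
    fun t ht => ⟨_, fun x => ?_, (hY t).hasDerivWithinAt⟩⟩
  rw [hbt t ht, BoundedContinuousFunction.coe_add, Pi.add_apply, hu.generator_apply ε ht,
    BoundedContinuousFunction.coe_neg, (hbS t ht).2]
  rfl

lemma IsTransportSolution.continuousOn (hY : IsTransportSolution ε u S y₀ Y) :
    ContinuousOn Y (Ici 0) := fun t ht => by
  obtain ⟨G, -, hG⟩ := hY.ode t ht
  exact hG.continuousWithinAt

lemma IsTransportSolution.isTorusCurve (hY : IsTransportSolution ε u S y₀ Y) :
    IsTorusCurve fun t => Y t :=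
  ⟨Y, hY.continuousOn, fun t ht => ⟨hY.periodic t ht, rfl⟩⟩

theorem IsTransportSolution.unique (hu : IsBoundedVelocity u M)
    {S' : ℝ → ℝ → ℝ} {Y' : ℝ → (ℝ →ᵇ ℝ)} (hSS' : ∀ t, 0 ≤ t → ∀ x, S t x = S' t x)
    (hY : IsTransportSolution ε u S y₀ Y) (hY' : IsTransportSolution ε u S' y₀ Y')
    {t : ℝ} (ht : 0 ≤ t) : Y t = Y' t := by
  have hdiff : ∀ t, 0 ≤ t → HasDerivWithinAt (fun t => Y t - Y' t)
      (hu.generator ε t (Y t - Y' t) + 0) (Ici 0) t := fun t ht => by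
    obtain ⟨G, hG, hGd⟩ := hY.ode t ht
    obtain ⟨G', hG', hGd'⟩ := hY'.ode t ht
    refine (hGd.sub hGd').congr_deriv ?_
    ext x
    simp only [BoundedContinuousFunction.coe_sub, Pi.sub_apply, hG, hG', map_sub, add_zero,
      hu.generator_apply ε ht, hSS' t ht]
    ring
  have hzero : ∀ t, 0 ≤ t →
      HasDerivWithinAt (fun _ => (0 : ℝ →ᵇ ℝ)) (hu.generator ε t 0 + 0) (Ici 0) t := fun t _ => by
    simpa only [map_zero, add_zero] using hasDerivWithinAt_const t (Ici 0) (0 : ℝ →ᵇ ℝ)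
  refine sub_eq_zero.1 (eq_of_hasDerivWithinAt_clm_apply_add
    (hu.continuous_generator ε).continuousOn hdiff hzero ?_ ht)
  ext x
  simp [hY.initial, hY'.initial]

lemma continuous_upwind (ε : ℝ) {c Z : ℝ → ℝ} (hc : Continuous c) (hZ : Continuous Z) :
    Continuous (upwind ε c Z) := by
  unfold upwind
  fun_prop

lemma IsTransportSolution.continuous_source (hu : IsBoundedVelocity u M)
    (hY : IsTransportSolution ε u S y₀ Y) {t : ℝ} (ht : 0 ≤ t) : Continuous (S t) := by
  obtain ⟨G, hG, -⟩ := hY.ode t ht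
  have h : S t = fun x => 2 * upwind ε (u t) (Y t) x - G x := by
    ext x; rw [hG]; ring
  rw [h]
  exact (continuous_const.mul (continuous_upwind ε (hu.continuous ht) (Y t).continuous)).sub
    G.continuous

lemma max_zero_add_max_zero_neg (c : ℝ) : max 0 c + max 0 (-c) = |c| := by
  simpa only [posPart_def, negPart_def, sup_comm] using posPart_add_negPart c

lemma periodL1_add_upwind_le {h : ℝ} (hε : 0 < ε) {c Z : ℝ → ℝ} (hc : Continuous c)
    (hcp : Function.Periodic c (2 * Real.pi)) (hM : ∀ x, |c x| ≤ M) (hZ : Continuous Z)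
    (hZp : Function.Periodic Z (2 * Real.pi)) (hh : 0 ≤ h) (hhM : h * M ≤ ε) :
    periodL1 (fun x => Z x + h * upwind ε c Z x) ≤ periodL1 Z := by
  set r := h / ε with hr
  have hr0 : 0 ≤ r := by positivity
  have hrM : ∀ x, r * |c x| ≤ 1 := fun x => by
    rw [hr, div_mul_eq_mul_div, div_le_one hε]
    exact (mul_le_mul_of_nonneg_left (hM x) hh).trans hhM
  -- `P`, `Q` and `D` are the portions of the mass moving right, moving left and staying put.
  set P : ℝ → ℝ := fun x => Z x * (r * max 0 (c x)) with hP
  set Q : ℝ → ℝ := fun x => Z x * (r * max 0 (-c x)) with hQ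
  set D : ℝ → ℝ := fun x => Z x * (1 - r * |c x|) with hD
  have hPc : Continuous P := by fun_prop
  have hQc : Continuous Q := by fun_prop
  have hDc : Continuous D := by fun_prop
  have hPp : Function.Periodic P (2 * Real.pi) := fun x => by simp only [hP, hZp x, hcp x]
  have hQp : Function.Periodic Q (2 * Real.pi) := fun x => by simp only [hQ, hZp x, hcp x]
  have hstep : (fun x => Z x + h * upwind ε c Z x) = fun x => (D x + P (x + -ε)) + Q (x + ε) := by
    ext x
    simp only [upwind, hD, hP, hQ, hr, ← sub_eq_add_neg]
    ring
  have hmass : periodL1 D + periodL1 P + periodL1 Q = periodL1 Z := by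
    unfold periodL1
    rw [← intervalIntegral.integral_add (hDc.abs.intervalIntegrable _ _)
      (hPc.abs.intervalIntegrable _ _), ← intervalIntegral.integral_add
      (Continuous.intervalIntegrable (by fun_prop) _ _) (hQc.abs.intervalIntegrable _ _)]
    congr 1
    ext x
    simp only [hD, hP, hQ, abs_mul, abs_of_nonneg hr0, abs_of_nonneg (le_max_left (0 : ℝ) _),
      abs_of_nonneg (sub_nonneg.2 (hrM x))]
    linear_combination (|Z x| * r) * max_zero_add_max_zero_neg (c x)
  calc periodL1 (fun x => Z x + h * upwind ε c Z x)
      = periodL1 fun x => (D x + P (x + -ε)) + Q (x + ε) := by rw [hstep]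
    _ ≤ periodL1 D + periodL1 (fun x => P (x + -ε)) + periodL1 (fun x => Q (x + ε)) :=
        (periodL1_add_le (by fun_prop) (by fun_prop)).trans
          (add_le_add_left (periodL1_add_le hDc (by fun_prop)) _)
    _ = periodL1 Z := by rw [periodL1_comp_add hPp, periodL1_comp_add hQp, hmass]

lemma periodL1_le_norm (Y : ℝ →ᵇ ℝ) : periodL1 Y ≤ 2 * Real.pi * ‖Y‖ :=
  periodL1_le_of_abs_le Y.continuous Y.norm_coe_le_norm

lemma continuous_periodL1 : Continuous fun Y : ℝ →ᵇ ℝ => periodL1 Y := by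
  refine (LipschitzWith.of_le_add_mul (2 * Real.pi).toNNReal fun Y Z => ?_).continuous
  rw [Real.coe_toNNReal _ (by positivity), dist_eq_norm]
  calc periodL1 Y = periodL1 fun x => Z x + (Y - Z) x := by
        congr 1
        ext x
        exact (add_sub_cancel (Z x) (Y x)).symm
    _ ≤ periodL1 Z + periodL1 (Y - Z) := periodL1_add_le Z.continuous (Y - Z).continuous
    _ ≤ periodL1 Z + 2 * Real.pi * ‖Y - Z‖ := by gcongr; exact periodL1_le_norm (Y - Z)

lemma IsTransportSolution.exists_periodL1_le_slope (hε : 0 < ε) (hu : IsBoundedVelocity u M)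
    (hY : IsTransportSolution ε u S y₀ Y) {t : ℝ} (ht : 0 ≤ t) :
    ∃ G : ℝ →ᵇ ℝ, HasDerivWithinAt Y G (Ici 0) t ∧ ∀ z, t < z → 2 * (z - t) * M ≤ ε →
      periodL1 (Y z) ≤ periodL1 (Y t) +
        (z - t) * (periodL1 (S t) + 2 * Real.pi * ‖slope Y t z - G‖) := by
  obtain ⟨G, hG, hGd⟩ := hY.ode t ht
  refine ⟨G, hGd, fun z htz hzM => ?_⟩
  have hh : 0 < z - t := sub_pos.2 htz
  set e : ℝ →ᵇ ℝ := slope Y t z - G with he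
  have hYz : ⇑(Y z) = fun x => (Y t x + 2 * (z - t) * upwind ε (u t) (Y t) x)
      + ((-(z - t)) * S t x + (z - t) * e x) := by
    ext x
    have hslope : (z - t) • e = Y z - Y t - (z - t) • G := by
      rw [he, smul_sub, sub_smul_slope]
      rfl
    have hslope_x := DFunLike.congr_fun hslope x
    simp only [BoundedContinuousFunction.coe_smul, BoundedContinuousFunction.coe_sub,
      Pi.sub_apply, smul_eq_mul, hG] at hslope_x
    linear_combination -hslope_x
  have hSc := hY.continuous_source hu ht
  have hup := continuous_upwind ε (hu.continuous ht) (Y t).continuous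
  calc periodL1 (Y z)
      ≤ periodL1 (fun x => Y t x + 2 * (z - t) * upwind ε (u t) (Y t) x)
        + (periodL1 (fun x => (-(z - t)) * S t x) + periodL1 fun x => (z - t) * e x) := by
        rw [hYz]
        exact (periodL1_add_le (by fun_prop) (by fun_prop)).trans
          (add_le_add_right (periodL1_add_le (by fun_prop) (by fun_prop)) _)
    _ ≤ periodL1 (Y t) + ((z - t) * periodL1 (S t) + (z - t) * (2 * Real.pi * ‖e‖)) := by
        rw [periodL1_const_mul, periodL1_const_mul, abs_neg, abs_of_pos hh]
        gcongr
        · exact periodL1_add_upwind_le hε (hu.continuous ht) (hu.periodic t ht)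
            (hu.bounded t ht) (Y t).continuous (hY.periodic t ht) (by positivity) hzM
        · exact periodL1_le_norm e
    _ = _ := by ring

theorem IsTransportSolution.periodL1_le (hε : 0 < ε) (hu : IsBoundedVelocity u M)
    (hY : IsTransportSolution ε u S y₀ Y) {B T : ℝ}
    (hS : ∀ t ∈ Icc 0 T, periodL1 (S t) ≤ B) :
    ∀ t ∈ Icc 0 T, periodL1 (Y t) ≤ periodL1 y₀ + B * t := by
  have hslope_le : ∀ t ∈ Ico 0 T, ∀ r, B < r →
      ∃ᶠ z in 𝓝[>] t, (z - t)⁻¹ * (periodL1 (Y z) - periodL1 (Y t)) < r := fun t ht r hr => by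
    obtain ⟨G, hGd, hstep⟩ := hY.exists_periodL1_le_slope hε hu ht.1
    have hslope : Tendsto (fun z => slope Y t z - G) (𝓝[>] t) (𝓝 0) := by
      have := (hasDerivWithinAt_iff_tendsto_slope' (notMem_Ioi.2 le_rfl)).1
        (hGd.mono (fun z hz => ht.1.trans (le_of_lt hz)) : HasDerivWithinAt Y G (Ioi t) t)
      simpa only [sub_self] using this.sub_const G
    have hlim : Tendsto (fun z => B + 2 * Real.pi * ‖slope Y t z - G‖) (𝓝[>] t) (𝓝 B) := by
      simpa only [norm_zero, mul_zero, add_zero] using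
        (hslope.norm.const_mul (2 * Real.pi)).const_add B
    have hsmall : ∀ᶠ z in 𝓝[>] t, 2 * (z - t) * M < ε :=
      (Tendsto.mono_left (Continuous.tendsto' (by fun_prop) t 0 (by ring))
        nhdsWithin_le_nhds).eventually (gt_mem_nhds hε)
    refine Eventually.frequently ?_
    filter_upwards [hlim.eventually (gt_mem_nhds hr), hsmall, self_mem_nhdsWithin] with z hz hzM hzt
    refine lt_of_le_of_lt ?_ hz
    rw [inv_mul_le_iff₀ (sub_pos.2 hzt), sub_le_iff_le_add']
    have hpos : 0 ≤ z - t := (sub_pos.2 hzt).le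
    refine (hstep z hzt hzM.le).trans ?_
    gcongr
    exact hS t (Ico_subset_Icc_self ht)
  intro t ht
  have h := le_gronwallBound_of_liminf_deriv_right_le (f := fun t => periodL1 (Y t))
    (f' := fun _ => B) (δ := periodL1 y₀) (K := 0) (ε := B) (a := 0) (b := T)
    (continuous_periodL1.comp_continuousOn (hY.continuousOn.mono Icc_subset_Ici_self))
    hslope_le (by rw [funext hY.initial]) (fun _ _ => by rw [zero_mul, zero_add]) t ht
  rwa [gronwallBound_K0, sub_zero] at h

end Transport

section Consistency

variable {φ ψ Ψ c Y G s r : ℝ → ℝ} {ε δ L M B R : ℝ}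

lemma integrable_mul_test (hf : Continuous c) (hψ : IsTest ψ) : Integrable fun x => c x * ψ x :=
  (hf.mul hψ.continuous).integrable_of_hasCompactSupport hψ.2.mul_left

lemma IsTest.exists_lipschitz (hψ : IsTest ψ) :
    ∃ L : ℝ, 0 ≤ L ∧ ∀ x y, |ψ x - ψ y| ≤ L * |x - y| := by
  obtain ⟨L, hL⟩ := hψ.deriv.exists_bound
  exact ⟨L, (abs_nonneg _).trans (hL 0), fun x y => convex_univ.norm_image_sub_le_of_norm_deriv_le
    (fun z _ => hψ.differentiable z) (fun z _ => hL z) (mem_univ y) (mem_univ x)⟩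

lemma abs_sub_sub_mul_deriv_le (hΨ : IsTest Ψ) (hB : ∀ x, |deriv (deriv Ψ) x| ≤ B) (x h : ℝ) :
    |Ψ (x + h) - Ψ x - h * deriv Ψ x| ≤ B * h ^ 2 := by
  have hd : ∀ y ∈ uIcc x (x + h), HasDerivWithinAt (fun y => Ψ y - y * deriv Ψ x)
      (deriv Ψ y - 1 * deriv Ψ x) (uIcc x (x + h)) y := fun y _ =>
    ((hΨ.differentiable y).hasDerivAt.sub
      ((hasDerivAt_id y).mul_const (deriv Ψ x))).hasDerivWithinAt
  have hb : ∀ y ∈ uIcc x (x + h), ‖deriv Ψ y - 1 * deriv Ψ x‖ ≤ B * |h| := fun y hy => by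
    have hlip := convex_univ.norm_image_sub_le_of_norm_deriv_le
      (fun z _ => hΨ.deriv.differentiable z) (fun z _ => hB z) (mem_univ x) (mem_univ y)
    have hyx : |y - x| ≤ |h| := by
      simpa only [add_sub_cancel_left] using abs_sub_left_of_mem_uIcc hy
    rw [one_mul]
    exact hlip.trans (mul_le_mul_of_nonneg_left hyx ((abs_nonneg _).trans (hB 0)))
  have hmean := (convex_uIcc x (x + h)).norm_image_sub_le_of_norm_hasDerivWithin_le hd hb
    left_mem_uIcc right_mem_uIcc
  rw [Real.norm_eq_abs, Real.norm_eq_abs, add_sub_cancel_left, mul_assoc, abs_mul_abs_self] at hmean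
  calc _ = |Ψ (x + h) - (x + h) * deriv Ψ x - (Ψ x - x * deriv Ψ x)| := by congr 1; ring
    _ ≤ B * (h * h) := hmean
    _ = _ := by ring

/-- The adjoint of `upwind ε c`, which discretizes `Ψ ↦ c Ψ'` by one-sided differences. -/
def upwindAdjoint (ε : ℝ) (c Ψ : ℝ → ℝ) (x : ℝ) : ℝ :=
  1 / ε * (max 0 (c x) * (Ψ (x + ε) - Ψ x) + max 0 (-c x) * (Ψ (x + -ε) - Ψ x))

lemma integral_upwind_mul (ε : ℝ) (hc : Continuous c) (hY : Continuous Y) (hΨ : IsTest Ψ) :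
    ∫ x, upwind ε c Y x * Ψ x = ∫ x, Y x * upwindAdjoint ε c Ψ x := by
  have hΨs : ∀ a, IsTest fun x => Ψ (x + a) := fun a =>
    ⟨hΨ.1.comp (contDiff_id.add contDiff_const), hΨ.2.comp_homeomorph (Homeomorph.addRight a)⟩
  set P : ℝ → ℝ := fun x => Y x * max 0 (c x) with hP
  set Q : ℝ → ℝ := fun x => Y x * max 0 (-c x) with hQ
  set A : ℝ → ℝ := fun x => Y x * |c x| with hA
  have hPc : Continuous P := by fun_prop
  have hQc : Continuous Q := by fun_prop
  have hAΨ := integrable_mul_test (c := A) (by fun_prop) hΨ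
  have hshiftP : ∫ x, P (x - ε) * Ψ x = ∫ x, P x * Ψ (x + ε) := by
    rw [← integral_add_right_eq_self _ ε]
    simp only [add_sub_cancel_right]
  have hshiftQ : ∫ x, Q (x + ε) * Ψ x = ∫ x, Q x * Ψ (x + -ε) := by
    rw [← integral_add_right_eq_self _ (-ε)]
    simp only [neg_add_cancel_right]
  calc ∫ x, upwind ε c Y x * Ψ x
      = ∫ x, 1 / ε * (P (x - ε) * Ψ x - A x * Ψ x + Q (x + ε) * Ψ x) := by
        congr 1
        ext x
        simp only [upwind, hP, hQ, hA]
        ring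
    _ = 1 / ε * ((∫ x, P x * Ψ (x + ε)) - (∫ x, A x * Ψ x) + ∫ x, Q x * Ψ (x + -ε)) := by
        have hPΨ := integrable_mul_test (c := fun x => P (x - ε)) (by fun_prop) hΨ
        rw [integral_const_mul, integral_add (hPΨ.sub' hAΨ)
          (integrable_mul_test (c := fun x => Q (x + ε)) (by fun_prop) hΨ),
          integral_sub hPΨ hAΨ, hshiftP, hshiftQ]
    _ = ∫ x, 1 / ε * (P x * Ψ (x + ε) - A x * Ψ x + Q x * Ψ (x + -ε)) := by
        have hPΨ := integrable_mul_test hPc (hΨs ε)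
        rw [integral_const_mul, integral_add (hPΨ.sub' hAΨ) (integrable_mul_test hQc (hΨs (-ε))),
          integral_sub hPΨ hAΨ]
    _ = ∫ x, Y x * upwindAdjoint ε c Ψ x := by
        congr 1
        ext x
        simp only [upwindAdjoint, hP, hQ, hA, ← max_zero_add_max_zero_neg (c x)]
        ring

lemma abs_upwindAdjoint_sub_le (hε : 0 < ε) (c : ℝ → ℝ) (hΨ : IsTest Ψ)
    (hB : ∀ x, |deriv (deriv Ψ) x| ≤ B) (x : ℝ) :
    |upwindAdjoint ε c Ψ x - c x * deriv Ψ x| ≤ |c x| * B * ε := by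
  have hpos := le_max_left 0 (c x)
  have hneg := le_max_left 0 (-c x)
  have hc : max 0 (c x) - max 0 (-c x) = c x := by
    simpa only [posPart_def, negPart_def, sup_comm] using posPart_sub_negPart (c x)
  have htaylor : upwindAdjoint ε c Ψ x - c x * deriv Ψ x =
      1 / ε * (max 0 (c x) * (Ψ (x + ε) - Ψ x - ε * deriv Ψ x)
        + max 0 (-c x) * (Ψ (x + -ε) - Ψ x - (-ε) * deriv Ψ x)) := by
    rw [upwindAdjoint]
    nth_rewrite 3 [← hc]
    field_simp
    ring
  calc |upwindAdjoint ε c Ψ x - c x * deriv Ψ x|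
      ≤ 1 / ε * (max 0 (c x) * (B * ε ^ 2) + max 0 (-c x) * (B * (-ε) ^ 2)) := by
        rw [htaylor, abs_mul, abs_of_pos (one_div_pos.2 hε)]
        refine mul_le_mul_of_nonneg_left ((abs_add_le _ _).trans ?_) (one_div_pos.2 hε).le
        rw [abs_mul, abs_mul, abs_of_nonneg hpos, abs_of_nonneg hneg]
        gcongr
        · exact abs_sub_sub_mul_deriv_le hΨ hB x ε
        · exact abs_sub_sub_mul_deriv_le hΨ hB x (-ε)
    _ = 1 / ε * ((max 0 (c x) + max 0 (-c x)) * (B * ε ^ 2)) := by ring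
    _ = |c x| * B * ε := by rw [max_zero_add_max_zero_neg]; field_simp

lemma upwindAdjoint_eq_zero_of_support (hε : |ε| ≤ 1) (hR : ∀ x, R < |x| → Ψ x = 0) (x : ℝ)
    (hx : R + 1 < |x|) : upwindAdjoint ε c Ψ x = 0 := by
  have hright := abs_sub (x + ε) ε
  have hleft := abs_sub (x + -ε) (-ε)
  simp only [add_sub_cancel_right, abs_neg] at hright hleft
  rw [upwindAdjoint, hR x (by linarith), hR (x + ε) (by linarith), hR (x + -ε) (by linarith)]
  ring

lemma abs_integral_upwind_mul_sub_le (hε : 0 < ε) (hε1 : ε ≤ 1) (hc : Continuous c)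
    (hM : ∀ x, |c x| ≤ M) (hY : Continuous Y) (hYp : Function.Periodic Y (2 * Real.pi))
    (hΨ : IsTest Ψ) (hR : ∀ x, R < |x| → Ψ x = 0) (hB : ∀ x, |deriv (deriv Ψ) x| ≤ B) :
    |(∫ x, upwind ε c Y x * Ψ x) - ∫ x, Y x * (c x * deriv Ψ x)| ≤
      ⌈(R + 1) / Real.pi⌉₊ * (M * B * ε) * periodL1 Y := by
  have hB0 : 0 ≤ B := (abs_nonneg _).trans (hB 0)
  have hzero := upwindAdjoint_eq_zero_of_support (c := c) ((abs_of_pos hε).trans_le hε1) hR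
  have hadj : Integrable fun x => Y x * upwindAdjoint ε c Ψ x := by
    have hcont : Continuous (upwindAdjoint ε c Ψ) := by
      have := hΨ.continuous
      unfold upwindAdjoint
      fun_prop
    refine (hY.mul hcont).integrable_of_hasCompactSupport (HasCompactSupport.mul_left
      (HasCompactSupport.of_support_subset_isCompact (isCompact_Icc (a := -(R + 1)) (b := R + 1))
        fun x hx => abs_le.1 (le_of_not_gt fun hxR => hx (hzero x hxR))))
  have hderiv : Integrable fun x => Y x * (c x * deriv Ψ x) := by
    simpa only [mul_assoc] using
      integrable_mul_test (c := fun x => Y x * c x) (by fun_prop) hΨ.deriv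
  rw [integral_upwind_mul ε hc hY hΨ, ← integral_sub hadj hderiv]
  simp only [← mul_sub]
  refine abs_integral_mul_le_periodL1 hY.locallyIntegrable hYp (fun x hx => ?_) fun x =>
    (abs_upwindAdjoint_sub_le hε c hΨ hB x).trans (by gcongr; exact hM x)
  rw [hzero x hx, deriv_eq_zero_of_support hR x (by linarith), mul_zero, sub_zero]

lemma exists_abs_integral_mollify_mul_sub_le (hφ : IsMollifier φ) (hψ : IsTest ψ) :
    ∃ C : ℝ, 0 ≤ C ∧ ∀ (δ : ℝ) (f : ℝ → ℝ), 0 < δ → δ ≤ 1 → LocallyIntegrable f volume →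
    Function.Periodic f (2 * Real.pi) →
    |(∫ x, mollify φ δ f x * ψ x) - ∫ x, f x * ψ x| ≤ C * δ * periodL1 f := by
  obtain ⟨R₁, -, h₁⟩ := hφ.comp_neg.1.exists_support_bound
  obtain ⟨R₂, -, h₂⟩ := hψ.exists_support_bound
  obtain ⟨L, hL0, hL⟩ := hψ.exists_lipschitz
  obtain ⟨B, hB⟩ := hψ.exists_bound
  set J := ∫ z, |z| * |φ (-z)|
  have : 0 ≤ J := integral_nonneg fun z => by positivity
  refine ⟨⌈(max R₂ (R₂ + R₁)) / Real.pi⌉₊ * (L * J), by positivity, fun δ f hδ hδ1 hf hp => ?_⟩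
  have hfint : ∀ g : ℝ → ℝ, IsTest g → Integrable fun x => f x * g x := fun g hg =>
    hf.integrable_smul_right_of_hasCompactSupport hg.continuous hg.2
  rw [integral_mollify_mul hφ.1 hδ hf hψ.continuous hψ.2,
    ← integral_sub (hfint _ (hφ.comp_neg.1.mollify hψ hδ)) (hfint _ hψ)]
  simp_rw [← mul_sub]
  refine (abs_integral_mul_le_periodL1 (B := L * J * δ) hf hp (fun x hx => ?_) fun x =>
    abs_mollify_sub_le hφ.comp_neg hδ hL0 hψ.continuous hL hB x).trans_eq (by ring)
  rw [mollify_eq_zero_of_support hδ hδ1 h₁ h₂ x (lt_of_le_of_lt (le_max_right _ _) hx),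
    h₂ x (lt_of_le_of_lt (le_max_left _ _) hx), sub_zero]

lemma integral_deriv_mul_test (hs : Differentiable ℝ s) (hs' : Continuous (deriv s))
    (hψ : IsTest ψ) : ∫ x, deriv s x * ψ x = -∫ x, s x * deriv ψ x := by
  rw [integral_mul_deriv_eq_deriv_mul_of_integrable
    (fun x _ => (hs x).hasDerivAt) (fun x _ => (hψ.differentiable x).hasDerivAt)
    (integrable_mul_test hs.continuous hψ.deriv) (integrable_mul_test hs' hψ)
    (integrable_mul_test hs.continuous hψ), neg_neg]

lemma integral_residual_eq (ε : ℝ) (hψ : IsTest ψ) (hc : Continuous c) (hY : Continuous Y)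
    (hs : Differentiable ℝ s) (hs' : Continuous (deriv s)) (hr : Continuous r) :
    ∫ x, ((2 * upwind ε c Y x - deriv s x) * ψ x - (2 * (c x * Y x) + r x) * deriv ψ x) =
      2 * ((∫ x, upwind ε c Y x * ψ x) - ∫ x, Y x * (c x * deriv ψ x))
        + ∫ x, (s x - r x) * deriv ψ x := by
  have hupwind := integrable_mul_test (continuous_upwind ε hc hY) hψ
  have hs'ψ := integrable_mul_test hs' hψ
  have hYc : Integrable fun x => Y x * (c x * deriv ψ x) := by
    simpa only [mul_assoc] using
      integrable_mul_test (c := fun x => Y x * c x) (by fun_prop) hψ.deriv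
  have hrψ' := integrable_mul_test hr hψ.deriv
  have hparts : ∫ x, (s x - r x) * deriv ψ x =
      -(∫ x, deriv s x * ψ x) - ∫ x, r x * deriv ψ x := by
    simp_rw [sub_mul]
    rw [integral_sub (integrable_mul_test hs.continuous hψ.deriv) hrψ',
      integral_deriv_mul_test hs hs' hψ, neg_neg]
  rw [hparts, ← integral_sub hupwind hYc, ← integral_const_mul, ← integral_neg,
    ← integral_sub hs'ψ.fun_neg hrψ',
    ← integral_add ((hupwind.sub' hYc).const_mul 2) (hs'ψ.fun_neg.sub' hrψ')]
  congr 1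
  ext x
  ring

lemma exists_residual_bound (hψ : IsTest ψ) : ∃ C : ℝ, 0 ≤ C ∧
    ∀ (ε M : ℝ) (c Y G s r : ℝ → ℝ), 0 < ε → ε ≤ 1 → Continuous c → (∀ x, |c x| ≤ M) →
    Continuous Y → Function.Periodic Y (2 * Real.pi) → Differentiable ℝ s → Continuous (deriv s) →
    Continuous r → (∀ x, G x = 2 * upwind ε c Y x - deriv s x) →
    |∫ x, (G x * ψ x - (2 * (c x * Y x) + r x) * deriv ψ x)| ≤
      C * (M * ε * periodL1 Y) + |∫ x, (s x - r x) * deriv ψ x| := by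
  obtain ⟨R, -, hR⟩ := hψ.exists_support_bound
  obtain ⟨B, hB⟩ := hψ.deriv.deriv.exists_bound
  have hB0 : 0 ≤ B := (abs_nonneg _).trans (hB 0)
  refine ⟨2 * ⌈(R + 1) / Real.pi⌉₊ * B, by positivity,
    fun ε M c Y G s r hε hε1 hc hM hY hYp hs hs' hr hG => ?_⟩
  simp only [hG]
  rw [integral_residual_eq ε hψ hc hY hs hs' hr]
  refine (abs_add_le _ _).trans (add_le_add ?_ le_rfl)
  rw [abs_mul, abs_two]
  calc _ ≤ 2 * (⌈(R + 1) / Real.pi⌉₊ * (M * B * ε) * periodL1 Y) := by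
        gcongr
        exact abs_integral_upwind_mul_sub_le hε hε1 hc hM hY hYp hψ hR hB
    _ = _ := by ring

/-- The commutator of multiplication by `c` and mollification. -/
def mollifyCommutator (k : ℝ → ℝ) (δ : ℝ) (c g : ℝ → ℝ) (x : ℝ) : ℝ :=
  c x * mollify k δ g x - mollify k δ (fun y => c y * g y) x

lemma integral_mul_mollifyCommutator (hφ : IsTest φ) (hψ : IsTest ψ) (hδ : 0 < δ)
    (hc : Continuous c) (hY : Continuous Y) :
    ∫ x, Y x * mollifyCommutator (fun y => φ (-y)) δ c ψ x =
      (∫ x, Y x * (c x * mollify (fun y => φ (-y)) δ ψ x))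
        - ∫ x, mollify φ δ Y x * (c x * ψ x) := by
  have hφ' : IsTest fun y => φ (-y) := hφ.comp_neg
  have hcψ : Continuous fun x => c x * ψ x := hc.mul hψ.continuous
  have hcψs : HasCompactSupport fun x => c x * ψ x := hψ.2.mul_left
  have hYc : Integrable fun x => Y x * (c x * mollify (fun y => φ (-y)) δ ψ x) := by
    simpa only [mul_assoc] using
      integrable_mul_test (c := fun x => Y x * c x) (by fun_prop) (hφ'.mollify hψ hδ)
  have hYm : Integrable fun x => Y x * mollify (fun y => φ (-y)) δ (fun y => c y * ψ y) x := by
    refine (hY.mul (continuous_mollify hφ' hδ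
      hcψ.locallyIntegrable)).integrable_of_hasCompactSupport (HasCompactSupport.mul_left ?_)
    rw [mollify_eq_convolution]
    exact (hφ'.rescale hδ.ne').2.convolution _ hcψs
  rw [integral_mollify_mul hφ hδ hY.locallyIntegrable hcψ hcψs, ← integral_sub hYc hYm]
  simp only [mollifyCommutator, mul_sub]

lemma deriv_mollify_of_test {k : ℝ → ℝ} (hk : IsTest k) (hδ : 0 < δ) (hψ : IsTest ψ) :
    deriv (mollify k δ ψ) = mollify k δ (deriv ψ) :=
  funext fun x => (hasDerivAt_mollify_of_test hk hδ hψ x).deriv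

lemma integral_mollify_upwind_sub_mul (ε : ℝ) (hφ : IsTest φ) (hψ : IsTest ψ) (hδ : 0 < δ)
    (hc : Continuous c) (hY : Continuous Y) (hs : Differentiable ℝ s) (hs' : Continuous (deriv s)) :
    ∫ x, mollify φ δ (fun x => 2 * upwind ε c Y x - deriv s x) x * ψ x =
      2 * (∫ x, upwind ε c Y x * mollify (fun y => φ (-y)) δ ψ x)
        + ∫ x, mollify φ δ s x * deriv ψ x := by
  have hupwind := continuous_upwind ε hc hY
  have hΨ : IsTest (mollify (fun y => φ (-y)) δ ψ) := hφ.comp_neg.mollify hψ hδ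
  rw [integral_mollify_mul hφ hδ ((hupwind.const_mul 2).fun_sub hs').locallyIntegrable
      hψ.continuous hψ.2,
    integral_mollify_mul hφ hδ hs.continuous.locallyIntegrable hψ.deriv.continuous hψ.deriv.2,
    ← deriv_mollify_of_test hφ.comp_neg hδ hψ, ← neg_neg (∫ x, s x * _),
    ← integral_deriv_mul_test hs hs' hΨ, ← sub_eq_add_neg, ← integral_const_mul,
    ← integral_sub ((integrable_mul_test hupwind hΨ).const_mul 2) (integrable_mul_test hs' hΨ)]
  congr 1
  ext x
  ring

-- Transposing the mollification onto `ψ` leaves the consistency error for the test function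
-- `mollify φ(-·) δ ψ`, a commutator with the velocity and the mollification error of the source.
lemma integral_mollified_residual_eq (hφ : IsTest φ) (hψ : IsTest ψ) (hδ : 0 < δ)
    (hc : Continuous c) (hY : Continuous Y) (hs : Differentiable ℝ s) (hs' : Continuous (deriv s))
    (hG : G = fun x => 2 * upwind ε c Y x - deriv s x) :
    ∫ x, (mollify φ δ G x * ψ x - (2 * (c x * mollify φ δ Y x) + s x) * deriv ψ x) =
      2 * ((∫ x, upwind ε c Y x * mollify (fun y => φ (-y)) δ ψ x)
          - ∫ x, Y x * (c x * deriv (mollify (fun y => φ (-y)) δ ψ) x))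
        + 2 * (∫ x, Y x * mollifyCommutator (fun y => φ (-y)) δ c (deriv ψ) x)
        + ((∫ x, mollify φ δ s x * deriv ψ x) - ∫ x, s x * deriv ψ x) := by
  have hGc : Continuous G := by
    rw [hG]
    exact ((continuous_upwind ε hc hY).const_mul 2).sub hs'
  have hmG := integrable_mul_test (continuous_mollify hφ hδ hGc.locallyIntegrable) hψ
  have hmY : Integrable fun x => mollify φ δ Y x * (c x * deriv ψ x) :=
    ((continuous_mollify hφ hδ hY.locallyIntegrable).mul
      (hc.mul hψ.deriv.continuous)).integrable_of_hasCompactSupport hψ.deriv.2.mul_left.mul_left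
  have hsψ' := integrable_mul_test hs.continuous hψ.deriv
  have hsplit : ∫ x, (mollify φ δ G x * ψ x - (2 * (c x * mollify φ δ Y x) + s x) * deriv ψ x) =
      (∫ x, mollify φ δ G x * ψ x) - (2 * (∫ x, mollify φ δ Y x * (c x * deriv ψ x))
        + ∫ x, s x * deriv ψ x) := by
    rw [← integral_const_mul, ← integral_add (hmY.const_mul 2) hsψ',
      ← integral_sub hmG ((hmY.const_mul 2).fun_add hsψ')]
    congr 1
    ext x
    ring
  rw [hsplit, hG, integral_mollify_upwind_sub_mul ε hφ hψ hδ hc hY hs hs',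
    integral_mul_mollifyCommutator hφ hψ.deriv hδ hc hY,
    deriv_mollify_of_test hφ.comp_neg hδ hψ]
  ring

lemma abs_integral_upwind_mul_mollify_sub_le {k : ℝ → ℝ} {R' : ℝ} (hk : IsTest k)
    (hε : 0 < ε) (hε1 : ε ≤ 1) (hδ : 0 < δ) (hδ1 : δ ≤ 1) (hc : Continuous c)
    (hM : ∀ x, |c x| ≤ M) (hY : Continuous Y) (hYp : Function.Periodic Y (2 * Real.pi))
    (hψ : IsTest ψ) (hkR : ∀ x, R' < |x| → k x = 0) (hψR : ∀ x, R < |x| → ψ x = 0)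
    (hB : ∀ x, |deriv (deriv ψ) x| ≤ B) :
    |(∫ x, upwind ε c Y x * mollify k δ ψ x) - ∫ x, Y x * (c x * deriv (mollify k δ ψ) x)| ≤
      ⌈(R + R' + 1) / Real.pi⌉₊ * (M * (B * ∫ z, |k z|) * ε) * periodL1 Y :=
  abs_integral_upwind_mul_sub_le hε hε1 hc hM hY hYp (hk.mollify hψ hδ)
    (mollify_eq_zero_of_support hδ hδ1 hkR hψR) fun x => by
      rw [deriv_mollify_of_test hk hδ hψ, deriv_mollify_of_test hk hδ hψ.deriv]
      exact abs_mollify_le hk hδ (Eventually.of_forall hB) x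

lemma abs_integral_mul_mollifyCommutator_le {k : ℝ → ℝ} {g : ℝ → ℝ} {R' : ℝ} (hk : IsTest k)
    (hδ : 0 < δ) (hδ1 : δ ≤ 1) (hc : Continuous c) (hM : ∀ x, |c x| ≤ M) (hL0 : 0 ≤ L)
    (hL : ∀ x y, |c x - c y| ≤ L * |x - y|) (hY : Continuous Y)
    (hYp : Function.Periodic Y (2 * Real.pi)) (hg : Continuous g)
    (hkR : ∀ x, R' < |x| → k x = 0) (hgR : ∀ x, R < |x| → g x = 0) (hB : ∀ x, |g x| ≤ B) :
    |∫ x, Y x * mollifyCommutator k δ c g x| ≤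
      ⌈(R + R') / Real.pi⌉₊ * (L * B * (∫ z, |z| * |k z|) * δ) * periodL1 Y :=
  abs_integral_mul_le_periodL1 hY.locallyIntegrable hYp
    (fun x hx => by
      rw [mollifyCommutator, mollify_eq_zero_of_support hδ hδ1 hkR hgR x hx,
        mollify_eq_zero_of_support hδ hδ1 hkR (fun y hy => by rw [hgR y hy, mul_zero]) x hx,
        mul_zero, sub_zero])
    (abs_mul_mollify_sub_le hk hδ hL0 hc hL hM hg hB)

lemma exists_mollified_residual_bound (hφ : IsMollifier φ) (hψ : IsTest ψ) :
    ∃ C : ℝ, 0 ≤ C ∧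
    ∀ (ε δ M L : ℝ) (c Y G s : ℝ → ℝ), 0 < ε → ε ≤ 1 → 0 < δ → δ ≤ 1 → Continuous c →
    (∀ x, |c x| ≤ M) → 0 ≤ L → (∀ x y, |c x - c y| ≤ L * |x - y|) →
    Continuous Y → Function.Periodic Y (2 * Real.pi) → Differentiable ℝ s → Continuous (deriv s) →
    Function.Periodic s (2 * Real.pi) → (∀ x, G x = 2 * upwind ε c Y x - deriv s x) →
    |∫ x, (mollify φ δ G x * ψ x - (2 * (c x * mollify φ δ Y x) + s x) * deriv ψ x)| ≤
      C * (M * ε * periodL1 Y + L * δ * periodL1 Y + δ * periodL1 s) := by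
  have hφ' : IsTest fun y => φ (-y) := hφ.1.comp_neg
  obtain ⟨R₁, -, h₁⟩ := hφ'.exists_support_bound
  obtain ⟨R₂, -, h₂⟩ := hψ.exists_support_bound
  obtain ⟨B₁, hB₁⟩ := hψ.deriv.exists_bound
  obtain ⟨B₂, hB₂⟩ := hψ.deriv.deriv.exists_bound
  obtain ⟨C₃, hC₃0, hC₃⟩ := exists_abs_integral_mollify_mul_sub_le hφ hψ.deriv
  set I := ∫ z, |φ (-z)|
  set J := ∫ z, |z| * |φ (-z)|
  set C₁ := 2 * (⌈(R₂ + R₁ + 1) / Real.pi⌉₊ * (B₂ * I))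
  set C₂ := 2 * (⌈(R₂ + R₁) / Real.pi⌉₊ * (B₁ * J))
  have : 0 ≤ I := integral_nonneg fun z => abs_nonneg _
  have : 0 ≤ J := integral_nonneg fun z => by positivity
  have hB₁0 : 0 ≤ B₁ := (abs_nonneg _).trans (hB₁ 0)
  have hB₂0 : 0 ≤ B₂ := (abs_nonneg _).trans (hB₂ 0)
  have hC₁0 : 0 ≤ C₁ := by positivity
  have hC₂0 : 0 ≤ C₂ := by positivity
  refine ⟨C₁ + C₂ + C₃, by positivity,
    fun ε δ M L c Y G s hε hε1 hδ hδ1 hc hM hL0 hL hY hYp hs hs' hsp hG => ?_⟩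
  have hM0 : 0 ≤ M := (abs_nonneg _).trans (hM 0)
  have hconsistency := abs_integral_upwind_mul_mollify_sub_le hφ' hε hε1 hδ hδ1 hc hM hY hYp hψ
    h₁ h₂ hB₂
  have hcommutator := abs_integral_mul_mollifyCommutator_le hφ' hδ hδ1 hc hM hL0 hL hY hYp
    hψ.deriv.continuous h₁ (deriv_eq_zero_of_support h₂) hB₁
  have hsource := hC₃ δ s hδ hδ1 hs.continuous.locallyIntegrable hsp
  rw [integral_mollified_residual_eq hφ.1 hψ hδ hc hY hs hs' (funext hG)]
  have hN := periodL1_nonneg Y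
  have hN' := periodL1_nonneg s
  refine (abs_add_three _ _ _).trans ?_
  rw [abs_mul, abs_mul, abs_two, mul_add, mul_add]
  refine add_le_add (add_le_add ?_ ?_) ?_
  · calc _ ≤ 2 * (⌈(R₂ + R₁ + 1) / Real.pi⌉₊ * (M * (B₂ * I) * ε) * periodL1 Y) := by gcongr
      _ = C₁ * (M * ε * periodL1 Y) := by ring
      _ ≤ _ := by gcongr; linarith
  · calc _ ≤ 2 * (⌈(R₂ + R₁) / Real.pi⌉₊ * (L * B₁ * J * δ) * periodL1 Y) := by gcongr
      _ = C₂ * (L * δ * periodL1 Y) := by ring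
      _ ≤ _ := by gcongr; linarith
  · calc _ ≤ C₃ * δ * periodL1 s := hsource
      _ = C₃ * (δ * periodL1 s) := mul_assoc _ _ _
      _ ≤ _ := by gcongr; linarith

end Consistency

/-- `N ε t = O(ε^{-a})` as `ε → 0⁺`, uniformly for `t ∈ [0, T]`: the bookkeeping device for the
power counting in `ε`. -/
def IsPowBounded (T a : ℝ) (N : ℝ → ℝ → ℝ) : Prop :=
  ∃ C : ℝ, 0 ≤ C ∧ ∀ᶠ ε in 𝓝[>] (0 : ℝ), ∀ t ∈ Icc 0 T, |N ε t| ≤ C * ε ^ (-a)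

lemma eventually_mem_Ioo : ∀ᶠ ε in 𝓝[>] (0 : ℝ), ε ∈ Ioo (0 : ℝ) 1 :=
  Ioo_mem_nhdsGT one_pos

namespace IsPowBounded

variable {T a b : ℝ} {N N' : ℝ → ℝ → ℝ}

lemma mono_exp (h : IsPowBounded T a N) (hab : a ≤ b) : IsPowBounded T b N := by
  obtain ⟨C, hC0, hC⟩ := h
  refine ⟨C, hC0, ?_⟩
  filter_upwards [hC, eventually_mem_Ioo] with ε hε h01 t ht
  exact (hε t ht).trans (mul_le_mul_of_nonneg_left
    (Real.rpow_le_rpow_of_exponent_ge h01.1 h01.2.le (neg_le_neg hab)) hC0)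

lemma of_abs_le (h : IsPowBounded T a N)
    (hle : ∀ ε ∈ Ioo (0 : ℝ) 1, ∀ t ∈ Icc 0 T, |N' ε t| ≤ N ε t) : IsPowBounded T a N' := by
  obtain ⟨C, hC0, hC⟩ := h
  refine ⟨C, hC0, ?_⟩
  filter_upwards [hC, eventually_mem_Ioo] with ε hε h01 t ht
  exact ((hle ε h01 t ht).trans (le_abs_self _)).trans (hε t ht)

protected lemma add (h : IsPowBounded T a N) (h' : IsPowBounded T a N') :
    IsPowBounded T a fun ε t => N ε t + N' ε t := by
  obtain ⟨C, hC0, hC⟩ := h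
  obtain ⟨C', hC0', hC'⟩ := h'
  refine ⟨C + C', by positivity, ?_⟩
  filter_upwards [hC, hC'] with ε h1 h2 t ht
  rw [add_mul]
  exact (abs_add_le _ _).trans (add_le_add (h1 t ht) (h2 t ht))

protected lemma mul (h : IsPowBounded T a N) (h' : IsPowBounded T b N') :
    IsPowBounded T (a + b) fun ε t => N ε t * N' ε t := by
  obtain ⟨C, hC0, hC⟩ := h
  obtain ⟨C', hC0', hC'⟩ := h'
  refine ⟨C * C', by positivity, ?_⟩
  filter_upwards [hC, hC', eventually_mem_Ioo] with ε h1 h2 h01 t ht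
  have hε := h01.1
  rw [neg_add, Real.rpow_add hε, abs_mul, mul_mul_mul_comm]
  exact mul_le_mul (h1 t ht) (h2 t ht) (abs_nonneg _) (by positivity)

lemma const (c : ℝ) : IsPowBounded T 0 fun _ _ => c :=
  ⟨|c|, abs_nonneg c, Eventually.of_forall fun ε t _ => by
    rw [neg_zero, Real.rpow_zero, mul_one]⟩

lemma const_mul (h : IsPowBounded T a N) (c : ℝ) : IsPowBounded T a fun ε t => c * N ε t := by
  simpa only [zero_add] using (const c).mul h

lemma rpow (a : ℝ) : IsPowBounded T (-a) fun ε _ => ε ^ a := by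
  refine ⟨1, zero_le_one, ?_⟩
  filter_upwards [eventually_mem_Ioo] with ε hε t _
  rw [neg_neg, one_mul, abs_of_pos (Real.rpow_pos_of_pos hε.1 a)]

lemma inv_rpow (a : ℝ) : IsPowBounded T a fun ε _ => (ε ^ a)⁻¹ := by
  refine ⟨1, zero_le_one, ?_⟩
  filter_upwards [eventually_mem_Ioo] with ε hε t _
  rw [Real.rpow_neg hε.1.le, one_mul, abs_of_pos (inv_pos.2 (Real.rpow_pos_of_pos hε.1 a))]

lemma tendstoUniformlyOn (h : IsPowBounded T a N) (ha : a < 0) :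
    TendstoUniformlyOn N (fun _ => 0) (𝓝[>] 0) (Icc 0 T) := by
  obtain ⟨C, -, hC⟩ := h
  have hpow : Tendsto (fun ε : ℝ => ε ^ (-a)) (𝓝 0) (𝓝 0) := by
    have := (Real.continuousAt_rpow_const 0 (-a) (Or.inr (neg_pos.2 ha).le)).tendsto
    rwa [Real.zero_rpow (neg_pos.2 ha).ne'] at this
  have hlim : Tendsto (fun ε : ℝ => C * ε ^ (-a)) (𝓝[>] 0) (𝓝 0) := by
    simpa only [mul_zero] using (hpow.mono_left nhdsWithin_le_nhds).const_mul C
  rw [Metric.tendstoUniformlyOn_iff]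
  intro e he
  filter_upwards [hC, hlim.eventually (gt_mem_nhds he)] with ε hN hsmall t ht
  rw [dist_zero_left, Real.norm_eq_abs]
  exact (hN t ht).trans_lt hsmall

end IsPowBounded

lemma rpow_pos_of_mem_Ioo {ε : ℝ} (hε : ε ∈ Ioo (0 : ℝ) 1) (α : ℝ) : 0 < ε ^ α :=
  Real.rpow_pos_of_pos hε.1 α

lemma rpow_le_one_of_mem_Ioo {ε α : ℝ} (hε : ε ∈ Ioo (0 : ℝ) 1) (hα : 0 ≤ α) : ε ^ α ≤ 1 :=
  Real.rpow_le_one hε.1.le hε.2.le hα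

section Families

variable {φ u₀ g : ℝ → ℝ} {α β a b T : ℝ} {u : ℝ → ℝ → ℝ → ℝ} {gε : ℝ → ℝ → ℝ}
  {Y : ℝ → ℝ → (ℝ →ᵇ ℝ)} {s : ℝ → ℝ → ℝ → ℝ}

lemma IsVelocityFamily.exists_isBoundedVelocity (hu : IsVelocityFamily β u₀ u) :
    ∃ M : ℝ, ∀ ε ∈ Ioo (0 : ℝ) 1, IsBoundedVelocity (u ε) M := by
  obtain ⟨M, hM⟩ := hu.bounded
  exact ⟨M, fun ε hε => ⟨hu.continuous ε hε, hu.periodic ε hε, hM ε hε⟩⟩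

lemma IsVelocityFamily.exists_lipschitz (hu : IsVelocityFamily β u₀ u) (T : ℝ) :
    ∃ C : ℝ, 0 ≤ C ∧ ∀ ε ∈ Ioo (0 : ℝ) 1, ∀ t ∈ Icc 0 T, ∀ x y,
      |u ε t x - u ε t y| ≤ C * (ε ^ β)⁻¹ * |x - y| := by
  obtain ⟨C, hC⟩ := hu.deriv_bound T
  refine ⟨|C|, abs_nonneg C, fun ε hε t ht x y => ?_⟩
  have hderiv : ∀ z, ‖deriv (u ε t) z‖ ≤ |C| * (ε ^ β)⁻¹ := fun z =>
    (hC ε hε t ht z).trans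
      (div_le_div_of_nonneg_right (le_abs_self C) (rpow_pos_of_mem_Ioo hε β).le)
  exact convex_univ.norm_image_sub_le_of_norm_deriv_le
    (fun z _ => hu.differentiable ε hε t ht.1 z) (fun z _ => hderiv z) (mem_univ y) (mem_univ x)

lemma IsRegularization.isPowBounded (hg : IsRegularization g gε) (T : ℝ) :
    IsPowBounded T 0 fun ε _ => periodL1 (gε ε) := by
  obtain ⟨C, hC⟩ := hg.bounded
  refine ⟨|C|, abs_nonneg C, hC.mono fun ε hε t _ => ?_⟩
  rw [neg_zero, Real.rpow_zero, mul_one, abs_of_nonneg (periodL1_nonneg _)]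
  exact hε.trans (le_abs_self C)

lemma IsVelocityFamily.exists_isTransportSolution (hu : IsVelocityFamily β u₀ u)
    (hg : IsRegularization g gε) {S : ℝ → ℝ → ℝ → ℝ}
    (hS : ∀ ε ∈ Ioo (0 : ℝ) 1, IsTorusCurve (S ε)) :
    ∃ Y : ℝ → ℝ → (ℝ →ᵇ ℝ),
      ∀ ε ∈ Ioo (0 : ℝ) 1, IsTransportSolution ε (u ε) (S ε) (gε ε) (Y ε) := by
  obtain ⟨M, hM⟩ := hu.exists_isBoundedVelocity
  choose! Y hY using fun ε (hε : ε ∈ Ioo (0 : ℝ) 1) => WeakAsymptotic.exists_isTransportSolution ε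
    (hM ε hε) (hS ε hε) (hg.continuous ε hε) (hg.periodic ε hε)
  exact ⟨Y, hY⟩

lemma IsVelocityFamily.isPowBounded_periodL1 (hu : IsVelocityFamily β u₀ u)
    (hg : IsRegularization g gε) {S : ℝ → ℝ → ℝ → ℝ}
    (hY : ∀ ε ∈ Ioo (0 : ℝ) 1, IsTransportSolution ε (u ε) (S ε) (gε ε) (Y ε))
    (ha : 0 ≤ a) (hS : IsPowBounded T a fun ε t => periodL1 (S ε t)) :
    IsPowBounded T a fun ε t => periodL1 (Y ε t) := by
  obtain ⟨M, hM⟩ := hu.exists_isBoundedVelocity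
  obtain ⟨C, hC0, hC⟩ := hS
  obtain ⟨C', hC0', hC'⟩ := (hg.isPowBounded T).mono_exp ha
  refine ⟨C' + C * |T|, by positivity, ?_⟩
  filter_upwards [hC, hC', eventually_mem_Ioo] with ε hsource hinitial hε t ht
  have hpow := rpow_pos_of_mem_Ioo hε (-a)
  have hgrowth := (hY ε hε).periodL1_le hε.1 (hM ε hε)
    (fun τ hτ => (le_abs_self _).trans (hsource τ hτ)) t ht
  rw [abs_of_nonneg (periodL1_nonneg _)]
  calc periodL1 (Y ε t) ≤ periodL1 (gε ε) + C * ε ^ (-a) * t := hgrowth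
    _ ≤ C' * ε ^ (-a) + C * ε ^ (-a) * |T| := by
        gcongr
        · exact (le_abs_self _).trans (hinitial t ht)
        · exact ht.2.trans (le_abs_self T)
    _ = (C' + C * |T|) * ε ^ (-a) := by ring

/- Both regimes of interest are instances: `Λ ε` is the identity when the solution itself is used,
and mollification at scale `ε^α` when it is smoothed. -/
theorem isWeakAsymptotic_clm {U F S : ℝ → ℝ → ℝ → ℝ} {y₀ : ℝ → ℝ → ℝ}
    (hY : ∀ ε ∈ Ioo (0 : ℝ) 1, IsTransportSolution ε (u ε) (S ε) (y₀ ε) (Y ε))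
    (Λ : ∀ ε ∈ Ioo (0 : ℝ) 1, (ℝ →ᵇ ℝ) →L[ℝ] (ℝ →ᵇ ℝ))
    (hU : ∀ ε hε t, U ε t = Λ ε hε (Y ε t))
    (hF : ∀ ε ∈ Ioo (0 : ℝ) 1, ∀ t, 0 ≤ t → Continuous (F ε t))
    (hres : ∀ ψ, IsTest ψ → ∀ T, ∃ a < 0, ∃ N, IsPowBounded T a N ∧
      ∀ ε hε, ∀ t ∈ Icc 0 T, ∀ G : ℝ →ᵇ ℝ,
        (∀ x, G x = 2 * upwind ε (u ε t) (Y ε t) x - S ε t x) →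
        |∫ x, (Λ ε hε G x * ψ x - F ε t x * deriv ψ x)| ≤ N ε t)
    (hg : TendstoDistrib (fun ε => U ε 0) g) : IsWeakAsymptotic U F g := by
  have hderiv : ∀ ε hε t, 0 ≤ t → ∃ G : ℝ →ᵇ ℝ,
      (∀ x, G x = 2 * upwind ε (u ε t) (Y ε t) x - S ε t x) ∧
      ∀ x, HasDerivWithinAt (fun τ => U ε τ x) (Λ ε hε G x) (Ici 0) t := fun ε hε t ht => by
    obtain ⟨G, hG, hGd⟩ := (hY ε hε).ode t ht
    refine ⟨G, hG, fun x => ?_⟩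
    simp only [hU ε hε]
    exact (((BoundedContinuousFunction.evalCLM ℝ x).comp (Λ ε hε)).hasFDerivAt
      (x := Y ε t)).comp_hasDerivWithinAt t hGd
  have hderivWithin : ∀ ε hε t, 0 ≤ t → ∃ G : ℝ →ᵇ ℝ,
      (∀ x, G x = 2 * upwind ε (u ε t) (Y ε t) x - S ε t x) ∧
      (fun x => derivWithin (fun τ => U ε τ x) (Ici 0) t) = Λ ε hε G := fun ε hε t ht => by
    obtain ⟨G, hG, hGd⟩ := hderiv ε hε t ht
    exact ⟨G, hG, funext fun x => (hGd x).derivWithin (uniqueDiffOn_Ici 0 t ht)⟩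
  refine ⟨fun ε hε t ht x => ?_, fun ε hε t ht => ?_,
    fun ε hε t ht => (hF ε hε t ht).locallyIntegrable, fun ψ hψ T => ?_, hg⟩
  · obtain ⟨G, -, hGd⟩ := hderiv ε hε t ht
    exact (hGd x).differentiableWithinAt
  · obtain ⟨G, -, hGd⟩ := hderivWithin ε hε t ht
    rw [hGd]
    exact (Λ ε hε G).continuous.locallyIntegrable
  · obtain ⟨a, ha, N, hN, hle⟩ := hres ψ hψ T
    refine (hN.of_abs_le fun ε hε t ht => ?_).tendstoUniformlyOn ha
    obtain ⟨G, hG, hGd⟩ := hderivWithin ε hε t ht.1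
    have hresidual : weakResidual U F ψ ε t =
        ∫ x, (Λ ε hε G x * ψ x - F ε t x * deriv ψ x) := by
      simp only [weakResidual, congrFun hGd]
    rw [hresidual]
    exact hle ε hε t ht G hG

lemma tendstoDistrib_smoothed (hφ : IsMollifier φ) (hα : 0 < α) (hg : IsRegularization g gε)
    (hY : ∀ ε ∈ Ioo (0 : ℝ) 1, ∀ x, Y ε 0 x = gε ε x) :
    TendstoDistrib (fun ε => smoothed φ α Y ε 0) g := fun ψ hψ => by
  obtain ⟨C, -, hC⟩ := exists_abs_integral_mollify_mul_sub_le hφ hψ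
  have herror : TendstoUniformlyOn
      (fun ε (_ : ℝ) => (∫ x, smoothed φ α Y ε 0 x * ψ x) - ∫ x, gε ε x * ψ x)
      (fun _ => 0) (𝓝[>] 0) (Icc 0 0) := by
    refine ((((IsPowBounded.rpow α).const_mul C).mul (hg.isPowBounded 0)).of_abs_le
      fun ε hε t _ => ?_).tendstoUniformlyOn (by linarith)
    simp only [smoothed, funext (hY ε hε)]
    exact hC (ε ^ α) (gε ε) (rpow_pos_of_mem_Ioo hε α) (rpow_le_one_of_mem_Ioo hε hα.le)
      (hg.continuous ε hε).locallyIntegrable (hg.periodic ε hε)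
  simpa only [sub_add_cancel, zero_add] using
    (herror.tendsto_at (x := 0) ⟨le_rfl, le_rfl⟩).add (hg.tendsto ψ hψ)

lemma continuous_smoothed {ε : ℝ} (hφ : IsTest φ) (hε : ε ∈ Ioo (0 : ℝ) 1) (t : ℝ) :
    Continuous (smoothed φ α Y ε t) :=
  continuous_mollify hφ (rpow_pos_of_mem_Ioo hε α) (Y ε t).continuous.locallyIntegrable

theorem isWeakAsymptotic_smoothed (hφ : IsMollifier φ) (hu : IsVelocityFamily β u₀ u)
    (hg : IsRegularization g gε)
    (hY : ∀ ε ∈ Ioo (0 : ℝ) 1,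
      IsTransportSolution ε (u ε) (fun t x => deriv (s ε t) x) (gε ε) (Y ε))
    (hs : ∀ ε ∈ Ioo (0 : ℝ) 1, ∀ t, 0 ≤ t → Differentiable ℝ (s ε t))
    (hsp : ∀ ε ∈ Ioo (0 : ℝ) 1, ∀ t, 0 ≤ t → Function.Periodic (s ε t) (2 * Real.pi))
    (ha : ∀ T, IsPowBounded T a fun ε t => periodL1 (Y ε t))
    (hb : ∀ T, IsPowBounded T b fun ε t => periodL1 (s ε t))
    (hα : 0 < α) (ha1 : a < 1) (haβ : a + β < α) (hbα : b < α) :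
    IsWeakAsymptotic (smoothed φ α Y)
      (fun ε t x => 2 * (u ε t x * smoothed φ α Y ε t x) + s ε t x) g := by
  obtain ⟨M, hM⟩ := hu.exists_isBoundedVelocity
  refine isWeakAsymptotic_clm hY (fun ε hε => mollifyL hφ.1 (rpow_pos_of_mem_Ioo hε α))
    (fun _ _ _ => rfl) (fun ε hε t ht => ?_) (fun ψ hψ T => ?_)
    (tendstoDistrib_smoothed hφ hα hg fun ε hε => (hY ε hε).initial)
  · have hu' := (hM ε hε).continuous ht
    have hv := continuous_smoothed (α := α) (Y := Y) hφ.1 hε t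
    have hs' := (hs ε hε t ht).continuous
    fun_prop
  · obtain ⟨C, -, hC⟩ := exists_mollified_residual_bound hφ hψ
    obtain ⟨L, hL0, hL⟩ := hu.exists_lipschitz T
    set m := max (-1 + a) (max (β + -α + a) (-α + b)) with hm
    have hm0 : m < 0 := by
      simp only [hm, max_lt_iff]
      exact ⟨by linarith, by linarith, by linarith⟩
    have hupwind : IsPowBounded T m fun ε t => M * ε ^ (1 : ℝ) * periodL1 (Y ε t) :=
      (((IsPowBounded.rpow 1).const_mul M).mul (ha T)).mono_exp (le_max_left _ _)
    have hcommutator : IsPowBounded T m fun ε t => L * (ε ^ β)⁻¹ * ε ^ α * periodL1 (Y ε t) :=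
      ((((IsPowBounded.inv_rpow β).const_mul L).mul (.rpow α)).mul (ha T)).mono_exp
        ((le_max_left _ _).trans (le_max_right _ _))
    have hsource : IsPowBounded T m fun ε t => ε ^ α * periodL1 (s ε t) :=
      ((IsPowBounded.rpow α).mul (hb T)).mono_exp ((le_max_right _ _).trans (le_max_right _ _))
    refine ⟨m, hm0, _, ((hupwind.add hcommutator).add hsource).const_mul C,
      fun ε hε t ht G hG => ?_⟩
    have hε0 := hε.1
    rw [Real.rpow_one]
    exact hC ε (ε ^ α) M (L * (ε ^ β)⁻¹) (u ε t) (Y ε t) G (s ε t) hε.1 hε.2.le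
      (rpow_pos_of_mem_Ioo hε α) (rpow_le_one_of_mem_Ioo hε hα.le) ((hM ε hε).continuous ht.1)
      ((hM ε hε).bounded t ht.1) (by positivity) (hL ε hε t ht) (Y ε t).continuous
      ((hY ε hε).periodic t ht.1) (hs ε hε t ht.1) ((hY ε hε).continuous_source (hM ε hε) ht.1)
      (hsp ε hε t ht.1) hG

-- The flux `s` that drives `Y` may differ from the flux `r` of the limit equation.
theorem isWeakAsymptotic_transport (hu : IsVelocityFamily β u₀ u) (hg : IsRegularization g gε)
    (hY : ∀ ε ∈ Ioo (0 : ℝ) 1,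
      IsTransportSolution ε (u ε) (fun t x => deriv (s ε t) x) (gε ε) (Y ε))
    (hs : ∀ ε ∈ Ioo (0 : ℝ) 1, ∀ t, 0 ≤ t → Differentiable ℝ (s ε t))
    {r : ℝ → ℝ → ℝ → ℝ} (hr : ∀ ε ∈ Ioo (0 : ℝ) 1, ∀ t, 0 ≤ t → Continuous (r ε t))
    (ha : ∀ T, IsPowBounded T a fun ε t => periodL1 (Y ε t)) (ha1 : a < 1)
    (hb : b < 0) (hsr : ∀ ψ : ℝ → ℝ, IsTest ψ → ∀ T,
      IsPowBounded T b fun ε t => |∫ x, (s ε t x - r ε t x) * deriv ψ x|) :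
    IsWeakAsymptotic (fun ε t x => Y ε t x)
      (fun ε t x => 2 * (u ε t x * Y ε t x) + r ε t x) g := by
  obtain ⟨M, hM⟩ := hu.exists_isBoundedVelocity
  refine isWeakAsymptotic_clm hY (fun ε _ => .id ℝ _) (fun _ _ _ => rfl) (fun ε hε t ht => ?_)
    (fun ψ hψ T => ?_) fun ψ hψ => (hg.tendsto ψ hψ).congr' ?_
  · have hu' := (hM ε hε).continuous ht
    have hr' := hr ε hε t ht
    fun_prop
  · obtain ⟨C, -, hC⟩ := exists_residual_bound hψ
    have hupwind : IsPowBounded T (max (-1 + a) b)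
        fun ε t => C * (M * ε ^ (1 : ℝ) * periodL1 (Y ε t)) :=
      ((((IsPowBounded.rpow 1).const_mul M).mul (ha T)).const_mul C).mono_exp (le_max_left _ _)
    refine ⟨_, max_lt (by linarith) hb, _,
      hupwind.add ((hsr ψ hψ T).mono_exp (le_max_right _ _)), fun ε hε t ht G hG => ?_⟩
    rw [Real.rpow_one]
    exact hC ε M (u ε t) (Y ε t) G (s ε t) (r ε t) hε.1 hε.2.le
      ((hM ε hε).continuous ht.1) ((hM ε hε).bounded t ht.1)
      (Y ε t).continuous ((hY ε hε).periodic t ht.1) (hs ε hε t ht.1)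
      ((hY ε hε).continuous_source (hM ε hε) ht.1) (hr ε hε t ht.1) hG
  · filter_upwards [eventually_mem_Ioo] with ε hε
    simp only [(hY ε hε).initial]

end Families

/-- The family `f ε t` of functions on the torus is bounded, and of bounded variation, by
`O(ε^{-a})` as `ε → 0⁺`, uniformly for `t ∈ [0, T]`. -/
structure IsPowBoundedBV (T a : ℝ) (f : ℝ → ℝ → ℝ → ℝ) : Prop where
  sup : ∃ N, IsPowBounded T a N ∧ ∀ ε ∈ Ioo (0 : ℝ) 1, ∀ t ∈ Icc 0 T, ∀ x, |f ε t x| ≤ N ε t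
  variation : IsPowBounded T a fun ε t => periodL1 (deriv (f ε t))

section PowerCounting

variable {T a b : ℝ} {f g : ℝ → ℝ → ℝ → ℝ}

lemma periodL1_zero : periodL1 (fun _ => 0) = 0 := by simp [periodL1]

lemma isPowBounded_periodL1_add (hf : ∀ ε ∈ Ioo (0 : ℝ) 1, IsTorusCurve (f ε))
    (hg : ∀ ε ∈ Ioo (0 : ℝ) 1, IsTorusCurve (g ε))
    (h : IsPowBounded T a fun ε t => periodL1 (f ε t))
    (h' : IsPowBounded T a fun ε t => periodL1 (g ε t)) :
    IsPowBounded T a fun ε t => periodL1 fun x => f ε t x + g ε t x :=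
  (h.add h').of_abs_le fun ε hε t ht => by
    rw [abs_of_nonneg (periodL1_nonneg _)]
    exact periodL1_add_le ((hf ε hε).continuous ht.1) ((hg ε hε).continuous ht.1)

lemma isPowBounded_periodL1_mul (hf : ∀ ε ∈ Ioo (0 : ℝ) 1, IsTorusCurve (f ε))
    (hg : ∀ ε ∈ Ioo (0 : ℝ) 1, IsTorusCurve (g ε))
    (h : ∃ N, IsPowBounded T a N ∧ ∀ ε ∈ Ioo (0 : ℝ) 1, ∀ t ∈ Icc 0 T, ∀ x, |f ε t x| ≤ N ε t)
    (h' : IsPowBounded T b fun ε t => periodL1 (g ε t)) :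
    IsPowBounded T (a + b) fun ε t => periodL1 fun x => f ε t x * g ε t x := by
  obtain ⟨N, hN, hfN⟩ := h
  refine (hN.mul h').of_abs_le fun ε hε t ht => ?_
  rw [abs_of_nonneg (periodL1_nonneg _)]
  exact periodL1_mul_le ((hf ε hε).continuous ht.1) ((hg ε hε).continuous ht.1) (hfN ε hε t ht)

namespace IsPowBoundedBV

lemma mono_exp (h : IsPowBoundedBV T a f) (hab : a ≤ b) : IsPowBoundedBV T b f := by
  obtain ⟨N, hN, hfN⟩ := h.sup
  exact ⟨⟨N, hN.mono_exp hab, hfN⟩, h.variation.mono_exp hab⟩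

lemma isPowBounded_periodL1 (hf : ∀ ε ∈ Ioo (0 : ℝ) 1, IsTorusCurve (f ε))
    (h : IsPowBoundedBV T a f) : IsPowBounded T a fun ε t => periodL1 (f ε t) := by
  obtain ⟨N, hN, hfN⟩ := h.sup
  refine (hN.const_mul (2 * Real.pi)).of_abs_le fun ε hε t ht => ?_
  rw [abs_of_nonneg (periodL1_nonneg _)]
  exact periodL1_le_of_abs_le ((hf ε hε).continuous ht.1) (hfN ε hε t ht)

lemma const (c : ℝ) : IsPowBoundedBV T 0 fun _ _ _ => c :=
  ⟨⟨_, .const |c|, fun _ _ _ _ _ => le_rfl⟩, by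
    simpa only [deriv_const', periodL1_zero] using .const 0⟩

protected lemma add (hf : ∀ ε ∈ Ioo (0 : ℝ) 1, IsTorusCurveC1 (f ε))
    (hg : ∀ ε ∈ Ioo (0 : ℝ) 1, IsTorusCurveC1 (g ε))
    (h : IsPowBoundedBV T a f) (h' : IsPowBoundedBV T a g) :
    IsPowBoundedBV T a fun ε t x => f ε t x + g ε t x := by
  obtain ⟨N, hN, hfN⟩ := h.sup
  obtain ⟨N', hN', hgN'⟩ := h'.sup
  refine ⟨⟨_, hN.add hN', fun ε hε t ht x =>
    (abs_add_le _ _).trans (add_le_add (hfN ε hε t ht x) (hgN' ε hε t ht x))⟩, ?_⟩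
  refine (h.variation.add h'.variation).of_abs_le fun ε hε t ht => ?_
  have hderiv : deriv (fun x => f ε t x + g ε t x) = fun x => deriv (f ε t) x + deriv (g ε t) x :=
    funext fun x =>
      deriv_fun_add ((hf ε hε).differentiable t ht.1 x) ((hg ε hε).differentiable t ht.1 x)
  rw [abs_of_nonneg (periodL1_nonneg _), hderiv]
  exact periodL1_add_le ((hf ε hε).curve_deriv.continuous ht.1)
    ((hg ε hε).curve_deriv.continuous ht.1)

protected lemma mul (hf : ∀ ε ∈ Ioo (0 : ℝ) 1, IsTorusCurveC1 (f ε))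
    (hg : ∀ ε ∈ Ioo (0 : ℝ) 1, IsTorusCurveC1 (g ε))
    (h : IsPowBoundedBV T a f) (h' : IsPowBoundedBV T b g) :
    IsPowBoundedBV T (a + b) fun ε t x => f ε t x * g ε t x := by
  obtain ⟨N, hN, hfN⟩ := h.sup
  obtain ⟨N', hN', hgN'⟩ := h'.sup
  refine ⟨⟨_, hN.mul hN', fun ε hε t ht x => ?_⟩, ?_⟩
  · rw [abs_mul]
    exact mul_le_mul (hfN ε hε t ht x) (hgN' ε hε t ht x) (abs_nonneg _)
      ((abs_nonneg _).trans (hfN ε hε t ht x))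
  · have hgdf := isPowBounded_periodL1_mul (fun ε hε => (hg ε hε).curve)
      (fun ε hε => (hf ε hε).curve_deriv) h'.sup h.variation
    have hfdg := isPowBounded_periodL1_mul (fun ε hε => (hf ε hε).curve)
      (fun ε hε => (hg ε hε).curve_deriv) h.sup h'.variation
    rw [add_comm b a] at hgdf
    refine (isPowBounded_periodL1_add
      (fun ε hε => (hg ε hε).curve.mul (hf ε hε).curve_deriv)
      (fun ε hε => (hf ε hε).curve.mul (hg ε hε).curve_deriv) hgdf hfdg).of_abs_le
      fun ε hε t ht => ?_
    rw [abs_of_nonneg (periodL1_nonneg _)]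
    refine (congrArg periodL1 (funext fun x => ?_)).le
    rw [deriv_fun_mul ((hf ε hε).differentiable t ht.1 x) ((hg ε hε).differentiable t ht.1 x),
      mul_comm (deriv (f ε t) x)]

lemma const_mul (hf : ∀ ε ∈ Ioo (0 : ℝ) 1, IsTorusCurveC1 (f ε)) (h : IsPowBoundedBV T a f)
    (c : ℝ) : IsPowBoundedBV T a fun ε t x => c * f ε t x := by
  simpa only [zero_add] using (const c).mul (fun _ _ => .const c) hf h

protected lemma pow (hf : ∀ ε ∈ Ioo (0 : ℝ) 1, IsTorusCurveC1 (f ε)) (h : IsPowBoundedBV T a f)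
    (n : ℕ) : IsPowBoundedBV T (n * a) fun ε t x => f ε t x ^ n := by
  induction n with
  | zero => simpa only [Nat.cast_zero, zero_mul, pow_zero] using const 1
  | succ n ih =>
    simpa only [Nat.cast_succ, add_mul, one_mul, pow_succ] using
      ih.mul (fun ε hε => (hf ε hε).pow n) hf h

protected lemma sum {ι : Type*} (s : Finset ι) {f : ι → ℝ → ℝ → ℝ → ℝ} (ha : 0 ≤ a)
    (hf : ∀ i ∈ s, ∀ ε ∈ Ioo (0 : ℝ) 1, IsTorusCurveC1 (f i ε))
    (h : ∀ i ∈ s, IsPowBoundedBV T a (f i)) :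
    IsPowBoundedBV T a fun ε t x => ∑ i ∈ s, f i ε t x := by
  classical
  induction s using Finset.induction_on with
  | empty => simpa only [Finset.sum_empty] using (const 0).mono_exp ha
  | insert i s hi ih =>
    have hfs : ∀ j ∈ s, ∀ ε ∈ Ioo (0 : ℝ) 1, IsTorusCurveC1 (f j ε) := fun j hj =>
      hf j (Finset.mem_insert_of_mem hj)
    simp_rw [Finset.sum_insert hi]
    exact (h i (Finset.mem_insert_self i s)).add (hf i (Finset.mem_insert_self i s))
      (fun ε hε => .sum s fun j hj => hfs j hj ε hε)
      (ih hfs fun j hj => h j (Finset.mem_insert_of_mem hj))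

end IsPowBoundedBV

/- The sup norm of a mollification, as well as its variation, costs one power of the scale over
the `L¹` norm. -/
lemma isPowBoundedBV_mollify {k : ℝ → ℝ} {α : ℝ} (hk : IsTest k) (hα : 0 ≤ α)
    (hf : ∀ ε ∈ Ioo (0 : ℝ) 1, IsTorusCurve (f ε))
    (h : IsPowBounded T a fun ε t => periodL1 (f ε t)) :
    IsPowBoundedBV T (α + a) fun ε t => mollify k (ε ^ α) (f ε t) := by
  have hscaled := (IsPowBounded.inv_rpow α).mul h
  constructor
  · obtain ⟨C, -, hC⟩ := exists_mollify_sup_bound hk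
    refine ⟨_, hscaled.const_mul C, fun ε hε t ht x => ?_⟩
    rw [← mul_assoc]
    exact hC _ _ (rpow_pos_of_mem_Ioo hε α) (rpow_le_one_of_mem_Ioo hε hα)
      ((hf ε hε).continuous ht.1) ((hf ε hε).periodic ht.1) x
  · refine (hscaled.const_mul (∫ z, |deriv k z|)).of_abs_le fun ε hε t ht => ?_
    have hδ := rpow_pos_of_mem_Ioo hε α
    have hc := (hf ε hε).continuous ht.1
    rw [abs_of_nonneg (periodL1_nonneg _),
      funext fun x => (hasDerivAt_mollify hk hδ hc.locallyIntegrable x).deriv,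
      periodL1_const_mul, abs_of_pos (inv_pos.2 hδ), mul_left_comm]
    exact mul_le_mul_of_nonneg_left (periodL1_mollify_le hk.deriv hδ hc
      ((hf ε hε).periodic ht.1)) (inv_pos.2 hδ).le

end PowerCounting

section Four

variable {φ u₀ v₀ w₀ Z₀ : ℝ → ℝ} {n : ℕ} {α β γ T : ℝ} {u : ℝ → ℝ → ℝ → ℝ}
  {v₀ε w₀ε Z₀ε : ℝ → ℝ → ℝ} {X w Z : ℝ → ℝ → (ℝ →ᵇ ℝ)}

lemma isTorusCurveC1_smoothed (hφ : IsTest φ) {ε : ℝ} (hε : ε ∈ Ioo (0 : ℝ) 1)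
    (hX : IsTorusCurve fun t => X ε t) : IsTorusCurveC1 (smoothed φ α X ε) :=
  isTorusCurveC1_mollify hX hφ (rpow_pos_of_mem_Ioo hε α)

theorem exists_fourConstruction (hφ : IsTest φ) (hu : IsVelocityFamily β u₀ u)
    (hv₀ : IsRegularization v₀ v₀ε) (hw₀ : IsRegularization w₀ w₀ε)
    (hZ₀ : IsRegularization Z₀ Z₀ε) (n : ℕ) (α γ : ℝ) :
    ∃ X w Z : ℝ → ℝ → (ℝ →ᵇ ℝ), IsFourConstruction φ n α γ u v₀ε w₀ε Z₀ε X w Z := by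
  obtain ⟨X, hX⟩ := hu.exists_isTransportSolution hv₀ (S := fun _ _ _ => 0) fun _ _ => .const 0
  have hv : ∀ ε ∈ Ioo (0 : ℝ) 1, IsTorusCurveC1 (smoothed φ α X ε) := fun ε hε =>
    isTorusCurveC1_smoothed hφ hε (hX ε hε).isTorusCurve
  obtain ⟨w, hw⟩ := hu.exists_isTransportSolution hw₀ fun ε hε =>
    (IsTorusCurve.const 2).mul ((hv ε hε).pow n).curve_deriv
  obtain ⟨Z, hZ⟩ := hu.exists_isTransportSolution hZ₀ fun ε hε =>
    (IsTorusCurve.const 6).mul (isTorusCurveC1_mollify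
      ((hv ε hε).curve.mul (hw ε hε).isTorusCurve) hφ (rpow_pos_of_mem_Ioo hε γ)).curve_deriv
  exact ⟨X, w, Z, hX, hw, hZ⟩

theorem fourConstruction_unique (hu : IsVelocityFamily β u₀ u)
    {X' w' Z' : ℝ → ℝ → (ℝ →ᵇ ℝ)} (h : IsFourConstruction φ n α γ u v₀ε w₀ε Z₀ε X w Z)
    (h' : IsFourConstruction φ n α γ u v₀ε w₀ε Z₀ε X' w' Z') {ε : ℝ} (hε : ε ∈ Ioo (0 : ℝ) 1)
    {t : ℝ} (ht : 0 ≤ t) : X ε t = X' ε t ∧ w ε t = w' ε t ∧ Z ε t = Z' ε t := by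
  obtain ⟨M, hM⟩ := hu.exists_isBoundedVelocity
  have hX : ∀ t, 0 ≤ t → X ε t = X' ε t := fun _ =>
    (h.X_eq ε hε).unique (hM ε hε) (fun _ _ _ => rfl) (h'.X_eq ε hε)
  have hv : ∀ t, 0 ≤ t → smoothed φ α X ε t = smoothed φ α X' ε t := fun t ht => by
    funext x
    simp only [smoothed, hX t ht]
  have hw : ∀ t, 0 ≤ t → w ε t = w' ε t := fun _ =>
    (h.w_eq ε hε).unique (hM ε hε) (fun t ht x => by rw [hv t ht]) (h'.w_eq ε hε)
  have hZ : ∀ t, 0 ≤ t → Z ε t = Z' ε t := fun _ =>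
    (h.Z_eq ε hε).unique (hM ε hε) (fun t ht x => by rw [hv t ht, hw t ht]) (h'.Z_eq ε hε)
  exact ⟨hX t ht, hw t ht, hZ t ht⟩

namespace IsFourConstruction

lemma isTorusCurveC1_v (h : IsFourConstruction φ n α γ u v₀ε w₀ε Z₀ε X w Z) (hφ : IsTest φ)
    {ε : ℝ} (hε : ε ∈ Ioo (0 : ℝ) 1) : IsTorusCurveC1 (smoothed φ α X ε) :=
  isTorusCurveC1_smoothed hφ hε (h.X_eq ε hε).isTorusCurve

lemma isTorusCurve_vw (h : IsFourConstruction φ n α γ u v₀ε w₀ε Z₀ε X w Z) (hφ : IsTest φ)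
    {ε : ℝ} (hε : ε ∈ Ioo (0 : ℝ) 1) : IsTorusCurve fun t x => smoothed φ α X ε t x * w ε t x :=
  (h.isTorusCurveC1_v hφ hε).curve.mul (h.w_eq ε hε).isTorusCurve

lemma isTransportSolution_w (h : IsFourConstruction φ n α γ u v₀ε w₀ε Z₀ε X w Z) {ε : ℝ}
    (hε : ε ∈ Ioo (0 : ℝ) 1) : IsTransportSolution ε (u ε)
      (fun t x => deriv (fun y => 2 * smoothed φ α X ε t y ^ n) x) (w₀ε ε) (w ε) := by
  simpa only [deriv_const_mul_field] using h.w_eq ε hε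

lemma isTransportSolution_Z (h : IsFourConstruction φ n α γ u v₀ε w₀ε Z₀ε X w Z) {ε : ℝ}
    (hε : ε ∈ Ioo (0 : ℝ) 1) : IsTransportSolution ε (u ε)
      (fun t x => deriv (fun z => 6 * mollify φ (ε ^ γ)
        (fun y => smoothed φ α X ε t y * w ε t y) z) x) (Z₀ε ε) (Z ε) := by
  simpa only [deriv_const_mul_field] using h.Z_eq ε hε

lemma isPowBounded_X (h : IsFourConstruction φ n α γ u v₀ε w₀ε Z₀ε X w Z)
    (hu : IsVelocityFamily β u₀ u) (hv₀ : IsRegularization v₀ v₀ε) :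
    IsPowBounded T 0 fun ε t => periodL1 (X ε t) :=
  hu.isPowBounded_periodL1 hv₀ h.X_eq le_rfl (by simpa only [periodL1_zero] using .const 0)

lemma isPowBoundedBV_v (h : IsFourConstruction φ n α γ u v₀ε w₀ε Z₀ε X w Z)
    (hφ : IsTest φ) (hα : 0 ≤ α) (hu : IsVelocityFamily β u₀ u) (hv₀ : IsRegularization v₀ v₀ε) :
    IsPowBoundedBV T α (smoothed φ α X) := by
  have hv := isPowBoundedBV_mollify hφ hα (fun ε hε => (h.X_eq ε hε).isTorusCurve)
    (h.isPowBounded_X (T := T) hu hv₀)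
  rwa [add_zero] at hv

lemma isPowBounded_w (h : IsFourConstruction φ n α γ u v₀ε w₀ε Z₀ε X w Z)
    (hφ : IsTest φ) (hα : 0 ≤ α) (hu : IsVelocityFamily β u₀ u) (hv₀ : IsRegularization v₀ v₀ε)
    (hw₀ : IsRegularization w₀ w₀ε) : IsPowBounded T (n * α) fun ε t => periodL1 (w ε t) := by
  have hv : ∀ ε ∈ Ioo (0 : ℝ) 1, IsTorusCurveC1 (smoothed φ α X ε) := fun _ =>
    h.isTorusCurveC1_v hφ
  exact hu.isPowBounded_periodL1 hw₀ (fun _ => h.isTransportSolution_w) (by positivity)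
    (((h.isPowBoundedBV_v hφ hα hu hv₀).pow hv n).const_mul (fun ε hε => (hv ε hε).pow n) 2).2

lemma isPowBounded_vw (h : IsFourConstruction φ n α γ u v₀ε w₀ε Z₀ε X w Z)
    (hφ : IsTest φ) (hα : 0 ≤ α) (hu : IsVelocityFamily β u₀ u) (hv₀ : IsRegularization v₀ v₀ε)
    (hw₀ : IsRegularization w₀ w₀ε) : IsPowBounded T (α + n * α) fun ε t =>
      periodL1 fun x => smoothed φ α X ε t x * w ε t x :=
  isPowBounded_periodL1_mul (fun _ hε => (h.isTorusCurveC1_v hφ hε).curve)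
    (fun ε hε => (h.w_eq ε hε).isTorusCurve) (h.isPowBoundedBV_v hφ hα hu hv₀).sup
    (h.isPowBounded_w hφ hα hu hv₀ hw₀)

lemma isPowBounded_Z (h : IsFourConstruction φ n α γ u v₀ε w₀ε Z₀ε X w Z)
    (hφ : IsTest φ) (hα : 0 ≤ α) (hγ : 0 ≤ γ) (hu : IsVelocityFamily β u₀ u)
    (hv₀ : IsRegularization v₀ v₀ε) (hw₀ : IsRegularization w₀ w₀ε)
    (hZ₀ : IsRegularization Z₀ Z₀ε) :
    IsPowBounded T (γ + (α + n * α)) fun ε t => periodL1 (Z ε t) :=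
  hu.isPowBounded_periodL1 hZ₀ (fun _ => h.isTransportSolution_Z) (by positivity)
    ((isPowBoundedBV_mollify hφ hγ (fun _ => h.isTorusCurve_vw hφ)
      (h.isPowBounded_vw hφ hα hu hv₀ hw₀)).const_mul (fun _ hε => isTorusCurveC1_mollify
        (h.isTorusCurve_vw hφ hε) hφ (rpow_pos_of_mem_Ioo hε γ)) 6).variation

theorem isWeakAsymptotic_v (h : IsFourConstruction φ n α γ u v₀ε w₀ε Z₀ε X w Z)
    (hφ : IsMollifier φ) (hβ : 0 < β) (hα : β < α) (hu : IsVelocityFamily β u₀ u)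
    (hv₀ : IsRegularization v₀ v₀ε) :
    IsWeakAsymptotic (smoothed φ α X) (fun ε t x => 2 * (u ε t x * smoothed φ α X ε t x)) v₀ := by
  have hα0 := hβ.trans hα
  simpa only [add_zero] using isWeakAsymptotic_smoothed (s := fun _ _ _ => 0) (b := 0) hφ hu hv₀
    (fun ε hε => by simpa only [deriv_const'] using h.X_eq ε hε)
    (fun _ _ _ _ => differentiable_const 0) (fun _ _ _ _ _ => rfl)
    (fun _ => h.isPowBounded_X hu hv₀) (fun _ => by simpa only [periodL1_zero] using .const 0)
    hα0 one_pos (by rwa [zero_add]) hα0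

theorem isWeakAsymptotic_w (h : IsFourConstruction φ n α γ u v₀ε w₀ε Z₀ε X w Z)
    (hφ : IsTest φ) (hα : 0 ≤ α) (hn : n * α < 1) (hu : IsVelocityFamily β u₀ u)
    (hv₀ : IsRegularization v₀ v₀ε) (hw₀ : IsRegularization w₀ w₀ε) :
    IsWeakAsymptotic (fun ε t x => w ε t x)
      (fun ε t x => 2 * (u ε t x * w ε t x) + 2 * smoothed φ α X ε t x ^ n) w₀ := by
  have hflux : ∀ ε ∈ Ioo (0 : ℝ) 1, ∀ t, 0 ≤ t →
      Differentiable ℝ fun x => 2 * smoothed φ α X ε t x ^ n := fun _ hε =>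
    (((h.isTorusCurveC1_v hφ hε).pow n).const_mul 2).differentiable
  exact isWeakAsymptotic_transport (b := -1) hu hw₀ (fun _ => h.isTransportSolution_w) hflux
    (fun ε hε t ht => (hflux ε hε t ht).continuous)
    (fun _ => h.isPowBounded_w hφ hα hu hv₀ hw₀) hn (by norm_num) fun ψ _ T => by
      simpa only [sub_self, zero_mul, integral_zero, abs_zero, zero_add] using
        (IsPowBounded.const 0).mul (.rpow 1)

lemma isPowBounded_mollify_vw_error (h : IsFourConstruction φ n α γ u v₀ε w₀ε Z₀ε X w Z)
    (hφ : IsMollifier φ) (hα : 0 ≤ α) (hγ : 0 ≤ γ) (hu : IsVelocityFamily β u₀ u)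
    (hv₀ : IsRegularization v₀ v₀ε) (hw₀ : IsRegularization w₀ w₀ε) {ψ : ℝ → ℝ} (hψ : IsTest ψ) :
    IsPowBounded T (-γ + (α + n * α)) fun ε t =>
      |∫ x, (6 * mollify φ (ε ^ γ) (fun y => smoothed φ α X ε t y * w ε t y) x -
        6 * (smoothed φ α X ε t x * w ε t x)) * ψ x| := by
  obtain ⟨C, -, hC⟩ := exists_abs_integral_mollify_mul_sub_le hφ hψ
  refine ((((IsPowBounded.rpow γ).const_mul C).mul
    (h.isPowBounded_vw hφ.1 hα hu hv₀ hw₀)).const_mul 6).of_abs_le fun ε hε t ht => ?_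
  have hδ := rpow_pos_of_mem_Ioo hε γ
  have hvw := h.isTorusCurve_vw hφ.1 hε
  have hvwc := hvw.continuous ht.1
  simp_rw [← mul_sub, mul_assoc (6 : ℝ), sub_mul]
  rw [integral_const_mul, integral_sub
    (integrable_mul_test (continuous_mollify hφ.1 hδ hvwc.locallyIntegrable) hψ)
    (integrable_mul_test hvwc hψ), abs_abs, abs_mul, abs_of_pos (by norm_num : (0 : ℝ) < 6)]
  exact mul_le_mul_of_nonneg_left (hC _ _ hδ (rpow_le_one_of_mem_Ioo hε hγ)
    hvwc.locallyIntegrable (hvw.periodic ht.1)) (by norm_num)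

theorem isWeakAsymptotic_Z (h : IsFourConstruction φ n α γ u v₀ε w₀ε Z₀ε X w Z)
    (hφ : IsMollifier φ) (hα : 0 ≤ α) (hγ : α + n * α < γ) (hγ1 : γ + (α + n * α) < 1)
    (hu : IsVelocityFamily β u₀ u) (hv₀ : IsRegularization v₀ v₀ε)
    (hw₀ : IsRegularization w₀ w₀ε) (hZ₀ : IsRegularization Z₀ Z₀ε) :
    IsWeakAsymptotic (fun ε t x => Z ε t x)
      (fun ε t x => 2 * (u ε t x * Z ε t x) + 6 * (smoothed φ α X ε t x * w ε t x)) Z₀ := by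
  have hγ0 : 0 ≤ γ := le_trans (by positivity) hγ.le
  refine isWeakAsymptotic_transport (b := -γ + (α + n * α)) hu hZ₀
    (fun _ => h.isTransportSolution_Z)
    (fun ε hε t ht => ?_) (fun ε hε t ht => ?_)
    (fun _ => h.isPowBounded_Z hφ.1 hα hγ0 hu hv₀ hw₀ hZ₀) hγ1 (by linarith) fun ψ hψ T =>
      h.isPowBounded_mollify_vw_error hφ hα hγ0 hu hv₀ hw₀ hψ.deriv
  · exact ((isTorusCurveC1_mollify (h.isTorusCurve_vw hφ.1 hε) hφ.1
      (rpow_pos_of_mem_Ioo hε γ)).const_mul 6).differentiable t ht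
  · exact ((IsTorusCurve.const 6).mul (h.isTorusCurve_vw hφ.1 hε)).continuous ht

end IsFourConstruction

theorem isWeakAsymptoticFour (hφ : IsMollifier φ) (hu : IsVelocityFamily β u₀ u) (hβ : 0 < β)
    (hα : β < α) (hγ : (n + 2) * α < γ) (hγ1 : 2 * γ + (n + 2) * α < 1)
    (hv₀ : IsRegularization v₀ v₀ε) (hw₀ : IsRegularization w₀ w₀ε)
    (hZ₀ : IsRegularization Z₀ Z₀ε) (h : IsFourConstruction φ n α γ u v₀ε w₀ε Z₀ε X w Z) :
    IsWeakAsymptoticFour n u (smoothed φ α X) (fun ε t x => w ε t x) (fun ε t x => Z ε t x)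
      u₀ v₀ w₀ Z₀ := by
  have hα0 : 0 < α := hβ.trans hα
  have hnα : 0 ≤ n * α := by positivity
  rw [add_mul] at hγ hγ1
  exact ⟨hu.weak, h.isWeakAsymptotic_v hφ hβ hα hu hv₀,
    h.isWeakAsymptotic_w hφ.1 hα0.le (by linarith) hu hv₀ hw₀,
    h.isWeakAsymptotic_Z hφ hα0.le (by linarith) (by linarith) hu hv₀ hw₀ hZ₀⟩

end Four

section HierarchySource

variable {U U' : ℕ → ℝ → ℝ → ℝ → ℝ} {k : ℕ} {ε t : ℝ}

lemma mem_Ico_of_mem_filter_antidiagonal {q : ℕ × ℕ}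
    (hq : q ∈ (Finset.HasAntidiagonal.antidiagonal k).filter fun q => 1 ≤ q.1 ∧ 1 ≤ q.2) :
    q.1 ∈ Ico 1 k ∧ q.2 ∈ Ico 1 k := by
  simp only [Finset.mem_filter, Finset.HasAntidiagonal.mem_antidiagonal] at hq
  simp only [mem_Ico]
  omega

lemma hierarchyFlux_zero : hierarchyFlux U 0 = fun ε t x => U 0 ε t x ^ 2 := by
  funext ε t x
  simp [hierarchyFlux, sq]

lemma hierarchyFlux_eq_add_hierarchySource (hk : 1 ≤ k) (ε t x : ℝ) :
    hierarchyFlux U k ε t x = 2 * (U 0 ε t x * U k ε t x) + hierarchySource U k ε t x := by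
  have hends : (Finset.HasAntidiagonal.antidiagonal k).filter
      (fun q : ℕ × ℕ => ¬(1 ≤ q.1 ∧ 1 ≤ q.2)) = {(0, k), (k, 0)} := by
    ext ⟨i, j⟩
    simp only [Finset.mem_filter, Finset.HasAntidiagonal.mem_antidiagonal, Finset.mem_insert,
      Finset.mem_singleton, Prod.mk.injEq]
    omega
  have hne : ((0, k) : ℕ × ℕ) ≠ (k, 0) := fun h => by
    rw [Prod.mk.injEq] at h
    omega
  rw [hierarchyFlux, hierarchySource,
    ← Finset.sum_filter_not_add_sum_filter _ fun q : ℕ × ℕ => 1 ≤ q.1 ∧ 1 ≤ q.2, hends,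
    Finset.sum_pair hne, Nat.choose_zero_right, Nat.choose_self]
  ring

lemma hierarchySource_one : hierarchySource U 1 = fun _ _ _ => 0 := by
  have hempty : (Finset.HasAntidiagonal.antidiagonal 1).filter
      (fun q : ℕ × ℕ => 1 ≤ q.1 ∧ 1 ≤ q.2) = ∅ := by decide
  funext ε t x
  rw [hierarchySource, hempty, Finset.sum_empty]

lemma hierarchySource_congr (h : ∀ i ∈ Ico 1 k, U i ε t = U' i ε t) :
    hierarchySource U k ε t = hierarchySource U' k ε t := by
  funext x
  refine Finset.sum_congr rfl fun q hq => ?_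
  obtain ⟨hq₁, hq₂⟩ := mem_Ico_of_mem_filter_antidiagonal hq
  rw [h _ hq₁, h _ hq₂]

lemma isTorusCurveC1_hierarchySource (hU : ∀ i ∈ Ico 1 k, IsTorusCurveC1 (U i ε)) :
    IsTorusCurveC1 (hierarchySource U k ε) :=
  .sum _ fun q hq =>
    have hq' := mem_Ico_of_mem_filter_antidiagonal hq
    ((hU q.1 hq'.1).mul (hU q.2 hq'.2)).const_mul _

lemma isPowBoundedBV_hierarchySource {T b : ℝ} {a : ℕ → ℝ}
    (hU : ∀ i ∈ Ico 1 k, ∀ ε ∈ Ioo (0 : ℝ) 1, IsTorusCurveC1 (U i ε))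
    (h : ∀ i ∈ Ico 1 k, IsPowBoundedBV T (a i) (U i)) (hb : 0 ≤ b)
    (hab : ∀ i ∈ Ico 1 k, ∀ j ∈ Ico 1 k, a i + a j ≤ b) :
    IsPowBoundedBV T b (hierarchySource U k) := by
  refine IsPowBoundedBV.sum _ hb (fun q hq ε hε => ?_) fun q hq => ?_ <;>
    obtain ⟨hq₁, hq₂⟩ := mem_Ico_of_mem_filter_antidiagonal hq
  · exact ((hU _ hq₁ ε hε).mul (hU _ hq₂ ε hε)).const_mul _
  · exact (((h _ hq₁).mul (hU _ hq₁) (hU _ hq₂) (h _ hq₂)).const_mul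
      (fun ε hε => (hU _ hq₁ ε hε).mul (hU _ hq₂ ε hε)) _).mono_exp (hab _ hq₁ _ hq₂)

end HierarchySource

section Hierarchy

variable {φ u₀ : ℝ → ℝ} {p : ℕ} {α : ℕ → ℝ} {β T : ℝ} {u : ℝ → ℝ → ℝ → ℝ}
  {g : ℕ → ℝ → ℝ} {gε : ℕ → ℝ → ℝ → ℝ} {X X' : ℕ → ℝ → ℝ → (ℝ →ᵇ ℝ)} {i k : ℕ}

lemma hierarchyFamily_of_pos (hk : 1 ≤ k) :
    hierarchyFamily φ α u X k = smoothed φ (α k) (X k) :=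
  if_neg (by omega)

lemma hierarchyFamily_congr {ε t : ℝ} (hk : 1 ≤ k) (h : X k ε t = X' k ε t) :
    hierarchyFamily φ α u X k ε t = hierarchyFamily φ α u X' k ε t := by
  funext x
  simp only [hierarchyFamily_of_pos hk, smoothed, h]

lemma isTorusCurveC1_hierarchyFamily (hφ : IsTest φ) {ε : ℝ} (hε : ε ∈ Ioo (0 : ℝ) 1)
    (hk : 1 ≤ k) (hX : IsTorusCurve fun t => X k ε t) :
    IsTorusCurveC1 (hierarchyFamily φ α u X k ε) := by
  rw [hierarchyFamily_of_pos hk]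
  exact isTorusCurveC1_smoothed hφ hε hX

theorem exists_hierarchyConstruction (hφ : IsTest φ) (hu : IsVelocityFamily β u₀ u) (α : ℕ → ℝ)
    (hg : ∀ k ∈ Icc 1 (p + 1), IsRegularization (g k) (gε k)) :
    ∃ X : ℕ → ℝ → ℝ → (ℝ →ᵇ ℝ), IsHierarchyConstruction φ p α u gε X := by
  suffices h : ∀ m ≤ p + 1, ∃ X : ℕ → ℝ → ℝ → (ℝ →ᵇ ℝ), ∀ k ∈ Icc 1 m,
      ∀ ε ∈ Ioo (0 : ℝ) 1, IsTransportSolution ε (u ε)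
        (fun t x => deriv (hierarchySource (hierarchyFamily φ α u X) k ε t) x) (gε k ε) (X k ε) from
    h (p + 1) le_rfl
  intro m
  induction m with
  | zero => exact fun _ => ⟨fun _ _ _ => 0, fun k hk => absurd (hk.1.trans hk.2) (by norm_num)⟩
  | succ m ih =>
    intro hm
    obtain ⟨X, hX⟩ := ih (by omega)
    have hsource : ∀ ε ∈ Ioo (0 : ℝ) 1,
        IsTorusCurveC1 (hierarchySource (hierarchyFamily φ α u X) (m + 1) ε) := fun ε hε =>
      isTorusCurveC1_hierarchySource fun i hi => isTorusCurveC1_hierarchyFamily hφ hε hi.1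
        (hX i ⟨hi.1, Nat.lt_succ_iff.1 hi.2⟩ ε hε).isTorusCurve
    obtain ⟨Y, hY⟩ := hu.exists_isTransportSolution (hg (m + 1) ⟨by omega, hm⟩) fun ε hε =>
      (hsource ε hε).curve_deriv
    refine ⟨Function.update X (m + 1) Y, fun k hk ε hε => ?_⟩
    have hupdate : ∀ t,
        hierarchySource (hierarchyFamily φ α u (Function.update X (m + 1) Y)) k ε t =
          hierarchySource (hierarchyFamily φ α u X) k ε t := fun t =>
      hierarchySource_congr fun i hi => hierarchyFamily_congr hi.1 (by
        rw [Function.update_of_ne (hi.2.trans_le hk.2).ne])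
    simp only [hupdate]
    rcases eq_or_ne k (m + 1) with rfl | hne
    · rw [Function.update_self]
      exact hY ε hε
    · rw [Function.update_of_ne hne]
      exact hX k ⟨hk.1, Nat.lt_succ_iff.1 (lt_of_le_of_ne hk.2 hne)⟩ ε hε

theorem hierarchyConstruction_unique (hu : IsVelocityFamily β u₀ u)
    (h : IsHierarchyConstruction φ p α u gε X) (h' : IsHierarchyConstruction φ p α u gε X')
    (hk : k ∈ Icc 1 (p + 1)) {ε : ℝ} (hε : ε ∈ Ioo (0 : ℝ) 1) {t : ℝ} (ht : 0 ≤ t) :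
    X k ε t = X' k ε t := by
  obtain ⟨M, hM⟩ := hu.exists_isBoundedVelocity
  induction k using Nat.strong_induction_on generalizing t with
  | _ k ih =>
    refine (h k hk ε hε).unique (hM ε hε) (fun t ht x => ?_) (h' k hk ε hε) ht
    rw [hierarchySource_congr fun i hi =>
      hierarchyFamily_congr hi.1 (ih i hi.2 ⟨hi.1, hi.2.le.trans hk.2⟩ ht)]

lemma scale_pos (h5 : ∀ k ∈ Icc 1 p, 5 * α k ≤ α (k + 1)) (h0 : 0 < α 1)
    (hk : k ∈ Icc 1 (p + 1)) : 0 < α k := by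
  obtain ⟨hk1, hkp⟩ := hk
  induction k, hk1 using Nat.le_induction with
  | base => exact h0
  | succ k hk1 ih => linarith [ih (by omega), h5 k ⟨hk1, by omega⟩]

lemma five_mul_scale_le (h5 : ∀ k ∈ Icc 1 p, 5 * α k ≤ α (k + 1)) (h0 : 0 < α 1)
    (hi : i ∈ Ico 1 k) (hk : k ≤ p + 1) : 5 * α i ≤ α k := by
  obtain ⟨hi1, hik⟩ := hi
  induction k, Nat.succ_le_of_lt hik using Nat.le_induction with
  | base => exact h5 i ⟨hi1, by omega⟩
  | succ k hik ih =>
    linarith [ih (by omega) (by omega), h5 k ⟨by omega, by omega⟩,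
      scale_pos h5 h0 (k := k) ⟨by omega, by omega⟩]

lemma scale_lt_one (h5 : ∀ k ∈ Icc 1 p, 5 * α k ≤ α (k + 1)) (h0 : 0 < α 1)
    (h1 : α (p + 1) < 1) (hk : k ∈ Icc 1 (p + 1)) : α k < 1 := by
  rcases hk.2.eq_or_lt with rfl | hlt
  · exact h1
  · linarith [five_mul_scale_le h5 h0 ⟨hk.1, hlt⟩ le_rfl, scale_pos h5 h0 hk]

namespace IsHierarchyConstruction

lemma isTorusCurveC1_hierarchyFamily (h : IsHierarchyConstruction φ p α u gε X) (hφ : IsTest φ)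
    (hk : k ∈ Icc 1 (p + 1)) {ε : ℝ} (hε : ε ∈ Ioo (0 : ℝ) 1) :
    IsTorusCurveC1 (hierarchyFamily φ α u X k ε) :=
  WeakAsymptotic.isTorusCurveC1_hierarchyFamily hφ hε hk.1 (h k hk ε hε).isTorusCurve

lemma isTorusCurveC1_hierarchySource (h : IsHierarchyConstruction φ p α u gε X) (hφ : IsTest φ)
    (hk : k ≤ p + 1) {ε : ℝ} (hε : ε ∈ Ioo (0 : ℝ) 1) :
    IsTorusCurveC1 (hierarchySource (hierarchyFamily φ α u X) k ε) :=
  WeakAsymptotic.isTorusCurveC1_hierarchySource fun _ hi =>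
    h.isTorusCurveC1_hierarchyFamily hφ ⟨hi.1, hi.2.le.trans hk⟩ hε

/- The exponent `2/3 α_k` reproduces itself: the product of `U_i` and `U_j` costs
`(1 + 2/3) (α_i + α_j)`, which is at most `(5/3) (2/5) α_k = 2/3 α_k`. -/
lemma isPowBoundedBV_hierarchySource (h : IsHierarchyConstruction φ p α u gε X) (hφ : IsTest φ)
    (h5 : ∀ k ∈ Icc 1 p, 5 * α k ≤ α (k + 1)) (h0 : 0 < α 1) (hk : k ∈ Icc 1 (p + 1))
    (hX : ∀ i ∈ Ico 1 k, IsPowBounded T (2 / 3 * α i) fun ε t => periodL1 (X i ε t)) :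
    IsPowBoundedBV T (2 / 3 * α k) (hierarchySource (hierarchyFamily φ α u X) k) := by
  have hmem : ∀ i ∈ Ico 1 k, i ∈ Icc 1 (p + 1) := fun i hi => ⟨hi.1, hi.2.le.trans hk.2⟩
  have hscale : ∀ i ∈ Ico 1 k, 5 * α i ≤ α k := fun i hi => five_mul_scale_le h5 h0 hi hk.2
  refine WeakAsymptotic.isPowBoundedBV_hierarchySource (a := fun i => α i + 2 / 3 * α i)
    (fun i hi ε hε => h.isTorusCurveC1_hierarchyFamily hφ (hmem i hi) hε) (fun i hi => ?_)
    (by linarith [scale_pos h5 h0 hk]) fun i hi j hj => by linarith [hscale i hi, hscale j hj]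
  rw [hierarchyFamily_of_pos hi.1]
  exact isPowBoundedBV_mollify hφ (scale_pos h5 h0 (hmem i hi)).le
    (fun ε hε => (h i (hmem i hi) ε hε).isTorusCurve) (hX i hi)

lemma isPowBounded_periodL1 (h : IsHierarchyConstruction φ p α u gε X) (hφ : IsTest φ)
    (hu : IsVelocityFamily β u₀ u) (h5 : ∀ k ∈ Icc 1 p, 5 * α k ≤ α (k + 1)) (h0 : 0 < α 1)
    (hg : ∀ k ∈ Icc 1 (p + 1), IsRegularization (g k) (gε k)) (hk : k ∈ Icc 1 (p + 1)) :
    IsPowBounded T (2 / 3 * α k) fun ε t => periodL1 (X k ε t) := by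
  induction k using Nat.strong_induction_on with
  | _ k ih =>
    exact hu.isPowBounded_periodL1 (hg k hk) (h k hk) (by linarith [scale_pos h5 h0 hk])
      (h.isPowBoundedBV_hierarchySource hφ h5 h0 hk fun i hi =>
        ih i hi.2 ⟨hi.1, hi.2.le.trans hk.2⟩).variation

lemma isPowBounded_periodL1_one (h : IsHierarchyConstruction φ p α u gε X)
    (hu : IsVelocityFamily β u₀ u) (hg : IsRegularization (g 1) (gε 1)) :
    IsPowBounded T 0 fun ε t => periodL1 (X 1 ε t) :=
  hu.isPowBounded_periodL1 hg (h 1 ⟨le_rfl, by omega⟩) le_rfl (by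
    simpa only [hierarchySource_one, deriv_const', periodL1_zero] using .const 0)

lemma exists_isPowBounded_periodL1 (h : IsHierarchyConstruction φ p α u gε X) (hφ : IsTest φ)
    (hu : IsVelocityFamily β u₀ u) (hβ : 0 < β) (hα : β < α 1)
    (h5 : ∀ k ∈ Icc 1 p, 5 * α k ≤ α (k + 1)) (hα1 : α (p + 1) < 1)
    (hg : ∀ k ∈ Icc 1 (p + 1), IsRegularization (g k) (gε k)) (hk : k ∈ Icc 1 (p + 1)) :
    ∃ a, (∀ T, IsPowBounded T a fun ε t => periodL1 (X k ε t)) ∧ a < 1 ∧ a + β < α k := by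
  have h0 : 0 < α 1 := hβ.trans hα
  rcases hk.1.eq_or_lt with rfl | hk1
  · exact ⟨0, fun T => h.isPowBounded_periodL1_one hu (hg 1 hk), one_pos, by rwa [zero_add]⟩
  · have hαk := scale_lt_one h5 h0 hα1 hk
    have hα1k := five_mul_scale_le h5 h0 ⟨le_rfl, hk1⟩ hk.2
    exact ⟨2 / 3 * α k, fun T => h.isPowBounded_periodL1 hφ hu h5 h0 hg hk,
      by linarith [scale_pos h5 h0 hk], by linarith⟩

end IsHierarchyConstruction

theorem isWeakAsymptoticHierarchy (hφ : IsMollifier φ) (hu : IsVelocityFamily β u₀ u)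
    (hβ : 0 < β) (hα : β < α 1) (h5 : ∀ k ∈ Icc 1 p, 5 * α k ≤ α (k + 1)) (hα1 : α (p + 1) < 1)
    (hg0 : g 0 = u₀) (hg : ∀ k ∈ Icc 1 (p + 1), IsRegularization (g k) (gε k))
    (h : IsHierarchyConstruction φ p α u gε X) :
    IsWeakAsymptoticHierarchy p (hierarchyFamily φ α u X) g := by
  intro k hkp
  have hzero : hierarchyFamily φ α u X 0 = u := if_pos rfl
  rcases Nat.eq_zero_or_pos k with rfl | hk1
  · rw [hierarchyFlux_zero, hzero, hg0]
    exact hu.weak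
  have hk : k ∈ Icc 1 (p + 1) := ⟨hk1, hkp⟩
  have h0 : 0 < α 1 := hβ.trans hα
  have hαk : 0 < α k := scale_pos h5 h0 hk
  have hsource : ∀ ε ∈ Ioo (0 : ℝ) 1,
      IsTorusCurveC1 (hierarchySource (hierarchyFamily φ α u X) k ε) := fun ε hε =>
    h.isTorusCurveC1_hierarchySource hφ.1 hkp hε
  have hsourceL1 : ∀ T, IsPowBounded T (2 / 3 * α k) fun ε t =>
      periodL1 (hierarchySource (hierarchyFamily φ α u X) k ε t) := fun T =>
    (h.isPowBoundedBV_hierarchySource hφ.1 h5 h0 hk fun i hi => h.isPowBounded_periodL1 hφ.1 hu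
      h5 h0 hg ⟨hi.1, hi.2.le.trans hkp⟩).isPowBounded_periodL1 fun ε hε => (hsource ε hε).curve
  obtain ⟨a, ha, ha1, haβ⟩ := h.exists_isPowBounded_periodL1 hφ.1 hu hβ hα h5 hα1 hg hk
  have hflux : hierarchyFlux (hierarchyFamily φ α u X) k = fun ε t x =>
      2 * (u ε t x * smoothed φ (α k) (X k) ε t x) +
        hierarchySource (hierarchyFamily φ α u X) k ε t x := by
    funext ε t x
    rw [hierarchyFlux_eq_add_hierarchySource hk1, hzero, hierarchyFamily_of_pos hk1]
  rw [hflux, hierarchyFamily_of_pos hk1]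
  exact isWeakAsymptotic_smoothed hφ hu (hg k hk) (h k hk)
    (fun ε hε t ht => (hsource ε hε).differentiable t ht)
    (fun ε hε t ht => (hsource ε hε).curve.periodic ht) ha hsourceL1 hαk ha1 haβ (by linarith)

end Hierarchy

/-- Continuous functions of at most exponential growth: the initial data for which the heat
equation is solved. -/
structure HasExpGrowth (F : ℝ → ℝ) : Prop where
  continuous : Continuous F
  exists_bound : ∃ C K : ℝ, 0 ≤ C ∧ 0 ≤ K ∧ ∀ x, |F x| ≤ C * Real.exp (K * |x|)

/-- The Gaussian average of `F` around `x` at scale `σ`, without the factor `π^{-1/2}`. -/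
def gaussAvg (F : ℝ → ℝ) (σ x : ℝ) : ℝ :=
  ∫ y, F (x + σ * y) * Real.exp (-y ^ 2)

/-- The solution at time `t` of `∂ₜh = ν ∂ₓₓh` with initial datum `F`, up to the constant factor
`√π`. -/
def heatFlow (ν : ℝ) (F : ℝ → ℝ) (t : ℝ) : ℝ → ℝ :=
  gaussAvg F (2 * √(ν * t))

section GaussAvg

variable {F F' F'' G : ℝ → ℝ}

lemma HasExpGrowth.bdd_mul (hF : HasExpGrowth F) (hG : Continuous G) {B : ℝ}
    (hB : ∀ x, |G x| ≤ B) : HasExpGrowth fun x => G x * F x := by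
  obtain ⟨C, K, hC, hK, hb⟩ := hF.exists_bound
  have hB0 : 0 ≤ B := (abs_nonneg _).trans (hB 0)
  refine ⟨hG.mul hF.continuous, B * C, K, by positivity, hK, fun x => ?_⟩
  rw [abs_mul, mul_assoc]
  exact mul_le_mul (hB x) (hb x) (abs_nonneg _) hB0

lemma HasExpGrowth.exists_gaussian_bound (hF : HasExpGrowth F) (R : ℝ) :
    ∃ D : ℝ, ∀ σ x y : ℝ, |σ| ≤ R → |x| ≤ R →
      |F (x + σ * y)| * (1 + |y|) * Real.exp (-y ^ 2) ≤ D * Real.exp (-(1 / 2) * y ^ 2) := by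
  obtain ⟨C, K, hC, hK, hb⟩ := hF.exists_bound
  refine ⟨C * Real.exp (K * R + (K * R + 1) ^ 2 / 2), fun σ x y hσ hx => ?_⟩
  have hshift : |x + σ * y| ≤ R + R * |y| := by
    refine (abs_add_le _ _).trans (add_le_add hx ?_)
    rw [abs_mul]
    exact mul_le_mul_of_nonneg_right hσ (abs_nonneg y)
  have hlin : 1 + |y| ≤ Real.exp |y| := by
    rw [add_comm]
    exact Real.add_one_le_exp _
  calc |F (x + σ * y)| * (1 + |y|) * Real.exp (-y ^ 2)
      ≤ C * Real.exp (K * (R + R * |y|)) * Real.exp |y| * Real.exp (-y ^ 2) := by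
        gcongr
        exact (hb _).trans (by gcongr)
    _ = C * Real.exp (K * (R + R * |y|) + |y| + -y ^ 2) := by
        rw [Real.exp_add, Real.exp_add]
        ring
    _ ≤ C * Real.exp (K * R + (K * R + 1) ^ 2 / 2 + -(1 / 2) * y ^ 2) := by
        refine mul_le_mul_of_nonneg_left (Real.exp_le_exp.2 ?_) hC
        nlinarith [sq_nonneg (K * R + 1 - |y|), sq_abs y]
    _ = C * Real.exp (K * R + (K * R + 1) ^ 2 / 2) * Real.exp (-(1 / 2) * y ^ 2) := by
        rw [Real.exp_add]
        ring

lemma HasExpGrowth.exists_dominating (hF : HasExpGrowth F) (R : ℝ) :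
    ∃ B : ℝ → ℝ, Integrable B ∧ ∀ σ x y : ℝ, |σ| ≤ R → |x| ≤ R →
      |F (x + σ * y) * Real.exp (-y ^ 2)| ≤ B y ∧
      |F (x + σ * y) * y * Real.exp (-y ^ 2)| ≤ B y := by
  obtain ⟨D, hD⟩ := hF.exists_gaussian_bound R
  refine ⟨fun y => D * Real.exp (-(1 / 2) * y ^ 2),
    (integrable_exp_neg_mul_sq (by norm_num)).const_mul D, fun σ x y hσ hx => ⟨?_, ?_⟩⟩
  · refine le_trans ?_ (hD σ x y hσ hx)
    rw [abs_mul, abs_of_pos (Real.exp_pos _)]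
    gcongr
    exact le_mul_of_one_le_right (abs_nonneg _) (by linarith [abs_nonneg y])
  · refine le_trans ?_ (hD σ x y hσ hx)
    rw [abs_mul, abs_mul, abs_of_pos (Real.exp_pos _)]
    gcongr
    linarith

lemma HasExpGrowth.integrable_mul_exp_neg_sq (hF : HasExpGrowth F) (σ x : ℝ) :
    Integrable fun y => F (x + σ * y) * Real.exp (-y ^ 2) := by
  obtain ⟨B, hB, hb⟩ := hF.exists_dominating (max |σ| |x|)
  have := hF.continuous
  exact hB.mono' (by fun_prop)
    (Eventually.of_forall fun y => (hb σ x y (le_max_left _ _) (le_max_right _ _)).1)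

lemma HasExpGrowth.integrable_mul_mul_exp_neg_sq (hF : HasExpGrowth F) (σ x : ℝ) :
    Integrable fun y => F (x + σ * y) * y * Real.exp (-y ^ 2) := by
  obtain ⟨B, hB, hb⟩ := hF.exists_dominating (max |σ| |x|)
  have := hF.continuous
  exact hB.mono' (by fun_prop)
    (Eventually.of_forall fun y => (hb σ x y (le_max_left _ _) (le_max_right _ _)).2)

lemma continuous_gaussAvg (hF : HasExpGrowth F) :
    Continuous fun q : ℝ × ℝ => gaussAvg F q.1 q.2 := by
  refine continuous_iff_continuousAt.2 fun q₀ => ?_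
  obtain ⟨B, hB, hb⟩ := hF.exists_dominating (max |q₀.1| |q₀.2| + 1)
  have := hF.continuous
  have hfst : ∀ᶠ q : ℝ × ℝ in 𝓝 q₀, |q.1| < max |q₀.1| |q₀.2| + 1 :=
    (Continuous.tendsto (by fun_prop) q₀).eventually_lt_const
      ((le_max_left _ _).trans_lt (lt_add_one _))
  have hsnd : ∀ᶠ q : ℝ × ℝ in 𝓝 q₀, |q.2| < max |q₀.1| |q₀.2| + 1 :=
    (Continuous.tendsto (by fun_prop) q₀).eventually_lt_const
      ((le_max_right _ _).trans_lt (lt_add_one _))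
  refine continuousAt_of_dominated (Eventually.of_forall fun q => by fun_prop) ?_ hB
    (Eventually.of_forall fun y => by fun_prop)
  filter_upwards [hfst, hsnd] with q hq₁ hq₂
  exact Eventually.of_forall fun y => (hb q.1 q.2 y hq₁.le hq₂.le).1

lemma abs_le_of_mem_ball_one {x y : ℝ} (h : y ∈ Metric.ball x 1) : |y| ≤ |x| + 1 := by
  rw [Metric.mem_ball, Real.dist_eq] at h
  linarith [abs_sub_abs_le_abs_sub y x]

lemma hasDerivAt_gaussAvg (hF : HasExpGrowth F) (hF' : HasExpGrowth F')
    (hd : ∀ x, HasDerivAt F (F' x) x) (σ x : ℝ) :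
    HasDerivAt (gaussAvg F σ) (gaussAvg F' σ x) x := by
  obtain ⟨B, hB, hb⟩ := hF'.exists_dominating (max |σ| (|x| + 1))
  have := hF.continuous
  have := hF'.continuous
  exact (hasDerivAt_integral_of_dominated_loc_of_deriv_le (bound := B)
    (F' := fun x y => F' (x + σ * y) * Real.exp (-y ^ 2))
    (Metric.ball_mem_nhds x one_pos) (Eventually.of_forall fun z => by fun_prop)
    (hF.integrable_mul_exp_neg_sq σ x) (by fun_prop)
    (Eventually.of_forall fun y z hz => (hb σ z y (le_max_left _ _)
      ((abs_le_of_mem_ball_one hz).trans (le_max_right _ _))).1) hB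
    (Eventually.of_forall fun y z _ =>
      ((hd (z + σ * y)).comp_add_const z (σ * y)).mul_const _)).2

lemma hasDerivAt_gaussAvg_scale (hF : HasExpGrowth F) (hF' : HasExpGrowth F')
    (hd : ∀ x, HasDerivAt F (F' x) x) (σ x : ℝ) :
    HasDerivAt (fun σ => gaussAvg F σ x) (∫ y, F' (x + σ * y) * y * Real.exp (-y ^ 2)) σ := by
  obtain ⟨B, hB, hb⟩ := hF'.exists_dominating (max (|σ| + 1) |x|)
  have := hF.continuous
  have := hF'.continuous
  have hlin : ∀ τ y : ℝ, HasDerivAt (fun τ => x + τ * y) y τ := fun τ y => by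
    simpa using ((hasDerivAt_id τ).mul_const y).const_add x
  exact (hasDerivAt_integral_of_dominated_loc_of_deriv_le (bound := B)
    (F' := fun τ y => F' (x + τ * y) * y * Real.exp (-y ^ 2))
    (Metric.ball_mem_nhds σ one_pos) (Eventually.of_forall fun z => by fun_prop)
    (hF.integrable_mul_exp_neg_sq σ x) (by fun_prop)
    (Eventually.of_forall fun y τ hτ => (hb τ x y
      ((abs_le_of_mem_ball_one hτ).trans (le_max_left _ _)) (le_max_right _ _)).2) hB
    (Eventually.of_forall fun y τ _ =>
      ((hd (x + τ * y)).comp τ (hlin τ y)).mul_const _)).2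

lemma integral_mul_mul_exp_neg_sq (hF : HasExpGrowth F) (hF' : HasExpGrowth F')
    (hd : ∀ x, HasDerivAt F (F' x) x) (σ x : ℝ) :
    ∫ y, F (x + σ * y) * y * Real.exp (-y ^ 2) = σ / 2 * gaussAvg F' σ x := by
  have hint := hF.integrable_mul_mul_exp_neg_sq σ x
  have hint' := (hF'.integrable_mul_exp_neg_sq σ x).const_mul (σ / 2)
  have hparts : ∫ y, (F (x + σ * y) * y * Real.exp (-y ^ 2) -
      σ / 2 * (F' (x + σ * y) * Real.exp (-y ^ 2))) = 0 := by
    refine integral_eq_zero_of_hasDerivAt_of_integrable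
      (f := fun y => -(1 / 2) * (F (x + σ * y) * Real.exp (-y ^ 2))) (fun y => ?_)
      (hint.sub hint') ((hF.integrable_mul_exp_neg_sq σ x).const_mul _)
    have hlin : HasDerivAt (fun y => x + σ * y) σ y := by
      simpa using ((hasDerivAt_id y).const_mul σ).const_add x
    have hgauss : HasDerivAt (fun y : ℝ => Real.exp (-y ^ 2))
        (Real.exp (-y ^ 2) * (-(2 * y))) y := by
      simpa using (hasDerivAt_pow 2 y).neg.exp
    refine ((((hd (x + σ * y)).comp y hlin).mul hgauss).const_mul (-(1 / 2))).congr_deriv ?_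
    simp only [Function.comp]
    ring
  rwa [integral_sub hint hint', integral_const_mul, sub_eq_zero] at hparts

lemma gaussAvg_pos (hF : HasExpGrowth F) (hp : ∀ x, 0 < F x) (σ x : ℝ) :
    0 < gaussAvg F σ x := by
  refine (integral_pos_iff_support_of_nonneg
    (fun y => (mul_pos (hp _) (Real.exp_pos _)).le) (hF.integrable_mul_exp_neg_sq σ x)).2 ?_
  have hsupp : (Function.support fun y => F (x + σ * y) * Real.exp (-y ^ 2)) = univ :=
    eq_univ_of_forall fun y => (mul_pos (hp _) (Real.exp_pos _)).ne'
  rw [hsupp]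
  simp

lemma abs_gaussAvg_le (hF : HasExpGrowth F) {B : ℝ} (hB : ∀ x, |G x| ≤ B * F x) (σ x : ℝ) :
    |gaussAvg G σ x| ≤ B * gaussAvg F σ x := by
  unfold gaussAvg
  rw [← integral_const_mul, ← Real.norm_eq_abs]
  refine norm_integral_le_of_norm_le ((hF.integrable_mul_exp_neg_sq σ x).const_mul B)
    (Eventually.of_forall fun y => ?_)
  rw [Real.norm_eq_abs, abs_mul, abs_of_pos (Real.exp_pos _), ← mul_assoc]
  exact mul_le_mul_of_nonneg_right (hB _) (Real.exp_pos _).le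

lemma gaussAvg_const_mul (c : ℝ) (F : ℝ → ℝ) (σ x : ℝ) :
    gaussAvg (fun z => c * F z) σ x = c * gaussAvg F σ x := by
  simp only [gaussAvg, mul_assoc, integral_const_mul]

lemma gaussAvg_add_right {c l : ℝ} (h : ∀ x, F (x + c) = l * F x) (σ x : ℝ) :
    gaussAvg F σ (x + c) = l * gaussAvg F σ x := by
  rw [← gaussAvg_const_mul]
  refine integral_congr_ae (Eventually.of_forall fun y => ?_)
  simp only [add_right_comm x c, h]

end GaussAvg

section HeatFlow

variable {F F' F'' : ℝ → ℝ} {ν : ℝ}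

lemma heatFlow_zero (ν : ℝ) (F : ℝ → ℝ) (x : ℝ) :
    heatFlow ν F 0 x = F x * ∫ y, Real.exp (-y ^ 2) := by
  simp [heatFlow, gaussAvg, integral_const_mul]

lemma continuous_heatFlow (ν : ℝ) (hF : HasExpGrowth F) :
    Continuous fun q : ℝ × ℝ => heatFlow ν F q.1 q.2 :=
  (continuous_gaussAvg hF).comp (f := fun q : ℝ × ℝ => (2 * √(ν * q.1), q.2)) (by fun_prop)

lemma hasDerivAt_heatFlow_time (hF : HasExpGrowth F) (hF' : HasExpGrowth F')
    (hd : ∀ x, HasDerivAt F (F' x) x) (hF'' : HasExpGrowth F'')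
    (hd' : ∀ x, HasDerivAt F' (F'' x) x) (hν : 0 < ν) (x : ℝ) {t : ℝ} (ht : 0 < t) :
    HasDerivAt (fun s => heatFlow ν F s x) (ν * heatFlow ν F'' t x) t := by
  have hνt : 0 < ν * t := by positivity
  have hscale : HasDerivAt (fun s => 2 * √(ν * s)) (2 * (ν / (2 * √(ν * t)))) t := by
    simpa using (((hasDerivAt_id t).const_mul ν).sqrt hνt.ne').const_mul 2
  refine ((hasDerivAt_gaussAvg_scale hF hF' hd _ x).comp t hscale).congr_deriv ?_
  rw [integral_mul_mul_exp_neg_sq hF' hF'' hd']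
  have := Real.sqrt_pos.2 hνt
  unfold heatFlow
  field_simp

lemma hasDerivWithinAt_heatFlow_time (hF : HasExpGrowth F) (hF' : HasExpGrowth F')
    (hd : ∀ x, HasDerivAt F (F' x) x) (hF'' : HasExpGrowth F'')
    (hd' : ∀ x, HasDerivAt F' (F'' x) x) (hν : 0 < ν) (x : ℝ) {t : ℝ} (ht : 0 ≤ t) :
    HasDerivWithinAt (fun s => heatFlow ν F s x) (ν * heatFlow ν F'' t x) (Ici 0) t := by
  have hpos := fun s (hs : 0 < s) => hasDerivAt_heatFlow_time hF hF' hd hF'' hd' hν x hs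
  rcases ht.eq_or_lt with rfl | ht
  · have hcont : ∀ {G : ℝ → ℝ}, HasExpGrowth G → Continuous fun s => heatFlow ν G s x :=
      fun hG => (continuous_heatFlow ν hG).comp (Continuous.prodMk_left x)
    refine hasDerivWithinAt_Ici_of_tendsto_deriv (s := Ioi 0)
      (fun s hs => (hpos s hs).differentiableAt.differentiableWithinAt)
      (hcont hF).continuousWithinAt self_mem_nhdsWithin ?_
    refine Tendsto.congr' ?_
      (((continuous_const.mul (hcont hF'')).tendsto 0).mono_left nhdsWithin_le_nhds)
    filter_upwards [self_mem_nhdsWithin] with s hs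
    exact (hpos s hs).deriv.symm
  · exact (hpos t ht).hasDerivWithinAt

end HeatFlow

/-- The functions `b_k` with `∂ₓᵏ exp(-A/ν) = b_k exp(-A/ν)`, where `A' = a`. -/
def coleHopfFactor (ν : ℝ) (a : ℝ → ℝ) : ℕ → ℝ → ℝ
  | 0 => 1
  | k + 1 => fun x => deriv (coleHopfFactor ν a k) x - a x / ν * coleHopfFactor ν a k x

/-- The `k`-th derivative of the Cole–Hopf transform `exp(-A/ν)` of `a`, where `A' = a`. -/
def coleHopfDatum (ν : ℝ) (a : ℝ → ℝ) (k : ℕ) (x : ℝ) : ℝ :=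
  coleHopfFactor ν a k x * Real.exp (-(∫ y in (0 : ℝ)..x, a y) / ν)

/-- The `k`-th `x`-derivative of the solution of the heat equation that starts from the Cole–Hopf
transform of `a`. -/
def coleHopfHeat (ν : ℝ) (a : ℝ → ℝ) (k : ℕ) : ℝ → ℝ → ℝ :=
  heatFlow ν (coleHopfDatum ν a k)

/-- The Cole–Hopf solution `-ν ∂ₓ log h` of the viscous equation with datum `a`, where `h` solves
the heat equation. -/
def coleHopf (ν : ℝ) (a : ℝ → ℝ) (t x : ℝ) : ℝ :=
  -ν * coleHopfHeat ν a 1 t x / coleHopfHeat ν a 0 t x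

section ColeHopf

variable {a : ℝ → ℝ} {ν : ℝ}

lemma periodic_deriv {f : ℝ → ℝ} {c : ℝ} (hf : Function.Periodic f c) :
    Function.Periodic (deriv f) c := fun x => by
  rw [← deriv_comp_add_const, funext hf]

lemma contDiff_coleHopfFactor (ν : ℝ) (ha : ContDiff ℝ ∞ a) :
    ∀ k, ContDiff ℝ ∞ (coleHopfFactor ν a k)
  | 0 => contDiff_const
  | k + 1 => by
    have ih := contDiff_coleHopfFactor ν ha k
    exact ih.deriv'.sub ((ha.div_const ν).mul ih)

lemma periodic_coleHopfFactor (ν : ℝ) {c : ℝ} (hp : Function.Periodic a c) :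
    ∀ k, Function.Periodic (coleHopfFactor ν a k) c
  | 0 => fun _ => rfl
  | k + 1 => fun x => by
    have ih := periodic_coleHopfFactor ν hp k
    simp only [coleHopfFactor, periodic_deriv ih x, hp x, ih x]

lemma coleHopfFactor_one (ν : ℝ) (a : ℝ → ℝ) : coleHopfFactor ν a 1 = fun x => -(a x / ν) := by
  funext x
  simp [coleHopfFactor]

lemma coleHopfFactor_two (ν : ℝ) (a : ℝ → ℝ) (x : ℝ) :
    coleHopfFactor ν a 2 x = a x ^ 2 / ν ^ 2 - deriv a x / ν := by
  rw [coleHopfFactor, coleHopfFactor_one]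
  simp only [deriv.fun_neg, deriv_div_const]
  ring

lemma hasDerivAt_coleHopfDatum (ν : ℝ) (ha : ContDiff ℝ ∞ a) (k : ℕ) (x : ℝ) :
    HasDerivAt (coleHopfDatum ν a k) (coleHopfDatum ν a (k + 1) x) x := by
  have hfactor : HasDerivAt (coleHopfFactor ν a k) (deriv (coleHopfFactor ν a k) x) x :=
    ((contDiff_coleHopfFactor ν ha k).differentiable (by simp) x).hasDerivAt
  have hexp := ((ha.continuous.integral_hasStrictDerivAt 0 x).hasDerivAt.fun_neg.div_const ν).exp
  refine (hfactor.mul hexp).congr_deriv ?_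
  simp only [coleHopfDatum, coleHopfFactor]
  ring

lemma hasExpGrowth_exp_neg_primitive (ha : Continuous a) (hp : Function.Periodic a (2 * Real.pi))
    (hν : 0 < ν) : HasExpGrowth fun x => Real.exp (-(∫ y in (0 : ℝ)..x, a y) / ν) := by
  obtain ⟨M, hM0, hM⟩ := exists_abs_le_of_periodic ha hp
  refine ⟨?_, 1, M / ν, zero_le_one, by positivity, fun x => ?_⟩
  · have := intervalIntegral.continuous_primitive (μ := volume)
      (fun b c => ha.intervalIntegrable b c) 0
    fun_prop
  · have hprim : |∫ y in (0 : ℝ)..x, a y| ≤ M * |x| := by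
      simpa using intervalIntegral.norm_integral_le_of_norm_le_const (f := a) (a := 0) (b := x)
        fun y _ => hM y
    rw [abs_of_pos (Real.exp_pos _), one_mul, Real.exp_le_exp, div_mul_eq_mul_div]
    exact div_le_div_of_nonneg_right ((neg_le_abs _).trans hprim) hν.le

lemma hasExpGrowth_coleHopfDatum (ha : ContDiff ℝ ∞ a) (hp : Function.Periodic a (2 * Real.pi))
    (hν : 0 < ν) (k : ℕ) : HasExpGrowth (coleHopfDatum ν a k) := by
  have hfactor := (contDiff_coleHopfFactor ν ha k).continuous
  obtain ⟨B, -, hB⟩ := exists_abs_le_of_periodic hfactor (periodic_coleHopfFactor ν hp k)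
  exact (hasExpGrowth_exp_neg_primitive ha.continuous hp hν).bdd_mul hfactor hB

lemma coleHopfDatum_add_period (ν : ℝ) (ha : Continuous a) {c : ℝ} (hp : Function.Periodic a c)
    (k : ℕ) (x : ℝ) : coleHopfDatum ν a k (x + c) =
      Real.exp (-(∫ y in (0 : ℝ)..c, a y) / ν) * coleHopfDatum ν a k x := by
  have hint : ∫ y in (0 : ℝ)..x + c, a y = (∫ y in (0 : ℝ)..x, a y) + ∫ y in (0 : ℝ)..c, a y := by
    simpa using hp.intervalIntegral_add_eq_add 0 x fun b d => ha.intervalIntegrable b d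
  simp only [coleHopfDatum, periodic_coleHopfFactor ν hp k x, hint]
  rw [neg_add, add_div, Real.exp_add]
  ring

lemma coleHopfDatum_zero_pos (ν : ℝ) (a : ℝ → ℝ) (x : ℝ) : 0 < coleHopfDatum ν a 0 x := by
  simpa [coleHopfDatum, coleHopfFactor] using Real.exp_pos _

lemma coleHopfDatum_eq_factor_mul (ν : ℝ) (a : ℝ → ℝ) (k : ℕ) (x : ℝ) :
    coleHopfDatum ν a k x = coleHopfFactor ν a k x * coleHopfDatum ν a 0 x := by
  simp [coleHopfDatum, coleHopfFactor]

lemma coleHopfHeat_zero_pos (ha : ContDiff ℝ ∞ a) (hp : Function.Periodic a (2 * Real.pi))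
    (hν : 0 < ν) (t x : ℝ) : 0 < coleHopfHeat ν a 0 t x :=
  gaussAvg_pos (hasExpGrowth_coleHopfDatum ha hp hν 0) (coleHopfDatum_zero_pos ν a) _ x

lemma abs_coleHopfHeat_le (ha : ContDiff ℝ ∞ a) (hp : Function.Periodic a (2 * Real.pi))
    (hν : 0 < ν) {k : ℕ} {B : ℝ} (hB : ∀ x, |coleHopfFactor ν a k x| ≤ B) (t x : ℝ) :
    |coleHopfHeat ν a k t x| ≤ B * coleHopfHeat ν a 0 t x := by
  refine abs_gaussAvg_le (hasExpGrowth_coleHopfDatum ha hp hν 0) (fun z => ?_) _ x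
  rw [coleHopfDatum_eq_factor_mul, abs_mul, abs_of_pos (coleHopfDatum_zero_pos ν a z)]
  exact mul_le_mul_of_nonneg_right (hB z) (coleHopfDatum_zero_pos ν a z).le

lemma hasDerivAt_coleHopfHeat (ha : ContDiff ℝ ∞ a) (hp : Function.Periodic a (2 * Real.pi))
    (hν : 0 < ν) (k : ℕ) (t x : ℝ) :
    HasDerivAt (coleHopfHeat ν a k t) (coleHopfHeat ν a (k + 1) t x) x :=
  hasDerivAt_gaussAvg (hasExpGrowth_coleHopfDatum ha hp hν k)
    (hasExpGrowth_coleHopfDatum ha hp hν (k + 1)) (hasDerivAt_coleHopfDatum ν ha k) _ x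

lemma hasDerivWithinAt_coleHopfHeat_time (ha : ContDiff ℝ ∞ a)
    (hp : Function.Periodic a (2 * Real.pi)) (hν : 0 < ν) (k : ℕ) {t : ℝ} (ht : 0 ≤ t) (x : ℝ) :
    HasDerivWithinAt (fun s => coleHopfHeat ν a k s x) (ν * coleHopfHeat ν a (k + 2) t x)
      (Ici 0) t :=
  have hgrowth := hasExpGrowth_coleHopfDatum ha hp hν
  have hderiv := hasDerivAt_coleHopfDatum ν ha
  hasDerivWithinAt_heatFlow_time (hgrowth k) (hgrowth (k + 1)) (hderiv k) (hgrowth (k + 2))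
    (hderiv (k + 1)) hν x ht

lemma contDiff_coleHopfHeat (ha : ContDiff ℝ ∞ a) (hp : Function.Periodic a (2 * Real.pi))
    (hν : 0 < ν) (t : ℝ) (n k : ℕ) : ContDiff ℝ n (coleHopfHeat ν a k t) := by
  have hdiff : ∀ k, Differentiable ℝ (coleHopfHeat ν a k t) := fun k x =>
    (hasDerivAt_coleHopfHeat ha hp hν k t x).differentiableAt
  induction n generalizing k with
  | zero => exact contDiff_zero.2 (hdiff k).continuous
  | succ n ih =>
    have hderiv : deriv (coleHopfHeat ν a k t) = coleHopfHeat ν a (k + 1) t :=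
      funext fun x => (hasDerivAt_coleHopfHeat ha hp hν k t x).deriv
    rw [Nat.cast_add_one, contDiff_succ_iff_deriv, hderiv]
    exact ⟨hdiff k, by simp, ih (k + 1)⟩

lemma contDiff_coleHopf (ha : ContDiff ℝ ∞ a) (hp : Function.Periodic a (2 * Real.pi))
    (hν : 0 < ν) (t : ℝ) (n : ℕ) : ContDiff ℝ n (coleHopf ν a t) :=
  (contDiff_const.mul (contDiff_coleHopfHeat ha hp hν t n 1)).div
    (contDiff_coleHopfHeat ha hp hν t n 0) fun x => (coleHopfHeat_zero_pos ha hp hν t x).ne'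

lemma hasDerivAt_coleHopf (ha : ContDiff ℝ ∞ a) (hp : Function.Periodic a (2 * Real.pi))
    (hν : 0 < ν) (t x : ℝ) :
    HasDerivAt (coleHopf ν a t)
      (coleHopf ν a t x ^ 2 / ν - ν * coleHopfHeat ν a 2 t x / coleHopfHeat ν a 0 t x) x := by
  have hne := (coleHopfHeat_zero_pos ha hp hν t x).ne'
  refine (((hasDerivAt_coleHopfHeat ha hp hν 1 t x).const_mul (-ν)).div
    (hasDerivAt_coleHopfHeat ha hp hν 0 t x) hne).congr_deriv ?_
  simp only [coleHopf, zero_add, Nat.reduceAdd]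
  field_simp
  ring

lemma hasDerivAt_deriv_coleHopf (ha : ContDiff ℝ ∞ a) (hp : Function.Periodic a (2 * Real.pi))
    (hν : 0 < ν) (t x : ℝ) :
    HasDerivAt (deriv (coleHopf ν a t))
      (2 * coleHopf ν a t x * deriv (coleHopf ν a t) x / ν -
        ν * (coleHopfHeat ν a 3 t x * coleHopfHeat ν a 0 t x -
          coleHopfHeat ν a 2 t x * coleHopfHeat ν a 1 t x) / coleHopfHeat ν a 0 t x ^ 2) x := by
  have hne := (coleHopfHeat_zero_pos ha hp hν t x).ne'
  have hu := hasDerivAt_coleHopf ha hp hν t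
  have hquot := ((hasDerivAt_coleHopfHeat ha hp hν 2 t x).const_mul ν).fun_div
    (hasDerivAt_coleHopfHeat ha hp hν 0 t x) hne
  rw [funext fun x => (hu x).deriv]
  refine ((((hu x).fun_pow 2).div_const ν).sub hquot).congr_deriv ?_
  simp only [zero_add, Nat.reduceAdd]
  ring

theorem isViscousSolution_coleHopf (ha : ContDiff ℝ ∞ a)
    (hp : Function.Periodic a (2 * Real.pi)) (hν : 0 < ν) :
    IsViscousSolution ν (coleHopf ν a) := by
  refine fun t ht => ⟨contDiff_coleHopf ha hp hν t 2, fun x => ?_⟩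
  have hne := (coleHopfHeat_zero_pos ha hp hν t x).ne'
  have hsq := ((contDiff_coleHopf ha hp hν t 1).differentiable (by simp) x).hasDerivAt.fun_pow 2
  rw [iteratedDeriv_succ, iteratedDeriv_one, (hasDerivAt_deriv_coleHopf ha hp hν t x).deriv,
    hsq.deriv]
  refine (((hasDerivWithinAt_coleHopfHeat_time ha hp hν 1 ht x).const_mul (-ν)).div
    (hasDerivWithinAt_coleHopfHeat_time ha hp hν 0 ht x) hne).congr_deriv ?_
  simp only [zero_add, Nat.reduceAdd]
  field_simp
  ring

lemma coleHopf_zero (hν : ν ≠ 0) : coleHopf ν a 0 = a := by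
  funext x
  have hdatum := (coleHopfDatum_zero_pos ν a x).ne'
  have hgauss : ∫ y : ℝ, Real.exp (-y ^ 2) ≠ 0 := by
    have := integral_gaussian 1
    simp only [neg_one_mul, div_one] at this
    rw [this]
    positivity
  simp only [coleHopf, coleHopfHeat, heatFlow_zero, coleHopfDatum_eq_factor_mul ν a 1,
    coleHopfFactor_one]
  field_simp

lemma continuous_coleHopf (ha : ContDiff ℝ ∞ a) (hp : Function.Periodic a (2 * Real.pi))
    (hν : 0 < ν) : Continuous fun q : ℝ × ℝ => coleHopf ν a q.1 q.2 :=
  have hheat := fun k => continuous_heatFlow ν (hasExpGrowth_coleHopfDatum ha hp hν k)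
  (continuous_const.mul (hheat 1)).div (hheat 0) fun q =>
    (coleHopfHeat_zero_pos ha hp hν q.1 q.2).ne'

lemma periodic_coleHopf (ν : ℝ) (ha : Continuous a) {c : ℝ} (hp : Function.Periodic a c)
    (t : ℝ) : Function.Periodic (coleHopf ν a t) c := fun x => by
  have hheat := fun k => gaussAvg_add_right (coleHopfDatum_add_period ν ha hp k) (2 * √(ν * t)) x
  simp only [coleHopf, coleHopfHeat, heatFlow, hheat]
  rw [mul_left_comm, mul_div_mul_left _ _ (Real.exp_pos _).ne']

lemma abs_coleHopf_le (ha : ContDiff ℝ ∞ a) (hp : Function.Periodic a (2 * Real.pi))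
    (hν : 0 < ν) {M : ℝ} (hM : ∀ x, |a x| ≤ M) (t x : ℝ) : |coleHopf ν a t x| ≤ M := by
  have hpos := coleHopfHeat_zero_pos ha hp hν t x
  have hheat := abs_coleHopfHeat_le ha hp hν (k := 1) (B := M / ν) (fun z => by
    rw [coleHopfFactor_one, abs_neg, abs_div, abs_of_pos hν]
    exact div_le_div_of_nonneg_right (hM z) hν.le) t x
  rw [coleHopf, abs_div, abs_mul, abs_neg, abs_of_pos hν, abs_of_pos hpos, div_le_iff₀ hpos]
  refine (mul_le_mul_of_nonneg_left hheat hν.le).trans_eq ?_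
  field_simp

lemma abs_deriv_coleHopf_le (ha : ContDiff ℝ ∞ a) (hp : Function.Periodic a (2 * Real.pi))
    (hν : 0 < ν) {M M₁ : ℝ} (hM : ∀ x, |a x| ≤ M) (hM₁ : ∀ x, |deriv a x| ≤ M₁) (t x : ℝ) :
    |deriv (coleHopf ν a t) x| ≤ M₁ + 2 * M ^ 2 / ν := by
  have hpos := coleHopfHeat_zero_pos ha hp hν t x
  have hheat := abs_coleHopfHeat_le ha hp hν (k := 2) (B := M ^ 2 / ν ^ 2 + M₁ / ν) (fun z => by
    rw [coleHopfFactor_two]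
    refine (abs_sub _ _).trans ?_
    rw [abs_div, abs_div, abs_of_pos hν, abs_of_pos (by positivity : 0 < ν ^ 2), abs_pow]
    gcongr
    exacts [hM z, hM₁ z]) t x
  have hsq : |coleHopf ν a t x ^ 2 / ν| ≤ M ^ 2 / ν := by
    rw [abs_div, abs_of_pos hν, abs_pow]
    gcongr
    exact abs_coleHopf_le ha hp hν hM t x
  have hquot : |ν * coleHopfHeat ν a 2 t x / coleHopfHeat ν a 0 t x| ≤ M ^ 2 / ν + M₁ := by
    rw [abs_div, abs_mul, abs_of_pos hν, abs_of_pos hpos, div_le_iff₀ hpos]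
    refine (mul_le_mul_of_nonneg_left hheat hν.le).trans_eq ?_
    field_simp
  rw [(hasDerivAt_coleHopf ha hp hν t x).deriv]
  refine (abs_sub _ _).trans ((add_le_add hsq hquot).trans_eq ?_)
  ring

end ColeHopf

section Viscous

variable {U : ℝ → ℝ → ℝ → ℝ} {ψ : ℝ → ℝ}

lemma IsViscousSolution.derivWithin_eq {ν : ℝ} {u : ℝ → ℝ → ℝ} (hu : IsViscousSolution ν u)
    {t : ℝ} (ht : 0 ≤ t) (x : ℝ) : derivWithin (fun s => u s x) (Ici 0) t =
      ν * deriv (deriv (u t)) x - deriv (fun y => u t y ^ 2) x := by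
  rw [((hu t ht).2 x).derivWithin (uniqueDiffOn_Ici 0 t ht), iteratedDeriv_succ,
    iteratedDeriv_one]

lemma weakResidual_viscous {ν ε t : ℝ} (hψ : IsTest ψ) (ht : 0 ≤ t)
    (hU : IsViscousSolution ν (U ε)) :
    weakResidual U (fun ε t x => U ε t x ^ 2) ψ ε t =
      ν * ∫ x, U ε t x * deriv (deriv ψ) x := by
  have hu : ContDiff ℝ 2 (U ε t) := (hU t ht).1
  have hu' : ContDiff ℝ 1 (deriv (U ε t)) := hu.deriv'
  have hu'' : Continuous (deriv (deriv (U ε t))) := hu'.continuous_deriv le_rfl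
  have hsq' : Continuous (deriv fun y => U ε t y ^ 2) :=
    (hu.pow 2).continuous_deriv (by norm_num)
  have hvisc : ∫ x, deriv (deriv (U ε t)) x * ψ x = ∫ x, U ε t x * deriv (deriv ψ) x := by
    rw [integral_deriv_mul_test (hu'.differentiable (by norm_num)) hu'' hψ,
      integral_deriv_mul_test (hu.differentiable (by norm_num)) hu'.continuous hψ.deriv, neg_neg]
  have hflux := integral_deriv_mul_test ((hu.pow 2).differentiable (by norm_num)) hsq' hψ
  have hint := integrable_mul_test hsq' hψ
  calc weakResidual U (fun ε t x => U ε t x ^ 2) ψ ε t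
      = ∫ x, (ν * (deriv (deriv (U ε t)) x * ψ x) - deriv (fun y => U ε t y ^ 2) x * ψ x -
          U ε t x ^ 2 * deriv ψ x) := by
        refine integral_congr_ae (Eventually.of_forall fun x => ?_)
        simp only [hU.derivWithin_eq ht x]
        ring
    _ = ν * ∫ x, U ε t x * deriv (deriv ψ) x := by
        rw [integral_sub (((integrable_mul_test hu'' hψ).const_mul ν).sub' hint)
            (integrable_mul_test (hu.pow 2).continuous hψ.deriv),
          integral_sub ((integrable_mul_test hu'' hψ).const_mul ν) hint, integral_const_mul,
          hvisc, hflux]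
        ring

lemma tendstoUniformlyOn_weakResidual_viscous {ν : ℝ → ℝ} {M : ℝ} (hψ : IsTest ψ)
    (hν : Tendsto ν (𝓝[>] 0) (𝓝 0))
    (hU : ∀ ε ∈ Ioo (0 : ℝ) 1, IsViscousSolution (ν ε) (U ε))
    (hM : ∀ ε ∈ Ioo (0 : ℝ) 1, ∀ t x, |U ε t x| ≤ M) (T : ℝ) :
    TendstoUniformlyOn (weakResidual U (fun ε t x => U ε t x ^ 2) ψ) (fun _ => 0) (𝓝[>] 0)
      (Icc 0 T) := by
  have hlim : Tendsto (fun ε => |ν ε| * (M * ∫ x, |deriv (deriv ψ) x|)) (𝓝[>] 0) (𝓝 0) := by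
    simpa using hν.abs.mul_const (M * ∫ x, |deriv (deriv ψ) x|)
  rw [Metric.tendstoUniformlyOn_iff]
  intro e he
  filter_upwards [eventually_mem_Ioo, hlim.eventually (gt_mem_nhds he)] with ε hε hlt t ht
  rw [dist_zero_left, Real.norm_eq_abs, weakResidual_viscous hψ ht.1 (hU ε hε), abs_mul]
  refine lt_of_le_of_lt (mul_le_mul_of_nonneg_left ?_ (abs_nonneg _)) hlt
  rw [← integral_const_mul, ← Real.norm_eq_abs]
  refine norm_integral_le_of_norm_le (hψ.deriv.deriv.integrable.norm.const_mul M)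
    (Eventually.of_forall fun x => ?_)
  rw [Real.norm_eq_abs, abs_mul]
  exact mul_le_mul_of_nonneg_right (hM ε hε t x) (abs_nonneg _)

lemma isWeakAsymptotic_viscous {ν : ℝ → ℝ} {g : ℝ → ℝ} {M : ℝ}
    (hν : Tendsto ν (𝓝[>] 0) (𝓝 0))
    (hU : ∀ ε ∈ Ioo (0 : ℝ) 1, IsViscousSolution (ν ε) (U ε))
    (hM : ∀ ε ∈ Ioo (0 : ℝ) 1, ∀ t x, |U ε t x| ≤ M)
    (hg : TendstoDistrib (fun ε => U ε 0) g) :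
    IsWeakAsymptotic U (fun ε t x => U ε t x ^ 2) g where
  differentiable ε hε t ht x := ((hU ε hε t ht).2 x).differentiableWithinAt
  locInt_deriv ε hε t ht := by
    have hu : ContDiff ℝ 2 (U ε t) := (hU ε hε t ht).1
    have hu'' : Continuous (deriv (deriv (U ε t))) :=
      (hu.deriv' : ContDiff ℝ 1 _).continuous_deriv le_rfl
    have hsq' : Continuous (deriv fun y => U ε t y ^ 2) :=
      (hu.pow 2).continuous_deriv (by norm_num)
    simp only [(hU ε hε).derivWithin_eq ht]
    exact ((continuous_const.mul hu'').sub hsq').locallyIntegrable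
  locInt_flux ε hε t ht := ((hU ε hε t ht).1.continuous.pow 2).locallyIntegrable
  residual _ hψ T := tendstoUniformlyOn_weakResidual_viscous hψ hν hU hM T
  initial := hg

end Viscous

section SlowViscosity

/-- A viscosity that vanishes as `ε → 0⁺` more slowly than every power of `ε`. -/
def slowViscosity (ε : ℝ) : ℝ := (1 - Real.log ε)⁻¹

lemma one_lt_one_sub_log {ε : ℝ} (hε : ε ∈ Ioo (0 : ℝ) 1) : 1 < 1 - Real.log ε := by
  linarith [Real.log_neg hε.1 hε.2]

lemma slowViscosity_pos {ε : ℝ} (hε : ε ∈ Ioo (0 : ℝ) 1) : 0 < slowViscosity ε :=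
  inv_pos.2 (zero_lt_one.trans (one_lt_one_sub_log hε))

lemma tendsto_slowViscosity : Tendsto slowViscosity (𝓝[>] 0) (𝓝 0) := by
  refine tendsto_inv_atTop_zero.comp ?_
  simp only [sub_eq_add_neg]
  exact tendsto_const_nhds.add_atTop (tendsto_neg_atBot_atTop.comp Real.tendsto_log_nhdsGT_zero)

lemma inv_slowViscosity_le {ε β : ℝ} (hε : ε ∈ Ioo (0 : ℝ) 1) (hβ : 0 < β) :
    (slowViscosity ε)⁻¹ ≤ (1 + 1 / β) / ε ^ β := by
  have hpow : 1 ≤ 1 / ε ^ β := by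
    rw [one_le_div (Real.rpow_pos_of_pos hε.1 β)]
    exact Real.rpow_le_one hε.1.le hε.2.le hβ.le
  have hlog : -Real.log ε ≤ 1 / β / ε ^ β := by
    have := Real.log_le_rpow_div (inv_nonneg.2 hε.1.le) hβ
    rw [Real.log_inv, Real.inv_rpow hε.1.le] at this
    refine this.trans_eq ?_
    field_simp
  rw [slowViscosity, inv_inv, add_div]
  linarith

end SlowViscosity

section ViscousVelocity

variable {φ u₀ : ℝ → ℝ}

lemma IsTorusLinfty.exists_bound (h : IsTorusLinfty u₀) :
    ∃ M : ℝ, 0 ≤ M ∧ ∀ᵐ x, |u₀ x| ≤ M := by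
  refine ⟨(eLpNorm u₀ ⊤ volume).toReal, ENNReal.toReal_nonneg, ?_⟩
  filter_upwards [ae_le_eLpNormEssSup (f := u₀) (μ := volume)] with x hx
  rw [← eLpNorm_exponent_top] at hx
  simpa using ENNReal.toReal_mono h.2.2.ne hx

lemma tendstoDistrib_mollify (hφ : IsMollifier φ) {δ : ℝ → ℝ}
    (hδ : Tendsto δ (𝓝[>] 0) (𝓝 0)) (hδ0 : ∀ ε ∈ Ioo (0 : ℝ) 1, 0 < δ ε)
    (hloc : LocallyIntegrable u₀) (hp : Function.Periodic u₀ (2 * Real.pi)) :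
    TendstoDistrib (fun ε => mollify φ (δ ε) u₀) u₀ := fun ψ hψ => by
  obtain ⟨C, -, hC⟩ := exists_abs_integral_mollify_mul_sub_le hφ hψ
  have hlim : Tendsto (fun ε => C * δ ε * periodL1 u₀) (𝓝[>] 0) (𝓝 0) := by
    simpa using (hδ.const_mul C).mul_const (periodL1 u₀)
  refine tendsto_iff_norm_sub_tendsto_zero.2
    (squeeze_zero' (Eventually.of_forall fun _ => norm_nonneg _) ?_ hlim)
  filter_upwards [eventually_mem_Ioo, hδ.eventually (gt_mem_nhds one_pos)] with ε hε hδ1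
  exact hC _ _ (hδ0 ε hε) hδ1.le hloc hp

lemma abs_deriv_mollify_le (hφ : IsTest φ) {δ M : ℝ} (hδ : 0 < δ) (hloc : LocallyIntegrable u₀)
    (hM : ∀ᵐ x, |u₀ x| ≤ M) (x : ℝ) :
    |deriv (mollify φ δ u₀) x| ≤ δ⁻¹ * (M * ∫ z, |deriv φ z|) := by
  rw [(hasDerivAt_mollify hφ hδ hloc x).deriv, abs_mul, abs_of_pos (inv_pos.2 hδ)]
  exact mul_le_mul_of_nonneg_left (abs_mollify_le hφ.deriv hδ hM x) (inv_pos.2 hδ).le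

/-- The Cole–Hopf solution with viscosity `slowViscosity ε` and with datum `u₀` mollified at the
same scale. -/
def viscousVelocity (φ u₀ : ℝ → ℝ) (ε : ℝ) : ℝ → ℝ → ℝ :=
  coleHopf (slowViscosity ε) (mollify φ (slowViscosity ε) u₀)

theorem isViscousSolution_viscousVelocity (hφ : IsTest φ) (hu₀ : IsTorusLinfty u₀) {ε : ℝ}
    (hε : ε ∈ Ioo (0 : ℝ) 1) : IsViscousSolution (slowViscosity ε) (viscousVelocity φ u₀ ε) :=
  isViscousSolution_coleHopf
    (contDiff_mollify hφ (slowViscosity_pos hε) (hu₀.2.locallyIntegrable le_top))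
    (mollify_periodic φ _ hu₀.1) (slowViscosity_pos hε)

lemma exists_abs_deriv_viscousVelocity_le (hφ : IsTest φ) (hu₀ : IsTorusLinfty u₀) {β : ℝ}
    (hβ : 0 < β) : ∃ C : ℝ, ∀ ε ∈ Ioo (0 : ℝ) 1, ∀ t x,
      |deriv (viscousVelocity φ u₀ ε t) x| ≤ C / ε ^ β := by
  obtain ⟨M, hM0, hM⟩ := hu₀.exists_bound
  have hloc : LocallyIntegrable u₀ := hu₀.2.locallyIntegrable le_top
  set I := ∫ z, |φ z|
  set I' := ∫ z, |deriv φ z|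
  have : 0 ≤ I' := integral_nonneg fun _ => abs_nonneg _
  refine ⟨(M * I' + 2 * (M * I) ^ 2) * (1 + 1 / β), fun ε hε t x => ?_⟩
  have hν := slowViscosity_pos hε
  calc |deriv (viscousVelocity φ u₀ ε t) x|
      ≤ (slowViscosity ε)⁻¹ * (M * I') + 2 * (M * I) ^ 2 / slowViscosity ε :=
        abs_deriv_coleHopf_le (contDiff_mollify hφ hν hloc) (mollify_periodic φ _ hu₀.1) hν
          (abs_mollify_le hφ hν hM) (abs_deriv_mollify_le hφ hν hloc hM) t x
    _ = (M * I' + 2 * (M * I) ^ 2) * (slowViscosity ε)⁻¹ := by ring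
    _ ≤ (M * I' + 2 * (M * I) ^ 2) * ((1 + 1 / β) / ε ^ β) := by
        gcongr
        exact inv_slowViscosity_le hε hβ
    _ = (M * I' + 2 * (M * I) ^ 2) * (1 + 1 / β) / ε ^ β := by ring

theorem isVelocityFamily_viscousVelocity (hφ : IsMollifier φ) (hu₀ : IsTorusLinfty u₀) {β : ℝ}
    (hβ : 0 < β) : IsVelocityFamily β u₀ (viscousVelocity φ u₀) := by
  obtain ⟨M, -, hM⟩ := hu₀.exists_bound
  have hloc : LocallyIntegrable u₀ := hu₀.2.locallyIntegrable le_top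
  have hsmooth := fun {ε : ℝ} (hε : ε ∈ Ioo (0 : ℝ) 1) =>
    contDiff_mollify hφ.1 (slowViscosity_pos hε) hloc
  have hper := fun ε => mollify_periodic φ (slowViscosity ε) hu₀.1
  have hbound : ∀ ε ∈ Ioo (0 : ℝ) 1, ∀ t x,
      |viscousVelocity φ u₀ ε t x| ≤ M * ∫ z, |φ z| := fun ε hε t x =>
    abs_coleHopf_le (hsmooth hε) (hper ε) (slowViscosity_pos hε)
      (abs_mollify_le hφ.1 (slowViscosity_pos hε) hM) t x
  have hsol := fun ε (hε : ε ∈ Ioo (0 : ℝ) 1) => isViscousSolution_viscousVelocity hφ.1 hu₀ hε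
  obtain ⟨C, hC⟩ := exists_abs_deriv_viscousVelocity_le hφ.1 hu₀ hβ
  refine ⟨fun ε hε => (continuous_coleHopf (hsmooth hε) (hper ε)
      (slowViscosity_pos hε)).continuousOn,
    fun ε hε t _ => periodic_coleHopf _ (hsmooth hε).continuous (hper ε) t,
    fun ε hε t ht => (hsol ε hε t ht).1.differentiable (by norm_num),
    ⟨M * ∫ z, |φ z|, fun ε hε t _ => hbound ε hε t⟩, fun _ => ⟨C, fun ε hε t _ => hC ε hε t⟩,
    isWeakAsymptotic_viscous tendsto_slowViscosity hsol hbound fun ψ hψ => ?_⟩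
  refine (tendstoDistrib_mollify hφ tendsto_slowViscosity
    (fun ε hε => slowViscosity_pos hε) hloc hu₀.1 ψ hψ).congr' ?_
  filter_upwards [eventually_mem_Ioo] with ε hε
  rw [viscousVelocity, coleHopf_zero (slowViscosity_pos hε).ne']

end ViscousVelocity

end WeakAsymptotic

end

theorem theorem2 (φ : ℝ → ℝ) (hφ : WeakAsymptotic.IsMollifier φ)
    (u₀ : ℝ → ℝ) (hu₀ : WeakAsymptotic.IsTorusLinfty u₀) :
    -- suitable velocities exist: viscous solutions with viscosity tending to zero
    (∃ (ν : ℝ → ℝ) (u : ℝ → ℝ → ℝ → ℝ),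
      (∀ ε ∈ Set.Ioo (0 : ℝ) 1, 0 < ν ε ∧ WeakAsymptotic.IsViscousSolution (ν ε) (u ε)) ∧
      Filter.Tendsto ν (nhdsWithin 0 (Set.Ioi 0)) (nhds 0) ∧
      ∀ β : ℝ, 0 < β → WeakAsymptotic.IsVelocityFamily β u₀ u) ∧
    -- for every suitable velocity:
    (∀ (β : ℝ) (u : ℝ → ℝ → ℝ → ℝ), 0 < β → WeakAsymptotic.IsVelocityFamily β u₀ u →
      -- the system with four components
      (∀ (n : ℕ) (α γ : ℝ), β < α → (n + 2) * α < γ → 2 * γ + (n + 2) * α < 1 →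
        ∀ (v₀ w₀ Z₀ : ℝ → ℝ) (v₀ε w₀ε Z₀ε : ℝ → ℝ → ℝ),
          WeakAsymptotic.IsTorusL1 v₀ → WeakAsymptotic.IsRegularization v₀ v₀ε →
          WeakAsymptotic.IsTorusL1 w₀ → WeakAsymptotic.IsRegularization w₀ w₀ε →
          WeakAsymptotic.IsTorusL1 Z₀ → WeakAsymptotic.IsRegularization Z₀ Z₀ε →
          (∃ X w Z : ℝ → ℝ → BoundedContinuousFunction ℝ ℝ,
            WeakAsymptotic.IsFourConstruction φ n α γ u v₀ε w₀ε Z₀ε X w Z) ∧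
          (∀ X w Z X' w' Z' : ℝ → ℝ → BoundedContinuousFunction ℝ ℝ,
            WeakAsymptotic.IsFourConstruction φ n α γ u v₀ε w₀ε Z₀ε X w Z →
            WeakAsymptotic.IsFourConstruction φ n α γ u v₀ε w₀ε Z₀ε X' w' Z' →
            ∀ ε ∈ Set.Ioo (0 : ℝ) 1, ∀ t, 0 ≤ t →
              X ε t = X' ε t ∧ w ε t = w' ε t ∧ Z ε t = Z' ε t) ∧
          (∀ X w Z : ℝ → ℝ → BoundedContinuousFunction ℝ ℝ,
            WeakAsymptotic.IsFourConstruction φ n α γ u v₀ε w₀ε Z₀ε X w Z →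
            WeakAsymptotic.IsWeakAsymptoticFour n u (WeakAsymptotic.smoothed φ α X)
              (fun ε t x => w ε t x) (fun ε t x => Z ε t x) u₀ v₀ w₀ Z₀)) ∧
      -- the systems with `p + 2` components
      (∀ (p : ℕ) (α : ℕ → ℝ), β < α 1 → (∀ k ∈ Set.Icc 1 p, 5 * α k ≤ α (k + 1)) →
        α (p + 1) < 1 →
        ∀ (g : ℕ → ℝ → ℝ) (gε : ℕ → ℝ → ℝ → ℝ), g 0 = u₀ →
          (∀ k ∈ Set.Icc 1 (p + 1), WeakAsymptotic.IsTorusL1 (g k) ∧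
            WeakAsymptotic.IsRegularization (g k) (gε k)) →
          (∃ X : ℕ → ℝ → ℝ → BoundedContinuousFunction ℝ ℝ,
            WeakAsymptotic.IsHierarchyConstruction φ p α u gε X) ∧
          (∀ X X' : ℕ → ℝ → ℝ → BoundedContinuousFunction ℝ ℝ,
            WeakAsymptotic.IsHierarchyConstruction φ p α u gε X →
            WeakAsymptotic.IsHierarchyConstruction φ p α u gε X' →
            ∀ k ∈ Set.Icc 1 (p + 1), ∀ ε ∈ Set.Ioo (0 : ℝ) 1, ∀ t, 0 ≤ t →
              X k ε t = X' k ε t) ∧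
          (∀ X : ℕ → ℝ → ℝ → BoundedContinuousFunction ℝ ℝ,
            WeakAsymptotic.IsHierarchyConstruction φ p α u gε X →
            WeakAsymptotic.IsWeakAsymptoticHierarchy p
              (WeakAsymptotic.hierarchyFamily φ α u X) g))) := by
  refine ⟨⟨WeakAsymptotic.slowViscosity, WeakAsymptotic.viscousVelocity φ u₀,
    fun ε hε => ⟨WeakAsymptotic.slowViscosity_pos hε,
      WeakAsymptotic.isViscousSolution_viscousVelocity hφ.1 hu₀ hε⟩,
    WeakAsymptotic.tendsto_slowViscosity,
    fun β hβ => WeakAsymptotic.isVelocityFamily_viscousVelocity hφ hu₀ hβ⟩,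
    fun β u hβ hu => ⟨?_, ?_⟩⟩
  · intro n α γ hα hγ hγ1 v₀ w₀ Z₀ v₀ε w₀ε Z₀ε _ hv _ hw _ hZ
    exact ⟨WeakAsymptotic.exists_fourConstruction hφ.1 hu hv hw hZ n α γ,
      fun _ _ _ _ _ _ h h' _ hε _ ht => WeakAsymptotic.fourConstruction_unique hu h h' hε ht,
      fun _ _ _ h => WeakAsymptotic.isWeakAsymptoticFour hφ hu hβ hα hγ hγ1 hv hw hZ h⟩
  · intro p α hα h5 hα1 g gε hg0 hg
    have hreg := fun k hk => (hg k hk).2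
    exact ⟨WeakAsymptotic.exists_hierarchyConstruction hφ.1 hu α hreg,
      fun _ _ h h' _ hk _ hε _ ht =>
        WeakAsymptotic.hierarchyConstruction_unique hu h h' hk hε ht,
      fun _ h => WeakAsymptotic.isWeakAsymptoticHierarchy hφ hu hβ hα h5 hα1 hg0 hreg h⟩
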